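/- **Conventions.** Write $e(x)=e^{2\pi i x}$ and $q=e(\tau)$. A discriminant form is a finite abelian group $D$ with a quadratic form $\operatorname{q}:D\to\mathbb Q/\mathbb Z$ whose bilinear form $(\beta,\gamma)=\operatorname{q}(\beta+\gamma)-\operatorname{q}(\beta)-\operatorname{q}(\gamma)$ is non-degenerate. Its level is the smallest positive integer $N$ with $N\operatorname{q}(\gamma)=0$ for all $\gamma\in D$. For an even lattice $L$ with dual $L'$, $L'/L$ is a discriminant form with $\operatorname{q}(\gamma)=\gamma^2/2 \bmod 1$, and $\operatorname{sign}(D)\in\mathbb Z/8\mathbb Z$ is the signature modulo $8$ of any even lattice with discriminant form $D$. $D$ is *regular* if for every prime $p\mid N$ the subgroup $\frac Np D$ contains a non-zero $\gamma$ with $\operatorname{q}(\gamma)=0$; the level and the regularity of $L$ are those of $L'/L$. Let $D$ have even signature and level $N$. The Weil representation $\rho_D$ of $\mathrm{SL}_2(\mathbb Z)$ on $\mathbb C[D]$ is given by $\rho_D(T)e^\gamma=e(-\operatorname{q}(\gamma))e^\gamma$ and $\rho_D(S)e^\gamma=\frac{e(\operatorname{sign}(D)/8)}{\sqrt{|D|}}\sum_{\beta\in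 D}e((\gamma,\beta))e^\beta$, with $S=\left(\begin{smallmatrix}0&-1\\1&0\end{smallmatrix}\right)$, $T=\left(\begin{smallmatrix}1&1\\0&1\end{smallmatrix}\right)$. A modular form of weight $k\in\mathbb Z$ for $\rho_D$ is a holomorphic function $F=\sum_\gamma F_\gamma e^\gamma$ on the upper half-plane, meromorphic at $\infty$, with $F(M\tau)=(c\tau+d)^k\rho_D(M)F(\tau)$ for all $M=\left(\begin{smallmatrix}a&b\\c&d\end{smallmatrix}\right)\in\mathrm{SL}_2(\mathbb Z)$. A component $F_\gamma$ is *singular* if it has a pole at $\infty$. $F$ is *weakly reflective* if (i) $D\cong L'/L$ for an even lattice $L$ of signature $(n,2)$ with $n>2$ and $k=1-n/2$; (ii) for every singular $F_\gamma$ there is a divisor $d\mid N$ such that $d\gamma=0$, $\operatorname{q}(\gamma)=1/d \bmod 1$ and $F_\gamma=c_\gamma q^{-1/d}+\dots$ with $c_\gamma\in\mathbb Q$. $F$ is *reflective* if in addition $F_0=q^{-1}+\dots$ and $F_\gamma=q^{-1/d}+\dots$ for every singular $F_\gamma$. An even lattice $L$ of signature $(n,2)$, $n>2$ even, *carries a reflective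 automorphic product* if there is a reflective modular form $F$ of weight $1-n/2$ for $\rho_{L'/L}$ (the product is then the Borcherds lift $\psi_F$ of $F$). For a prime $p$ let $\nu_p$ be the exponent of $p$ in $N$, put $\mu_p(N)=p^{\nu_p-1}$ if $\nu_p\ge 2$, $\mu_p(N)=p+1$ if $\nu_p=1$, $\mu_p(N)=1$ if $\nu_p=0$, and let $\omega(N)$ be the number of primes $p$ with $\nu_p=1$. **Theorem.** (a) Let $D$ be a regular discriminant form of even signature and level $N$ carrying a weakly reflective modular form $F$ of weight $k$ whose component $F_0$ is singular. Then $$\frac{-k}{12}\prod_{p\mid N}\mu_p(N)\le 2^{\omega(N)}.$$ (b) Let $L$ be a regular even lattice of signature $(n,2)$, $n>2$ and even, carrying a reflective automorphic product. Then the level of $L$ is one of the following (in particular $n$ is one of the listed values): $$\begin{array}{r|l} n & \text{level}\\ \hline 4 & 3,4,6,7,8,9,11,12,14,15,16,18,19,20,21,22,23,24,27,28,30,33,35,36,40,42,44,45,49,60,63,72,75,98,100,121\\ 6 & 2,3,4,5,6,7,8,9,10,11,12,14,15,18,20,25,36\\ 8 & 3,4,6,7,8,9,12\\ 10 & 1,2,3,4,5,6,9\\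 12 & 3,4\\ 14 & 2,3,4\\ 18 & 1,2\\ 26 & 1 \end{array}$$ -/

import Mathlib

open UpperHalfPlane MatrixGroups Manifold Filter Topology

/-! ### Discriminant forms -/

/-- A discriminant form: a finite abelian group `D` with a quadratic form `q : D → ℚ/ℤ` whose
associated bilinear form `(x, y) = q (x + y) - q x - q y` is non-degenerate.
Here `ℚ/ℤ` is `AddCircle (1 : ℚ)`. -/
structure DiscriminantForm (D : Type*) [AddCommGroup D] where
  finite : Finite D
  q : QuadraticMap ℤ D (AddCircle (1 : ℚ))
  nondegenerate : ∀ x, (∀ y, QuadraticMap.polar q x y = 0) → x = 0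

namespace DiscriminantForm

variable {D : Type*} [AddCommGroup D] (A : DiscriminantForm D)

/-- The bilinear form `(x, y) = q (x + y) - q x - q y` with values in `ℚ/ℤ`. -/
def pairing (x y : D) : AddCircle (1 : ℚ) := QuadraticMap.polar A.q x y

/-- The level: the smallest positive integer `N` with `N q(γ) = 0 mod 1` for all `γ`. -/
noncomputable def level : ℕ := sInf {N : ℕ | 0 < N ∧ ∀ γ : D, N • A.q γ = 0}

/-- `D` of level `N` is regular if for each prime `p ∣ N` the subgroup `D^{N/p}`, the image of
multiplication by `N/p`, contains a non-trivial isotropic element. -/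
def IsRegular : Prop :=
  ∀ p : ℕ, p.Prime → p ∣ A.level →
    ∃ γ ∈ Set.range (fun μ : D => (A.level / p) • μ), γ ≠ 0 ∧ A.q γ = 0

/-- The set `D_{d,1/d}` of all `γ` with `d γ = 0` and `q(γ) = 1/d mod 1`. -/
def reflectiveSet (d : ℕ) : Set D :=
  {γ | d • γ = 0 ∧ A.q γ = ((1 / d : ℚ) : AddCircle (1 : ℚ))}

/-- Isomorphism of discriminant forms. -/
def IsIsometric {D' : Type*} [AddCommGroup D'] (A' : DiscriminantForm D') : Prop :=
  ∃ φ : D ≃+ D', ∀ x, A'.q (φ x) = A.q x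

end DiscriminantForm

/-! ### Even lattices -/

/-- An even lattice `L`, realised inside the rational quadratic space `V = L ⊗ ℚ`: a finitely
generated subgroup spanning `V` with `(x, x) ∈ 2ℤ` for all `x ∈ L` (hence `(x, y) ∈ ℤ` for all
`x, y ∈ L`). -/
structure EvenLattice (V : Type*) [AddCommGroup V] [Module ℚ V] where
  form : LinearMap.BilinForm ℚ V
  symm : form.IsSymm
  nondegenerate : form.Nondegenerate
  carrier : Submodule ℤ V
  isLattice : carrier.IsLattice ℚ
  even : ∀ x ∈ carrier, ∃ m : ℤ, form x x = 2 * m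

namespace EvenLattice

variable {V : Type*} [AddCommGroup V] [Module ℚ V] (L : EvenLattice V)

/-- `L` has signature `(n, m)`: the maximal dimension of a positive (resp. negative) definite
subspace of `L ⊗ ℚ` is `n` (resp. `m`). -/
def HasSignature (n m : ℕ) : Prop :=
  sigPos L.form.toQuadraticMap = n ∧ sigNeg L.form.toQuadraticMap = m

/-- The dual lattice `L' = {x ∈ V | (x, y) ∈ ℤ for all y ∈ L}`. -/
def dual : Submodule ℤ V := L.form.dualSubmodule L.carrier

/-- The group `L'/L`. -/
abbrev DiscGroup : Type _ := L.dual ⧸ L.carrier.submoduleOf L.dual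

theorem form_comm (x y : V) : L.form x y = L.form y x := by
  simpa using L.symm.eq x y

theorem exists_basis : ∃ (ι : Type) (_ : Finite ι) (b : Module.Basis ι ℚ V),
    L.carrier = Submodule.span ℤ (Set.range b) := by
  have := L.isLattice
  have hfree : Module.Free ℤ L.carrier := Submodule.IsLattice.free (K := ℚ) L.carrier
  let c := Module.finBasis ℤ L.carrier
  refine ⟨_, inferInstance, c.extendOfIsLattice ℚ, ?_⟩
  have h1 : Set.range (c.extendOfIsLattice ℚ) = L.carrier.subtype '' Set.range c := by
    rw [← Set.range_comp]; congr 1; ext i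
    simp [Module.Basis.extendOfIsLattice_apply]
  rw [h1, Submodule.span_image, c.span_eq]
  simp

theorem mem_dual {x : V} : x ∈ L.dual ↔ ∀ y ∈ L.carrier, ∃ m : ℤ, L.form x y = m := by
  simp only [dual, LinearMap.BilinForm.mem_dualSubmodule, Submodule.mem_one]
  simp [eq_comm]

theorem mem_carrier_of_forall {x : V} (hx : ∀ y ∈ L.dual, ∃ m : ℤ, L.form x y = m) :
    x ∈ L.carrier := by
  obtain ⟨ι, _, b, hb⟩ := L.exists_basis
  have h := LinearMap.BilinForm.dualSubmodule_dualSubmodule_of_basis (R := ℤ) L.form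
    L.nondegenerate L.symm b
  rw [hb, ← h, ← hb, LinearMap.BilinForm.mem_dualSubmodule]
  intro y hy
  obtain ⟨m, hm⟩ := hx y hy
  exact Submodule.mem_one.2 ⟨m, by simp [hm]⟩

theorem carrier_le_dual : L.carrier ≤ L.dual := by
  intro x hx
  rw [mem_dual]
  intro y hy
  obtain ⟨a, ha⟩ := L.even _ (L.carrier.add_mem hx hy)
  obtain ⟨b, hb⟩ := L.even _ hx
  obtain ⟨c, hc⟩ := L.even _ hy
  refine ⟨a - b - c, ?_⟩
  have := L.form_comm x y
  simp only [map_add, LinearMap.add_apply] at ha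
  push_cast
  linarith

theorem exists_smul_mem (x : V) : ∃ n : ℤ, n ≠ 0 ∧ n • x ∈ L.carrier := by
  have hx : x ∈ Submodule.span ℚ (L.carrier : Set V) := by
    rw [L.isLattice.span_eq_top]; trivial
  induction hx using Submodule.span_induction with
  | mem x h => exact ⟨1, one_ne_zero, by simpa using h⟩
  | zero => exact ⟨1, one_ne_zero, by simp⟩
  | add x y _ _ hx hy =>
    obtain ⟨a, ha, hxa⟩ := hx
    obtain ⟨b, hb, hyb⟩ := hy
    refine ⟨a * b, mul_ne_zero ha hb, ?_⟩
    rw [smul_add]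
    refine L.carrier.add_mem ?_ ?_
    · rw [mul_comm, mul_smul]; exact L.carrier.smul_mem _ hxa
    · rw [mul_smul]; exact L.carrier.smul_mem _ hyb
  | smul r x _ hx =>
    obtain ⟨a, ha, hxa⟩ := hx
    refine ⟨a * r.den, mul_ne_zero ha (by exact_mod_cast r.den_ne_zero), ?_⟩
    have : ((a * r.den : ℤ)) • r • x = r.num • (a • x) := by
      simp only [← Int.cast_smul_eq_zsmul ℚ, smul_smul]
      congr 1
      push_cast
      rw [mul_assoc, Rat.den_mul_eq_num, mul_comm]
    rw [this]
    exact L.carrier.smul_mem _ hxa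

theorem finite_discGroup : Finite L.DiscGroup := by
  obtain ⟨ι, _, b, hb⟩ := L.exists_basis
  classical
  have hd : L.dual = Submodule.span ℤ
      (Set.range (L.form.dualBasis L.nondegenerate b)) := by
    rw [dual, hb, LinearMap.BilinForm.dualSubmodule_span_of_basis L.form L.nondegenerate]
  have hfin : Module.Finite ℤ L.dual := by
    rw [Module.Finite.iff_fg, hd]
    exact Submodule.fg_span (Set.finite_range _)
  refine Module.finite_of_fg_torsion _ ?_
  rintro ⟨x⟩
  obtain ⟨n, hn, hx⟩ := L.exists_smul_mem x
  refine ⟨⟨n, mem_nonZeroDivisors_of_ne_zero hn⟩, ?_⟩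
  change Submodule.Quotient.mk (n • x) = 0
  rw [Submodule.Quotient.mk_eq_zero]
  exact hx

/-- The function `x ↦ x²/2 mod 1` on `L'`. -/
noncomputable def normMod (x : L.dual) : AddCircle (1 : ℚ) :=
  ((L.form (x : V) (x : V) / 2 : ℚ) : AddCircle (1 : ℚ))

theorem coe_eq_zero_iff (r : ℚ) : (r : AddCircle (1 : ℚ)) = 0 ↔ ∃ m : ℤ, r = m := by
  rw [AddCircle.coe_eq_zero_iff]
  simp [eq_comm]

theorem normMod_add (x y : L.dual) :
    L.normMod (x + y) =
      L.normMod x + L.normMod y + ((L.form (x : V) y : ℚ) : AddCircle (1 : ℚ)) := by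
  have := L.form_comm x y
  simp only [normMod, ← AddCircle.coe_add]
  congr 1
  simp only [Submodule.coe_add, map_add, LinearMap.add_apply]
  linarith

theorem normMod_congr (x y : L.dual) (h : x - y ∈ L.carrier.submoduleOf L.dual) :
    L.normMod x = L.normMod y := by
  change ((x - y : L.dual) : V) ∈ L.carrier at h
  have h1 : L.normMod (x - y) = 0 := by
    obtain ⟨m, hm⟩ := L.even _ h
    refine (coe_eq_zero_iff _).2 ⟨m, ?_⟩
    have hm' : L.form ((x - y : L.dual) : V) ((x - y : L.dual) : V) = 2 * m := hm
    rw [hm']; ring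
  have h2 : ((L.form (y : V) ((x - y : L.dual) : V) : ℚ) : AddCircle (1 : ℚ)) = 0 :=
    (coe_eq_zero_iff _).2 (L.mem_dual.1 y.2 _ h)
  have := L.normMod_add y (x - y)
  rwa [h1, h2, add_sub_cancel, add_zero, add_zero] at this

/-- The quadratic form `q(γ) = γ²/2 mod 1` on `L'/L`. -/
noncomputable def discQ (γ : L.DiscGroup) : AddCircle (1 : ℚ) :=
  Quotient.liftOn' γ L.normMod fun x y h =>
    L.normMod_congr x y ((Submodule.quotientRel_def _).1 h)

theorem discQ_mk (x : L.dual) :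
    L.discQ (Submodule.Quotient.mk x) = L.normMod x := rfl

theorem polar_discQ (x y : L.dual) :
    QuadraticMap.polar L.discQ (Submodule.Quotient.mk x) (Submodule.Quotient.mk y) =
      ((L.form (x : V) y : ℚ) : AddCircle (1 : ℚ)) := by
  rw [QuadraticMap.polar, ← Submodule.Quotient.mk_add, discQ_mk, discQ_mk, discQ_mk, normMod_add]
  abel

/-- The discriminant form `L'/L` of an even lattice, with `q(γ) = γ²/2 mod 1`. -/
noncomputable def discForm : DiscriminantForm L.DiscGroup where
  finite := L.finite_discGroup
  q := QuadraticMap.ofPolar L.discQ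
    (by
      rintro a ⟨x⟩
      change L.normMod (a • x) = (a * a) • L.normMod x
      rw [normMod, normMod, ← AddCircle.coe_zsmul]
      congr 1
      simp only [Submodule.coe_smul, map_zsmul, LinearMap.smul_apply, zsmul_eq_mul]
      push_cast
      ring)
    (by
      rintro ⟨x⟩ ⟨x'⟩ ⟨y⟩
      refine (L.polar_discQ (x + x') y).trans ?_
      refine Eq.trans ?_ (congrArg₂ (· + ·) (L.polar_discQ x y) (L.polar_discQ x' y)).symm
      simp)
    (by
      rintro a ⟨x⟩ ⟨y⟩
      refine (L.polar_discQ (a • x) y).trans ?_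
      refine Eq.trans ?_ (congrArg (a • ·) (L.polar_discQ x y)).symm
      simp only [← AddCircle.coe_zsmul, Submodule.coe_smul, map_zsmul, LinearMap.smul_apply])
  nondegenerate := by
    rintro ⟨x⟩ hx
    change Submodule.Quotient.mk x = 0
    rw [Submodule.Quotient.mk_eq_zero]
    refine L.mem_carrier_of_forall fun y hy => (coe_eq_zero_iff _).1 ?_
    exact (L.polar_discQ x ⟨y, hy⟩).symm.trans (hx (Submodule.Quotient.mk ⟨y, hy⟩))

theorem discForm_q_mk (x : L.dual) :
    L.discForm.q (Submodule.Quotient.mk x) =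
      ((L.form (x : V) (x : V) / 2 : ℚ) : AddCircle (1 : ℚ)) := rfl

end EvenLattice

/-- `s` represents the signature `sign(D) ∈ ℤ/8ℤ`: the signature modulo `8` of an even lattice with
discriminant form `D`. -/
def DiscriminantForm.HasSignature {D : Type*} [AddCommGroup D] (A : DiscriminantForm D) (s : ℤ) :
    Prop :=
  ∃ (V : Type) (_ : AddCommGroup V) (_ : Module ℚ V) (L : EvenLattice V) (n m : ℕ),
    L.HasSignature n m ∧ L.discForm.IsIsometric A ∧ s ≡ (n : ℤ) - m [ZMOD 8]

/-! ### Modular forms for the Weil representation -/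

/-- The character `e(x) = exp(2πix)` on `ℚ/ℤ`. -/
noncomputable def expQZ : AddCircle (1 : ℚ) → ℂ :=
  Function.Periodic.lift (f := fun r : ℚ => Complex.exp (2 * Real.pi * Complex.I * r)) (c := 1)
    (by
      intro r
      simp only [Rat.cast_add, Rat.cast_one, mul_add, mul_one, Complex.exp_periodic _])

namespace DiscriminantForm

variable {D : Type*} [AddCommGroup D] (A : DiscriminantForm D)

/-- The operator `ρ_D(T)` on `ℂ[D] = (D → ℂ)`, `e^γ ↦ e(-q(γ)) e^γ`. -/
noncomputable def weilT : (D → ℂ) →ₗ[ℂ] (D → ℂ) where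
  toFun v γ := expQZ (-A.q γ) * v γ
  map_add' v w := by ext; simp [mul_add]
  map_smul' c v := by ext; simp; ring

/-- The operator `ρ_D(S)` on `ℂ[D] = (D → ℂ)`, where `sign(D) = s mod 8`:
`e^γ ↦ e(s/8) / √|D| ∑_β e((γ,β)) e^β`. -/
noncomputable def weilS (s : ℤ) : (D → ℂ) →ₗ[ℂ] (D → ℂ) where
  toFun v β := Complex.exp (2 * Real.pi * Complex.I * (s / 8)) / (Real.sqrt (Nat.card D) : ℂ) *
    ∑ᶠ γ : D, expQZ (A.pairing γ β) * v γ
  map_add' v w := by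
    have := A.finite
    ext; simp [mul_add, finsum_add_distrib (Set.toFinite _) (Set.toFinite _)]
  map_smul' c v := by
    have := A.finite
    ext β
    simp only [Pi.smul_apply, smul_eq_mul, RingHom.id_apply]
    rw [mul_left_comm c, ← smul_eq_mul c, smul_finsum]
    congr 2
    ext γ
    simp only [smul_eq_mul]
    ring

/-- `F : ℍ → ℂ[D]` is a modular form of weight `k` for the Weil representation `ρ_D`, where `s`
represents `sign(D)`: it is holomorphic on `ℍ`, meromorphic at `∞` and satisfies
`F(Mτ) = (cτ+d)^k ρ_D(M) F(τ)` for `M ∈ SL₂(ℤ)`. As `S` and `T` generate `SL₂(ℤ)`, it is enough to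
require the transformation law for these, see `transform_iff`. -/
structure IsModularForm (s k : ℤ) (F : ℍ → D → ℂ) : Prop where
  holomorphic : ∀ γ, MDifferentiable 𝓘(ℂ) 𝓘(ℂ) (fun τ => F τ γ)
  transform_S : ∀ τ : ℍ, F (ModularGroup.S • τ) = (τ : ℂ) ^ k • A.weilS s (F τ)
  transform_T : ∀ τ : ℍ, F (ModularGroup.T • τ) = A.weilT (F τ)
  meromorphic : ∀ γ, ∃ m : ℕ,
    IsBoundedAtImInfty (fun τ : ℍ => Complex.exp (2 * Real.pi * Complex.I * m * τ) * F τ γ)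

theorem denom_mul_SL (M N : SL(2, ℤ)) (τ : ℍ) :
    denom ((M * N : SL(2, ℤ)) : GL (Fin 2) ℝ) τ =
      denom (M : GL (Fin 2) ℝ) (N • τ : ℍ) * denom (N : GL (Fin 2) ℝ) τ := by
  have h := denom_cocycle_σ (M : GL (Fin 2) ℝ) (N : GL (Fin 2) ℝ) τ
  have h2 : ((M * N : SL(2, ℤ)) : GL (Fin 2) ℝ) = (M : GL (Fin 2) ℝ) * (N : GL (Fin 2) ℝ) := by
    simp
  rw [h2, h]
  simp [σ]

/-- For the representation `ρ` of `SL₂(ℤ)` on `ℂ[D]` with `ρ(S) = weilS` and `ρ(T) = weilT` (the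
Weil representation), the transformation law holds for all `M` if and only if it holds for `S`
and `T`. -/
theorem transform_iff (s k : ℤ) (F : ℍ → D → ℂ) (ρ : Representation ℂ SL(2, ℤ) (D → ℂ))
    (hS : ρ ModularGroup.S = A.weilS s) (hT : ρ ModularGroup.T = A.weilT) :
    (∀ (M : SL(2, ℤ)) (τ : ℍ),
        F (M • τ) = ((M 1 0 : ℂ) * τ + (M 1 1 : ℂ)) ^ k • ρ M (F τ)) ↔
      (∀ τ : ℍ, F (ModularGroup.S • τ) = (τ : ℂ) ^ k • A.weilS s (F τ)) ∧
        (∀ τ : ℍ, F (ModularGroup.T • τ) = A.weilT (F τ)) := by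
  constructor
  · intro h
    refine ⟨fun τ => ?_, fun τ => ?_⟩
    · rw [h, hS]; simp [ModularGroup.S]
    · rw [h, hT]; simp [ModularGroup.T]
  · rintro ⟨h1, h2⟩ M
    simp only [← ModularGroup.denom_apply]
    have hM : M ∈ Subgroup.closure {ModularGroup.S, ModularGroup.T} := by
      simp [SpecialLinearGroup.SL2Z_generators]
    induction hM using Subgroup.closure_induction with
    | mem M hM =>
      intro τ
      rcases hM with rfl | rfl
      · rw [h1, hS, ModularGroup.denom_apply]; simp [ModularGroup.S]
      · rw [h2, hT, ModularGroup.denom_apply]; simp [ModularGroup.T]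
    | one => intro τ; rw [ModularGroup.denom_apply]; simp
    | mul M N _ _ hM hN =>
      intro τ
      rw [mul_smul, hM, hN, denom_mul_SL, mul_zpow, map_smul, smul_smul, map_mul]
      rfl
    | inv M _ hM =>
      intro τ
      have h := hM (M⁻¹ • τ)
      rw [smul_inv_smul] at h
      have hc : denom (M : GL (Fin 2) ℝ) (M⁻¹ • τ : ℍ) * denom ((M⁻¹ : SL(2, ℤ)) : GL (Fin 2) ℝ) τ
          = 1 := by
        rw [← denom_mul_SL, mul_inv_cancel, ModularGroup.denom_apply]; simp
      have h3 : ρ M⁻¹ (ρ M (F (M⁻¹ • τ))) = F (M⁻¹ • τ) := by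
        rw [← Module.End.mul_apply, ← map_mul]; simp
      rw [h, map_smul, h3, smul_smul, ← mul_zpow, mul_comm, hc, one_zpow, one_smul]

/-- The component `F_γ` is singular, i.e. has a pole at `∞`. -/
def IsSingularAt (F : ℍ → D → ℂ) (γ : D) : Prop :=
  ¬ IsBoundedAtImInfty (fun τ : ℍ => F τ γ)

/-- `F_γ(τ) = c q^{-1/d} + …` where the dots stand for higher order terms, i.e.
`q^{1/d} F_γ(τ) → c` for `τ → i∞`. -/
def HasLeadingTerm (F : ℍ → D → ℂ) (γ : D) (d : ℕ) (c : ℂ) : Prop :=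
  Tendsto (fun τ : ℍ => Complex.exp (2 * Real.pi * Complex.I * τ / d) * F τ γ) atImInfty (𝓝 c)

/-- Weakly reflective modular forms of weight `k` for `ρ_D`, where `s` represents `sign(D)`. -/
structure IsWeaklyReflective (s k : ℤ) (F : ℍ → D → ℂ) : Prop where
  isModularForm : A.IsModularForm s k F
  exists_lattice : ∃ (V : Type) (_ : AddCommGroup V) (_ : Module ℚ V) (L : EvenLattice V) (n : ℕ),
    L.HasSignature n 2 ∧ 2 < n ∧ (k : ℚ) = 1 - n / 2 ∧ L.discForm.IsIsometric A
  pole : ∀ γ, IsSingularAt F γ →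
    ∃ d : ℕ, d ∣ A.level ∧ γ ∈ A.reflectiveSet d ∧ ∃ c : ℚ, HasLeadingTerm F γ d c

/-- Reflective modular forms of weight `k` for `ρ_D`: in addition `F_0 = q^{-1} + …`, and
`F_γ = q^{-1/d} + …` whenever `F_γ` is singular. -/
structure IsReflective (s k : ℤ) (F : ℍ → D → ℂ) : Prop
    extends A.IsWeaklyReflective s k F where
  zero_component : HasLeadingTerm F 0 1 1
  singular_component : ∀ γ, IsSingularAt F γ →
    ∃ d : ℕ, d ∣ A.level ∧ γ ∈ A.reflectiveSet d ∧ HasLeadingTerm F γ d 1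

end DiscriminantForm

/-- `L`, of signature `(n, 2)` with `n` even, carries a reflective automorphic product. By
definition this is the theta lift `ψ_F` of a reflective modular form `F` of weight `1 - n/2` for the
Weil representation of `L'/L`, so the condition is that such an `F` exists. -/
def EvenLattice.CarriesReflectiveProduct {V : Type*} [AddCommGroup V] [Module ℚ V]
    (L : EvenLattice V) (n : ℕ) : Prop :=
  ∃ (k : ℤ) (F : ℍ → L.DiscGroup → ℂ), (k : ℚ) = 1 - n / 2 ∧
    L.discForm.IsReflective ((n : ℤ) - 2) k F

/-! ### The numerical data -/

/-- The local factor `μ_p(N)`, with `ν_p` the exponent of `p` in `N`. -/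
def localFactor (p N : ℕ) : ℕ :=
  if N.factorization p = 0 then 1
  else if N.factorization p = 1 then p + 1
  else p ^ (N.factorization p - 1)

/-- `ω(N)`: the number of primes that are Hall divisors of `N`, i.e. that divide `N` exactly
once. -/
def hallOmega (N : ℕ) : ℕ := {p ∈ N.primeFactors | N.factorization p = 1}.card

/-- The possible levels in signature `(n, 2)`. -/
def levelTable (n : ℕ) : Finset ℕ :=
  if n = 4 then
    {3, 4, 6, 7, 8, 9, 11, 12, 14, 15, 16, 18, 19, 20, 21, 22, 23, 24, 27, 28,
      30, 33, 35, 36, 40, 42, 44, 45, 49, 60, 63, 72, 75, 98, 100, 121}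
  else if n = 6 then {2, 3, 4, 5, 6, 7, 8, 9, 10, 11, 12, 14, 15, 18, 20, 25, 36}
  else if n = 8 then {3, 4, 6, 7, 8, 9, 12}
  else if n = 10 then {1, 2, 3, 4, 5, 6, 9}
  else if n = 12 then {3, 4}
  else if n = 14 then {2, 3, 4}
  else if n = 18 then {1, 2}
  else if n = 26 then {1}
  else ∅

/-! ### A bound for the weight of families of functions permuted by `SL₂(ℤ)` -/

/-! The bound comes from a valence argument for a product of scalar functions $\langle v,F\rangle$,
with one functional $v$ on $\mathbb C[D]$ for each coprime pair $(c,d)$ modulo $N$.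

The Heisenberg operators of $D$ in direction $(c,d)$ commute and fix exactly one line of functionals
(`exists_isFixed`, `IsFixed.unique`); for $(0,1)$ this is the component at $0$. The Weil
representation normalises the Heisenberg group, so $S$ and $T$ permute these lines by
$(c,d)\mapsto(d,-c)$ and $(c,d)\mapsto(c,d+c)$. The product of all the pairings is thus a scalar
form of weight $k$ times the number of pairs, with a multiplier of order dividing 12. Cancelling its
pole by a power of $\Delta$ shows that $-k/12$ is at most the average pole order
(`weight_le_of_permuted_family`).

Regularity makes these pole orders small. Choose $0\ne\gamma_p\in\frac NpD$ isotropic and twist each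
functional by $\prod_p(1-W(\gamma_p))$, where $W$ acts in a complementary direction $(a,b)$. At
$(0,1)$ this adds to $F_0$ only components at non-zero isotropic elements; these are never singular,
so the pairing does not vanish, and neither does any other, by transitivity. Elsewhere the factor at
$p$ removes singular components. Let $p^\nu$ exactly divide $N$. If $p\nmid c$, a surviving
reflective element, with pole order $1/\delta$, has $p^\nu\mid\delta$. If $p\mid c$ but
$p^{\nu-1}\nmid c$, no reflective element survives. Otherwise the trivial bound 1 is used. By the
Chinese remainder theorem the average of these local bounds is a product of factors $2/(p+1)$ for
$\nu=1$ and $p^{1-\nu}$ for $\nu\ge2$, which is (a).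

The only exception is $p=2$, $\nu=3$, where for $2\mid c$, $4\nmid c$ poles of order $1/4$ may
survive. They require a characteristic element of the 2-torsion. As the lattice has even rank, a
parity count (`IsExceptional.false`) then improves the bound for $4\mid c$, $8\nmid c$ from 1 to
$1/2$, and the average is unchanged.

For (b) put $r=-k=n/2-1$. Then (a) gives $r^2N\le144$, a finite problem. Two further restrictions
come from the Gauss sum, which the relation between $S$ and $T$ applied to $F$ evaluates: $8\mid
n-2$ if $N=1$, and $4\mid n-2$ if $-1$ is a square modulo $N$. -/

theorem coe_S_smul (τ : ℍ) : ((ModularGroup.S • τ : ℍ) : ℂ) = -(τ : ℂ)⁻¹ := by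
  rw [UpperHalfPlane.modular_S_smul]
  exact inv_neg

theorem coe_T_smul (τ : ℍ) : ((ModularGroup.T • τ : ℍ) : ℂ) = τ + 1 := by
  rw [UpperHalfPlane.modular_T_smul, UpperHalfPlane.coe_vadd]
  push_cast; ring

theorem add_one_ne_zero (τ : ℍ) : (τ : ℂ) + 1 ≠ 0 := by
  rw [← coe_T_smul]; exact UpperHalfPlane.ne_zero _

theorem coe_ST_smul (τ : ℍ) :
    ((ModularGroup.T • ModularGroup.S • ModularGroup.T • τ : ℍ) : ℂ) * (ModularGroup.T • τ : ℍ) =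
      τ := by
  have := add_one_ne_zero τ
  rw [coe_T_smul, coe_S_smul, coe_T_smul]
  field_simp
  ring

theorem S_smul_S_smul (τ : ℍ) : ModularGroup.S • ModularGroup.S • τ = τ := by
  apply UpperHalfPlane.ext
  rw [coe_S_smul, coe_S_smul]
  simp

theorem TSTST_smul (τ : ℍ) :
    ModularGroup.T • ModularGroup.S • ModularGroup.T • ModularGroup.S • ModularGroup.T • τ =
      ModularGroup.S • τ := by
  apply UpperHalfPlane.ext
  have := add_one_ne_zero τ
  have := UpperHalfPlane.ne_zero τ
  rw [coe_T_smul, coe_S_smul, coe_T_smul, coe_S_smul, coe_T_smul, coe_S_smul]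
  have h : -((τ : ℂ) + 1)⁻¹ + 1 = τ / (τ + 1) := by field_simp; ring
  rw [h]
  field_simp
  ring

theorem denom_T (τ : ℍ) : denom (ModularGroup.T : GL (Fin 2) ℝ) τ = 1 := by
  rw [ModularGroup.denom_apply]
  simp [ModularGroup.T]

-- Multiplication by $\Delta^m$ cancels a pole of order at most $m$, and a holomorphic form of level
-- one and negative weight is zero.
open scoped ModularForm in
theorem weight_nonneg_of_isBigO {g : ℍ → ℂ} {K : ℤ} {m : ℕ}
    (hol : MDifferentiable 𝓘(ℂ) 𝓘(ℂ) g)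
    (hS : ∀ τ : ℍ, g (ModularGroup.S • τ) = (τ : ℂ) ^ K * g τ)
    (hT : ∀ τ : ℍ, g (ModularGroup.T • τ) = g τ)
    (hO : g =O[atImInfty] fun τ => Real.exp (2 * Real.pi * m * τ.im))
    (hne : ∃ τ, g τ ≠ 0) : 0 ≤ K + 12 * m := by
  by_contra hlt
  push Not at hlt
  have hΔS (τ : ℍ) : ModularForm.discriminant (ModularGroup.S • τ) =
      (τ : ℂ) ^ (12 : ℤ) * ModularForm.discriminant τ := by
    have h := congrFun ModularForm.discriminant_S_invariant τ
    rw [ModularForm.SL_slash_apply, ModularGroup.denom_S] at h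
    have := UpperHalfPlane.ne_zero τ
    rw [← h]
    field_simp
  have hΔT (τ : ℍ) : ModularForm.discriminant (ModularGroup.T • τ) =
      ModularForm.discriminant τ := by
    have h := congrFun ModularForm.discriminant_T_invariant τ
    rwa [ModularForm.SL_slash_apply, denom_T, one_zpow, mul_one] at h
  let G : ℍ → ℂ := fun τ => g τ * ModularForm.discriminant τ ^ m
  have hGS : G ∣[K + 12 * m] ModularGroup.S = G := by
    ext τ
    have h0 := UpperHalfPlane.ne_zero τ
    rw [ModularForm.SL_slash_apply, ModularGroup.denom_S]
    simp only [G]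
    rw [hS, hΔS, mul_pow, zpow_neg, zpow_add₀ h0, zpow_mul, zpow_natCast]
    field_simp
  have hGT : G ∣[K + 12 * m] ModularGroup.T = G := by
    ext τ
    rw [ModularForm.SL_slash_apply, denom_T, one_zpow, mul_one]
    simp only [G]
    rw [hT, hΔT]
  have hinv := SlashInvariantForm.slash_action_generators_SL2Z hGS hGT
  have hΔO : (ModularForm.discriminant : ℍ → ℂ) =O[atImInfty]
      fun τ => Real.exp (-2 * Real.pi * τ.im) := by
    have := CuspFormClass.exp_decay_atImInfty (h := 1) CuspForm.discriminant one_pos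
      one_mem_strictPeriods_SL
    simpa using this
  have hbdd : IsBoundedAtImInfty G := by
    have h := hO.mul (hΔO.pow m)
    refine h.trans (Asymptotics.isBigO_of_le _ fun τ => ?_)
    rw [← Real.exp_nat_mul, ← Real.exp_add]
    have : 2 * Real.pi * m * τ.im + m * (-2 * Real.pi * τ.im) = 0 := by ring
    rw [this, Real.exp_zero]
    simp
  have hGhol : MDifferentiable 𝓘(ℂ) 𝓘(ℂ) G := by
    have h1 : MDifferentiable 𝓘(ℂ) 𝓘(ℂ) (ModularForm.discriminant : ℍ → ℂ) :=
      CuspForm.discriminant.holo'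
    exact hol.mul (h1.pow m)
  let GF : ModularForm 𝒮ℒ (K + 12 * m) :=
    { toFun := G
      slash_action_eq' := by
        rintro A ⟨A, rfl⟩
        exact hinv A
      holo' := hGhol
      bdd_at_cusps' := by
        intro c hc
        rw [Subgroup.IsArithmetic.isCusp_iff_isCusp_SL2Z] at hc
        rw [OnePoint.isBoundedAt_iff_forall_SL2Z hc]
        intro γ _
        rw [hinv]
        exact hbdd }
  have h0 : (GF : ℍ → ℂ) = 0 := ModularFormClass.levelOne_neg_weight_eq_zero hlt GF
  obtain ⟨τ, hτ⟩ := hne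
  have h1 : G τ = 0 := congrFun h0 τ
  exact mul_ne_zero hτ (pow_ne_zero _ (ModularForm.discriminant_ne_zero τ)) h1

/-- On the upper half-plane $S^2=1$ and $TSTST=S$, which give $C^2(-1)^K=1$ and $CC'^3=1$. Hence
$C^4=1$ and $C'^{12}=1$. -/
theorem multiplier_pow_twelve {G : ℍ → ℂ} {K : ℤ} {C C' : ℂ}
    (hS : ∀ τ : ℍ, G (ModularGroup.S • τ) = C * (τ : ℂ) ^ K * G τ)
    (hT : ∀ τ : ℍ, G (ModularGroup.T • τ) = C' * G τ)
    (hne : ∃ τ, G τ ≠ 0) : C ^ 12 = 1 ∧ C' ^ 12 = 1 := by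
  obtain ⟨τ, hτ⟩ := hne
  have h0 := UpperHalfPlane.ne_zero τ
  have h1 : C ^ 2 * (-1) ^ K = 1 := by
    have h := congrArg G (S_smul_S_smul τ)
    rw [hS, hS, coe_S_smul] at h
    have h2 : (-(τ : ℂ)⁻¹) ^ K * (τ : ℂ) ^ K = (-1) ^ K := by
      rw [← mul_zpow]; congr 1; field_simp
    apply mul_right_cancel₀ hτ
    linear_combination h - C ^ 2 * G τ * h2
  have h3 : C ^ 4 = 1 := by
    have h4 : ((-1 : ℂ) ^ K) ^ 2 = 1 := by
      rw [← zpow_natCast, zpow_comm]; simp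
    linear_combination (C ^ 2 * (-1) ^ K + 1) * h1 - C ^ 4 * h4
  have hC : C ≠ 0 := by rintro rfl; norm_num at h3
  have h5 : C * C' ^ 3 = 1 := by
    have h := congrArg G (TSTST_smul τ)
    rw [hT, hS, hT, hS, hT, hS] at h
    have h2 := coe_ST_smul τ
    apply_fun (· ^ K) at h2
    simp only [mul_zpow] at h2
    apply mul_left_cancel₀ hC
    apply mul_right_cancel₀ (mul_ne_zero (zpow_ne_zero K h0) hτ)
    linear_combination h - C' ^ 3 * C ^ 2 * G τ * h2
  refine ⟨by linear_combination (C ^ 8 + C ^ 4 + 1) * h3, ?_⟩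
  have : C ^ 4 * C' ^ 12 = 1 := by
    linear_combination ((C * C' ^ 3) ^ 3 + (C * C' ^ 3) ^ 2 + C * C' ^ 3 + 1) * h5
  rwa [h3, one_mul] at this

theorem mdifferentiable_prod_ne_zero {ι : Type*} (s : Finset ι) (f : ι → ℍ → ℂ)
    (hol : ∀ i, MDifferentiable 𝓘(ℂ) 𝓘(ℂ) (f i)) (hne : ∀ i, ∃ τ, f i τ ≠ 0) :
    MDifferentiable 𝓘(ℂ) 𝓘(ℂ) (fun τ => ∏ i ∈ s, f i τ) ∧ ∃ τ, ∏ i ∈ s, f i τ ≠ 0 := by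
  classical
  induction s using Finset.induction_on with
  | empty => exact ⟨by simpa using mdifferentiable_const, ⟨I, by simp⟩⟩
  | insert a s ha ih =>
    have hmul : MDifferentiable 𝓘(ℂ) 𝓘(ℂ) (fun τ => f a τ * ∏ i ∈ s, f i τ) :=
      (hol a).mul ih.1
    simp only [Finset.prod_insert ha]
    refine ⟨hmul, ?_⟩
    by_contra! h
    have := (UpperHalfPlane.mul_eq_zero_iff (hol a) ih.1).1 (funext h)
    rcases this with h | h
    · obtain ⟨τ, hτ⟩ := hne a; exact hτ (congrFun h τ)
    · obtain ⟨τ, hτ⟩ := ih.2; exact hτ (congrFun h τ)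

/-- The product of the family is a scalar form up to multipliers, since $S$ and $T$ only permute its
factors. -/
theorem weight_le_of_permuted_family {ι : Type*} [Fintype ι] (f : ι → ℍ → ℂ) (k : ℤ)
    (σ θ : ι ≃ ι) (hol : ∀ i, MDifferentiable 𝓘(ℂ) 𝓘(ℂ) (f i)) (hne : ∀ i, ∃ τ, f i τ ≠ 0)
    (hS : ∀ i, ∃ c : ℂ, ∀ τ : ℍ, f i (ModularGroup.S • τ) = c * (τ : ℂ) ^ k * f (σ i) τ)
    (hT : ∀ i, ∃ c : ℂ, ∀ τ : ℍ, f i (ModularGroup.T • τ) = c * f (θ i) τ)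
    (w : ι → ℚ) (hw : ∀ i, 0 ≤ w i)
    (hO : ∀ i, f i =O[atImInfty] fun τ => Real.exp (2 * Real.pi * w i * τ.im)) :
    -(k : ℚ) / 12 * Fintype.card ι ≤ ∑ i, w i := by
  choose c hc using hS
  choose c' hc' using hT
  obtain ⟨hGhol, hGne⟩ := mdifferentiable_prod_ne_zero Finset.univ f hol hne
  set G : ℍ → ℂ := fun τ => ∏ i, f i τ with hG
  have hGS (τ : ℍ) : G (ModularGroup.S • τ) =
      (∏ i, c i) * (τ : ℂ) ^ (k * Fintype.card ι) * G τ := by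
    simp only [hG, hc, Finset.prod_mul_distrib, Finset.prod_const, Finset.card_univ]
    rw [Equiv.prod_comp σ (fun i => f i τ), zpow_mul, zpow_natCast]
  have hGT (τ : ℍ) : G (ModularGroup.T • τ) = (∏ i, c' i) * G τ := by
    simp only [hG, hc', Finset.prod_mul_distrib]
    rw [Equiv.prod_comp θ (fun i => f i τ)]
  obtain ⟨h1, h2⟩ := multiplier_pow_twelve hGS hGT hGne
  set W := ∑ i, w i with hW
  have hWn : 0 ≤ W := Finset.sum_nonneg fun i _ => hw i
  have hnum : ((W.num.toNat : ℕ) : ℚ) = W * W.den := by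
    rw [Rat.mul_den_eq_num]
    have : ((W.num.toNat : ℕ) : ℤ) = W.num := Int.toNat_of_nonneg (Rat.num_nonneg.2 hWn)
    exact_mod_cast congrArg (Int.cast : ℤ → ℚ) this
  have hGO : G =O[atImInfty] fun τ => Real.exp (2 * Real.pi * W * τ.im) := by
    have h := Asymptotics.IsBigO.finsetProd (s := Finset.univ) fun i _ => hO i
    refine h.trans (Asymptotics.isBigO_of_le _ fun τ => le_of_eq ?_)
    rw [← Real.exp_sum, hW]
    congr 2
    push_cast
    rw [Finset.mul_sum, Finset.sum_mul]
  -- The exponent 12 removes the multipliers, and the denominator of $W$ makes the pole order an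
  -- integer.
  have key := weight_nonneg_of_isBigO (g := fun τ => G τ ^ (12 * W.den))
    (K := k * Fintype.card ι * (12 * W.den : ℕ)) (m := 12 * W.num.toNat)
    (hGhol.pow _)
    (fun τ => by
      rw [hGS, mul_pow, mul_pow, pow_mul, h1, one_pow, one_mul]
      congr 1
      rw [← zpow_natCast, ← zpow_mul])
    (fun τ => by
      rw [hGT, mul_pow, pow_mul, h2, one_pow, one_mul])
    (by
      refine (hGO.pow (12 * W.den)).trans (Asymptotics.isBigO_of_le _ fun τ => le_of_eq ?_)
      rw [← Real.exp_nat_mul]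
      congr 2
      have : ((W.num.toNat : ℕ) : ℝ) = W * W.den := by
        exact_mod_cast congrArg (Rat.cast : ℚ → ℝ) hnum
      push_cast
      rw [this]; ring)
    (by
      obtain ⟨τ, hτ⟩ := hGne
      exact ⟨τ, pow_ne_zero _ hτ⟩)
  have key' : (0 : ℚ) ≤ k * Fintype.card ι * (12 * W.den) + 12 * (12 * W.num.toNat : ℕ) := by
    exact_mod_cast key
  push_cast at key'
  rw [hnum] at key'
  have hden : (0 : ℚ) < W.den := by exact_mod_cast W.den_pos
  have : 0 ≤ (k * Fintype.card ι + 12 * W) * (12 * W.den) := by linarith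
  have := nonneg_of_mul_nonneg_left this (by positivity)
  linarith

/-! ### The character of `ℚ/ℤ` -/

theorem expQZ_coe (r : ℚ) :
    expQZ (r : AddCircle (1 : ℚ)) = Complex.exp (2 * Real.pi * Complex.I * r) := rfl

theorem expQZ_add (x y : AddCircle (1 : ℚ)) : expQZ (x + y) = expQZ x * expQZ y := by
  induction x using QuotientAddGroup.induction_on with | _ a
  induction y using QuotientAddGroup.induction_on with | _ b
  rw [← AddCircle.coe_add, expQZ_coe, expQZ_coe, expQZ_coe, ← Complex.exp_add]
  push_cast
  ring_nf

@[simp]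
theorem expQZ_zero : expQZ 0 = 1 := by
  have := expQZ_coe 0
  simpa using this

theorem expQZ_eq_one_iff {x : AddCircle (1 : ℚ)} : expQZ x = 1 ↔ x = 0 := by
  induction x using QuotientAddGroup.induction_on with | _ a
  rw [expQZ_coe, Complex.exp_eq_one_iff, EvenLattice.coe_eq_zero_iff]
  refine exists_congr fun n => ?_
  have h : (2 * Real.pi * Complex.I : ℂ) ≠ 0 := by simp [Real.pi_ne_zero]
  rw [mul_comm, mul_left_inj' h]
  norm_cast

theorem expQZ_ne_zero (x : AddCircle (1 : ℚ)) : expQZ x ≠ 0 := fun h => by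
  have := expQZ_add x (-x)
  simp [h] at this

theorem expQZ_neg (x : AddCircle (1 : ℚ)) : expQZ (-x) = (expQZ x)⁻¹ := by
  refine eq_inv_of_mul_eq_one_left ?_
  rw [← expQZ_add]
  simp

theorem conj_expQZ (x : AddCircle (1 : ℚ)) :
    (starRingEnd ℂ) (expQZ x) = expQZ (-x) := by
  induction x using QuotientAddGroup.induction_on with | _ a
  rw [← AddCircle.coe_neg, expQZ_coe, expQZ_coe, ← Complex.exp_conj]
  congr 1
  simp only [map_mul, Complex.conj_ofReal, Complex.conj_I, map_ofNat, map_ratCast, Rat.cast_neg]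
  ring

/-- Characters of a group with values in `ℚ/ℤ`, as complex characters. -/
noncomputable def expChar {G : Type*} [AddCommGroup G] (f : G →+ AddCircle (1 : ℚ)) :
    AddChar G ℂ where
  toFun x := expQZ (f x)
  map_zero_eq_one' := by simp
  map_add_eq_mul' x y := by rw [map_add, expQZ_add]

theorem expChar_apply {G : Type*} [AddCommGroup G] (f : G →+ AddCircle (1 : ℚ)) (x : G) :
    expChar f x = expQZ (f x) := rfl

theorem expChar_injective {G : Type*} [AddCommGroup G] :
    Function.Injective (expChar (G := G)) := by
  intro f g h
  ext x
  have h1 : expQZ (f x) = expQZ (g x) := DFunLike.congr_fun h x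
  rw [← sub_eq_zero, ← expQZ_eq_one_iff, sub_eq_add_neg, expQZ_add, expQZ_neg, h1,
    mul_inv_cancel₀ (expQZ_ne_zero _)]

theorem sum_expQZ {G : Type*} [AddCommGroup G] [Fintype G] (f : G →+ AddCircle (1 : ℚ)) :
    ∑ x, expQZ (f x) = if f = 0 then (Fintype.card G : ℂ) else 0 := by
  classical
  have h := AddChar.sum_eq_ite (expChar f)
  have h0 : expChar f = 0 ↔ f = 0 := by
    rw [← expChar_injective.eq_iff (b := 0)]
    have : expChar (0 : G →+ AddCircle (1 : ℚ)) = 0 := by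
      ext x; simp [expChar_apply]
    rw [this]
  simp only [h0] at h
  exact h

/-- In a pairing `A × B → ℚ/ℤ` that is injective on `A`, the group `A` is at most as large as
`B`. -/
theorem card_le_of_injective_pairing {G H : Type*} [AddCommGroup G] [AddCommGroup H] [Finite H]
    (B : G →+ H →+ AddCircle (1 : ℚ)) (hB : Function.Injective B) :
    Finite G ∧ Nat.card G ≤ Nat.card H := by
  have hinj : Function.Injective fun x => expChar (B x) := expChar_injective.comp hB
  cases nonempty_fintype H
  have hc : Nat.card (AddChar H ℂ) = Nat.card H := by
    rw [Nat.card_eq_fintype_card, Nat.card_eq_fintype_card, AddChar.card_eq]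
  exact ⟨Finite.of_injective _ hinj, hc ▸ Nat.card_le_card_of_injective _ hinj⟩

/-! ### Discriminant forms -/

namespace DiscriminantForm

variable {D : Type*} [AddCommGroup D] (A : DiscriminantForm D)

/-- The bilinear form as a bi-additive map. -/
noncomputable def pairingHom : D →+ D →+ AddCircle (1 : ℚ) :=
  AddMonoidHom.mk' (fun x => AddMonoidHom.mk' (A.pairing x)
      (fun y z => A.q.polar_add_right x y z))
    (fun x y => by ext z; exact A.q.polar_add_left x y z)

theorem pairingHom_apply (x y : D) : A.pairingHom x y = A.pairing x y := rfl

theorem pairing_add_left (x y z : D) : A.pairing (x + y) z = A.pairing x z + A.pairing y z :=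
  A.q.polar_add_left x y z

theorem pairing_add_right (x y z : D) : A.pairing x (y + z) = A.pairing x y + A.pairing x z :=
  A.q.polar_add_right x y z

theorem pairing_zsmul_left (n : ℤ) (x y : D) : A.pairing (n • x) y = n • A.pairing x y :=
  A.q.polar_smul_left n x y

theorem pairing_zsmul_right (n : ℤ) (x y : D) : A.pairing x (n • y) = n • A.pairing x y :=
  A.q.polar_smul_right n x y

theorem pairing_nsmul_left (n : ℕ) (x y : D) : A.pairing (n • x) y = n • A.pairing x y := by
  simpa using A.pairing_zsmul_left n x y

theorem pairing_nsmul_right (n : ℕ) (x y : D) : A.pairing x (n • y) = n • A.pairing x y := by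
  simpa using A.pairing_zsmul_right n x y

@[simp]
theorem pairing_zero_left (y : D) : A.pairing 0 y = 0 := by
  simpa using A.pairing_zsmul_left 0 0 y

@[simp]
theorem pairing_zero_right (y : D) : A.pairing y 0 = 0 := by
  simpa using A.pairing_zsmul_right 0 y 0

theorem pairing_neg_right (x y : D) : A.pairing x (-y) = -A.pairing x y := by
  simpa using A.pairing_zsmul_right (-1) x y

theorem pairing_sub_right (x y z : D) : A.pairing x (y - z) = A.pairing x y - A.pairing x z := by
  rw [sub_eq_add_neg, pairing_add_right, pairing_neg_right, sub_eq_add_neg]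

theorem pairing_comm (x y : D) : A.pairing x y = A.pairing y x :=
  QuadraticMap.polar_comm A.q x y

theorem q_add (x y : D) : A.q (x + y) = A.q x + A.q y + A.pairing x y :=
  QuadraticMap.map_add A.q x y

theorem q_zsmul (n : ℤ) (x : D) : A.q (n • x) = (n * n) • A.q x :=
  A.q.map_smul n x

theorem q_nsmul (n : ℕ) (x : D) : A.q (n • x) = (n * n) • A.q x := by
  have := A.q_zsmul n x
  rw [natCast_zsmul] at this
  rw [this, ← Nat.cast_mul, natCast_zsmul]

theorem pairing_self (x : D) : A.pairing x x = 2 • A.q x := by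
  have h := A.q_add x x
  rw [← two_nsmul, q_nsmul] at h
  have h2 : (2 * 2) • A.q x = 2 • A.q x + 2 • A.q x := by rw [← add_nsmul]
  rw [h2, two_nsmul] at h
  rw [two_nsmul]
  exact (add_left_cancel h).symm

theorem q_zero : A.q 0 = 0 := QuadraticMap.map_zero A.q

theorem pairing_eq_zero_of_nsmul {m n : ℕ} {x y : D} (hx : m • A.pairing x y = 0)
    (hy : n • A.pairing x y = 0) (h : m.Coprime n) : A.pairing x y = 0 := by
  have h1 := addOrderOf_dvd_of_nsmul_eq_zero hx
  have h2 := addOrderOf_dvd_of_nsmul_eq_zero hy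
  have h3 : addOrderOf (A.pairing x y) = 1 := Nat.eq_one_of_dvd_coprimes h h1 h2
  simpa using h3

theorem level_spec : 0 < A.level ∧ ∀ γ : D, A.level • A.q γ = 0 := by
  refine Nat.sInf_mem (s := {N : ℕ | 0 < N ∧ ∀ γ : D, N • A.q γ = 0}) ?_
  have := A.finite
  refine ⟨2 * Nat.card D, by have := Nat.card_pos (α := D); positivity, fun γ => ?_⟩
  rw [mul_comm, mul_nsmul', ← pairing_self, ← pairing_nsmul_left, card_nsmul_eq_zero',
    pairing_zero_left]

theorem level_pos : 0 < A.level := A.level_spec.1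

theorem level_nsmul_q (x : D) : A.level • A.q x = 0 := A.level_spec.2 x

theorem level_nsmul_pairing (x y : D) : A.level • A.pairing x y = 0 := by
  have h := congrArg (A.level • ·) (A.q_add x y)
  simpa [level_nsmul_q] using h.symm

theorem level_nsmul (x : D) : A.level • x = 0 :=
  A.nondegenerate _ fun y => by
    change A.pairing _ _ = 0
    rw [pairing_nsmul_left, level_nsmul_pairing]

theorem zsmul_q_congr {m n : ℤ} (h : m ≡ n [ZMOD A.level]) (x : D) : m • A.q x = n • A.q x := by
  obtain ⟨t, ht⟩ := h.symm.dvd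
  rw [← sub_eq_zero, ← sub_smul, ht, mul_comm, mul_zsmul, natCast_zsmul, level_nsmul_q,
    zsmul_zero]

theorem zsmul_congr {m n : ℤ} (h : m ≡ n [ZMOD A.level]) (x : D) : m • x = n • x := by
  obtain ⟨t, ht⟩ := h.symm.dvd
  rw [← sub_eq_zero, ← sub_smul, ht, mul_comm, mul_zsmul, natCast_zsmul, level_nsmul,
    zsmul_zero]

theorem zsmul_pairing_congr {m n : ℤ} (h : m ≡ n [ZMOD A.level]) (x y : D) :
    m • A.pairing x y = n • A.pairing x y := by
  rw [← pairing_zsmul_left, ← pairing_zsmul_left, A.zsmul_congr h]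

/-- A subgroup is its own double orthogonal complement. -/
theorem mem_of_forall_pairing (H : AddSubgroup D) (y : D)
    (hy : ∀ x, (∀ h ∈ H, A.pairing x h = 0) → A.pairing x y = 0) : y ∈ H := by
  have := A.finite
  cases nonempty_fintype D
  by_contra hyH
  have hne : (QuotientAddGroup.mk y : D ⧸ H) ≠ 0 := by
    rwa [Ne, QuotientAddGroup.eq_zero_iff]
  obtain ⟨ψ, hψ⟩ := AddChar.exists_apply_ne_zero.2 hne
  have hinj : Function.Injective fun x => expChar (A.pairingHom x) := by
    refine expChar_injective.comp ((injective_iff_map_eq_zero _).2 fun x hx => ?_)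
    exact A.nondegenerate x fun z => DFunLike.congr_fun hx z
  have hsurj : Function.Surjective fun x => expChar (A.pairingHom x) := by
    classical
    refine ((Fintype.bijective_iff_injective_and_card _).2 ⟨hinj, ?_⟩).2
    exact AddChar.card_eq.symm
  obtain ⟨x, hx⟩ := hsurj (ψ.compAddMonoidHom (QuotientAddGroup.mk' H))
  have hx' (z : D) : expQZ (A.pairing x z) = ψ (QuotientAddGroup.mk z) :=
    DFunLike.congr_fun hx z
  refine hψ ?_
  rw [← hx', hy x fun h hh => ?_, expQZ_zero]
  rw [← expQZ_eq_one_iff, hx', (QuotientAddGroup.eq_zero_iff h).2 hh, AddChar.map_zero_eq_one]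

/-- This is $D[n]^\perp=nD$: by non-degeneracy $(nD)^\perp=D[n]$, and a subgroup is its own double
complement. -/
theorem exists_eq_zsmul (n : ℤ) (y : D) (hy : ∀ x, n • x = 0 → A.pairing x y = 0) :
    ∃ w, y = n • w := by
  have h := A.mem_of_forall_pairing (zsmulAddGroupHom n).range y fun x hx => hy x ?_
  · obtain ⟨w, hw⟩ := h
    exact ⟨w, hw.symm⟩
  · refine A.nondegenerate _ fun z => ?_
    change A.pairing _ _ = 0
    rw [pairing_zsmul_left, ← pairing_zsmul_right]
    exact hx _ ⟨z, rfl⟩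

theorem zsmul_eq_zero_of_coprime {a b c d : ℤ} (hdet : a * d - b * c ≡ 1 [ZMOD A.level]) {x : D}
    (hc : c • x = 0) (hd : d • x = 0) : x = 0 := by
  have h := A.zsmul_congr hdet x
  rw [one_zsmul, sub_smul, mul_zsmul, mul_zsmul, hc, hd] at h
  simpa using h.symm

/-! ### Eigenfunctionals of the Heisenberg group -/

/-- The functionals on `ℂ[D]` that are fixed by the Heisenberg operators in direction `(c, d)`. -/
def IsFixed (c d : ℤ) (ℓ : D → ℂ) : Prop :=
  ∀ x y, ℓ y = expQZ ((c * d) • A.q x + d • A.pairing x y) * ℓ (y + c • x)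

variable {A}

theorem IsFixed.congr {c d c' d' : ℤ} {ℓ : D → ℂ} (h : A.IsFixed c d ℓ)
    (hc : c ≡ c' [ZMOD A.level]) (hd : d ≡ d' [ZMOD A.level]) : A.IsFixed c' d' ℓ := by
  intro x y
  rw [← A.zsmul_q_congr (hc.mul hd), ← A.zsmul_pairing_congr hd, ← A.zsmul_congr hc]
  exact h x y

/-- Conjugation by $T$ shears the direction of a Heisenberg operator; conjugation by $S$, in the
next lemma, rotates it. -/
theorem IsFixed.weilT {c d : ℤ} {ℓ : D → ℂ} (h : A.IsFixed c d ℓ) :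
    A.IsFixed c (d + c) fun y => expQZ (-A.q y) * ℓ y := by
  intro x y
  simp only
  rw [h x y, ← mul_assoc, ← mul_assoc, ← expQZ_add, ← expQZ_add, A.q_add, A.q_zsmul,
    A.pairing_zsmul_right, A.pairing_comm y x]
  congr 2
  module

theorem IsFixed.weilS [Fintype D] {c d : ℤ} {ℓ : D → ℂ} (h : A.IsFixed c d ℓ) (C : ℂ) :
    A.IsFixed d (-c) fun y => C * ∑ β, expQZ (A.pairing y β) * ℓ β := by
  intro x y
  simp only
  rw [mul_left_comm]
  congr 1
  rw [← Equiv.sum_comp (Equiv.addRight (c • x))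
    (fun β => expQZ (A.pairing (y + d • x) β) * ℓ β), Finset.mul_sum]
  refine Finset.sum_congr rfl fun β _ => ?_
  simp only [Equiv.coe_addRight]
  rw [h x β, ← mul_assoc, ← mul_assoc, ← expQZ_add, ← expQZ_add, A.pairing_add_left,
    A.pairing_add_right, A.pairing_add_right, A.pairing_zsmul_left, A.pairing_zsmul_left,
    A.pairing_zsmul_right, A.pairing_zsmul_right, A.pairing_self, A.pairing_comm x y]
  congr 2
  module

theorem IsFixed.pairing_eq {c d : ℤ} {ℓ : D → ℂ} (h : A.IsFixed c d ℓ) {x y : D}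
    (hy : ℓ y ≠ 0) (hx : c • x = 0) : (c * d) • A.q x + d • A.pairing x y = 0 := by
  have := h x y
  rw [hx, add_zero] at this
  rw [← expQZ_eq_one_iff]
  exact (mul_eq_right₀ hy).1 this.symm

/-- Fixedness determines $\ell$ on a coset of $cD$ from one value. The support is a single coset: if
$z$ is the difference of two of its points and $cx=0$, then $c(x,z)=d(x,z)=0$, so $(x,z)=0$ by
coprimality, and $z\in D[c]^\perp=cD$. -/
theorem IsFixed.unique {a b c d : ℤ} (hdet : a * d - b * c ≡ 1 [ZMOD A.level]) {ℓ ℓ' : D → ℂ}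
    (h : A.IsFixed c d ℓ) (h' : A.IsFixed c d ℓ') (hℓ : ∃ y, ℓ y ≠ 0) :
    ∃ C : ℂ, ∀ y, ℓ' y = C * ℓ y := by
  obtain ⟨y₀, hy₀⟩ := hℓ
  have key {f : D → ℂ} (hf : A.IsFixed c d f) {y : D} (hy : f y ≠ 0) : ∃ w, y = y₀ + c • w := by
    obtain ⟨w, hw⟩ := A.exists_eq_zsmul c (y - y₀) fun x hx => by
      have h1 := h.pairing_eq hy₀ hx
      have h2 := hf.pairing_eq hy hx
      have h3 : d • A.pairing x (y - y₀) = 0 := by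
        rw [A.pairing_sub_right, zsmul_sub, sub_eq_zero]
        exact add_left_cancel (h2.trans h1.symm)
      have h4 : c • A.pairing x (y - y₀) = 0 := by
        rw [← A.pairing_zsmul_left, hx, A.pairing_zero_left]
      have h5 := A.zsmul_pairing_congr hdet x (y - y₀)
      rw [one_zsmul, sub_smul, mul_zsmul, mul_zsmul, h3, h4] at h5
      simpa using h5.symm
    exact ⟨w, by rw [← hw]; abel⟩
  refine ⟨ℓ' y₀ / ℓ y₀, fun y => ?_⟩
  by_cases hy : ∃ w, y = y₀ + c • w
  · obtain ⟨w, rfl⟩ := hy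
    rw [h w y₀, h' w y₀]
    have := h w y₀ ▸ hy₀
    have h6 := expQZ_ne_zero ((c * d) • A.q w + d • A.pairing w y₀)
    have h7 := right_ne_zero_of_mul this
    field_simp
  · have h1 : ℓ y = 0 := by by_contra h1; exact hy (key h h1)
    have h2 : ℓ' y = 0 := by by_contra h2; exact hy (key h' h2)
    rw [h1, h2, mul_zero]

/-- The sum of all Heisenberg operators in direction $(c,d)$ has fixed image and trace $|D|\ne0$.
Only $x=0$ contributes to the trace: an operator with $cx\ne0$ has zero diagonal, and if $cx=0$,
$x\ne0$, the diagonal is a multiple of a non-trivial character. -/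
theorem exists_isFixed {a b c d : ℤ} (hdet : a * d - b * c ≡ 1 [ZMOD A.level]) :
    ∃ ℓ : D → ℂ, A.IsFixed c d ℓ ∧ ∃ y, ℓ y ≠ 0 := by
  classical
  have := A.finite
  cases nonempty_fintype D
  let φ (x y : D) : ℂ := expQZ ((c * d) • A.q x + d • A.pairing x y)
  -- `ℓ y'` is the image of the indicator of `y'` under this sum of operators.
  let ℓ (y' y : D) : ℂ := ∑ x, if y + c • x = y' then φ x y else 0
  have hfix (y' : D) : A.IsFixed c d (ℓ y') := by
    intro x y
    simp only [ℓ]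
    rw [← Equiv.sum_comp (Equiv.addRight x) (fun z => if y + c • z = y' then φ z y else 0),
      Finset.mul_sum]
    refine Finset.sum_congr rfl fun z _ => ?_
    have h1 : y + c • (z + x) = y + c • x + c • z := by rw [zsmul_add]; abel
    simp only [Equiv.coe_addRight, mul_ite, mul_zero, h1]
    congr 1
    simp only [φ]
    rw [← expQZ_add, A.q_add, A.pairing_add_left, A.pairing_add_right, A.pairing_zsmul_right]
    congr 1
    module
  have htr : ∑ y, ℓ y y = Fintype.card D := by
    simp only [ℓ]
    rw [Finset.sum_comm]
    have h1 (x : D) : (∑ y : D, if y + c • x = y then φ x y else 0) =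
        if x = 0 then (Fintype.card D : ℂ) else 0 := by
      by_cases hc : c • x = 0
      · simp only [hc, add_zero, if_true, φ]
        have h2 := sum_expQZ (d • A.pairingHom x)
        simp only [AddMonoidHom.smul_apply, pairingHom_apply] at h2
        simp only [expQZ_add, ← Finset.mul_sum, h2]
        by_cases hx : x = 0
        · subst hx
          simp [A.q_zero]
        · rw [if_neg, if_neg hx, mul_zero]
          intro h3
          refine hx (A.zsmul_eq_zero_of_coprime hdet hc (A.nondegenerate _ fun z => ?_))
          change A.pairing _ _ = 0
          rw [A.pairing_zsmul_left]
          exact DFunLike.congr_fun h3 z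
      · have hx : x ≠ 0 := by rintro rfl; simp at hc
        simp [hc, hx]
    rw [Finset.sum_congr rfl fun x _ => h1 x]
    simp
  by_contra! hcon
  have : ∑ y, ℓ y y = 0 := Finset.sum_eq_zero fun y _ => hcon _ (hfix y) y
  rw [htr] at this
  exact absurd this (by simp [Fintype.card_ne_zero])

end DiscriminantForm

namespace DiscriminantForm

variable {D : Type*} [AddCommGroup D] (A : DiscriminantForm D)

/-! ### Twisted eigenfunctionals -/

/-- The composition of `ℓ` with the product over `p ∈ P` of `1 - W(γ p)`, where `W(γ p)` is the
Heisenberg operator of `γ p` in direction `(a, b)`. -/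
noncomputable def twist (P : Finset ℕ) (γ : ℕ → D) (a b : ℤ) (ℓ : D → ℂ) (y : D) : ℂ :=
  ∑ S ∈ P.powerset, (-1) ^ S.card *
    (expQZ (b • A.pairing (∑ p ∈ S, γ p) y) * ℓ (y + a • ∑ p ∈ S, γ p))

/-- All partial sums of the family are isotropic. -/
def IsotropicSums (P : Finset ℕ) (γ : ℕ → D) : Prop :=
  ∀ S ∈ P.powerset, A.q (∑ p ∈ S, γ p) = 0

variable {A} {P : Finset ℕ} {γ : ℕ → D}

theorem twist_const_mul (a b : ℤ) (ℓ : D → ℂ) (C : ℂ) (y : D) :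
    A.twist P γ a b (fun y => C * ℓ y) y = C * A.twist P γ a b ℓ y := by
  simp only [twist, Finset.mul_sum]
  exact Finset.sum_congr rfl fun S _ => by ring

theorem twist_congr {a b a' b' : ℤ} (ha : a ≡ a' [ZMOD A.level]) (hb : b ≡ b' [ZMOD A.level])
    (ℓ : D → ℂ) : A.twist P γ a b ℓ = A.twist P γ a' b' ℓ := by
  ext y
  refine Finset.sum_congr rfl fun S _ => ?_
  rw [A.zsmul_pairing_congr hb, A.zsmul_congr ha]

/-- Isotropy of the partial sums removes the quadratic phases, so the direction $(a,b)$ transforms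
under $T$ and $S$ exactly like $(c,d)$. -/
theorem twist_weilT (hγ : A.IsotropicSums P γ) (a b : ℤ) (ℓ : D → ℂ) (y : D) :
    expQZ (-A.q y) * A.twist P γ a b ℓ y =
      A.twist P γ a (b + a) (fun y => expQZ (-A.q y) * ℓ y) y := by
  simp only [twist, Finset.mul_sum]
  refine Finset.sum_congr rfl fun S hS => ?_
  rw [mul_left_comm, ← mul_assoc (expQZ _), ← mul_assoc (expQZ _), ← expQZ_add, ← expQZ_add,
    A.q_add, A.q_zsmul, hγ S hS, A.pairing_zsmul_right, A.pairing_comm y]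
  congr 3
  module

theorem twist_weilS [Fintype D] (hγ : A.IsotropicSums P γ) (a b : ℤ) (ℓ : D → ℂ) (C : ℂ) (y : D) :
    C * ∑ β, expQZ (A.pairing y β) * A.twist P γ a b ℓ β =
      A.twist P γ b (-a) (fun y => C * ∑ β, expQZ (A.pairing y β) * ℓ β) y := by
  rw [twist_const_mul]
  congr 1
  simp only [twist, Finset.mul_sum]
  rw [Finset.sum_comm]
  refine Finset.sum_congr rfl fun S hS => ?_
  set h := ∑ p ∈ S, γ p
  rw [← Equiv.sum_comp (Equiv.addRight (a • h))
    (fun β => (-1) ^ S.card * (expQZ (-a • A.pairing h y) * _))]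
  refine Finset.sum_congr rfl fun β _ => ?_
  simp only [Equiv.coe_addRight]
  rw [mul_left_comm, ← mul_assoc (expQZ _), ← mul_assoc (expQZ _), ← expQZ_add, ← expQZ_add,
    A.pairing_add_left, A.pairing_add_right, A.pairing_add_right, A.pairing_zsmul_left,
    A.pairing_zsmul_left, A.pairing_zsmul_right, A.pairing_zsmul_right, A.pairing_self,
    hγ S hS, A.pairing_comm y h]
  congr 3
  module

/-- Changing $(a,b)$ by a multiple of $(c,d)$ multiplies the operator by one in direction $(c,d)$,
which fixes $\ell$. The twist therefore does not depend on the chosen complement. -/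
theorem IsFixed.twist_shift (hγ : A.IsotropicSums P γ) {c d : ℤ} {ℓ : D → ℂ}
    (hℓ : A.IsFixed c d ℓ) (a b t : ℤ) :
    A.twist P γ (a + t * c) (b + t * d) ℓ = A.twist P γ a b ℓ := by
  ext y
  refine Finset.sum_congr rfl fun S hS => ?_
  set h := ∑ p ∈ S, γ p
  have h1 : y + (a + t * c) • h = y + a • h + c • t • h := by module
  rw [h1, hℓ (t • h) (y + a • h), ← mul_assoc (expQZ (b • _)), ← expQZ_add, A.q_zsmul, hγ S hS,
    A.pairing_add_right, A.pairing_zsmul_left, A.pairing_zsmul_left, A.pairing_zsmul_right,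
    A.pairing_self, hγ S hS]
  congr 3
  module

variable (A P γ) in
/-- The nonzero fixed functionals in direction `(c, d)`, twisted in a complementary direction. -/
def IsTwistedFixed (c d : ℤ) (v : D → ℂ) : Prop :=
  ∃ a b : ℤ, a * d - b * c ≡ 1 [ZMOD A.level] ∧
    ∃ ℓ, A.IsFixed c d ℓ ∧ (∃ y, ℓ y ≠ 0) ∧ v = A.twist P γ a b ℓ

theorem exists_isTwistedFixed {a b c d : ℤ} (hdet : a * d - b * c ≡ 1 [ZMOD A.level]) :
    ∃ v, A.IsTwistedFixed P γ c d v := by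
  obtain ⟨ℓ, hℓ, h0⟩ := exists_isFixed hdet
  exact ⟨_, a, b, hdet, ℓ, hℓ, h0, rfl⟩

theorem IsTwistedFixed.congr {c d c' d' : ℤ} {v : D → ℂ} (h : A.IsTwistedFixed P γ c d v)
    (hc : c ≡ c' [ZMOD A.level]) (hd : d ≡ d' [ZMOD A.level]) :
    A.IsTwistedFixed P γ c' d' v := by
  obtain ⟨a, b, hdet, ℓ, hℓ, h0, rfl⟩ := h
  exact ⟨a, b, (((hd.mul_left a).sub (hc.mul_left b)).symm.trans hdet), ℓ, hℓ.congr hc hd, h0, rfl⟩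

theorem IsTwistedFixed.weilT (hγ : A.IsotropicSums P γ) {c d : ℤ} {v : D → ℂ}
    (h : A.IsTwistedFixed P γ c d v) :
    A.IsTwistedFixed P γ c (d + c) fun y => expQZ (-A.q y) * v y := by
  obtain ⟨a, b, hdet, ℓ, hℓ, ⟨y, hy⟩, rfl⟩ := h
  refine ⟨a, b + a, ?_, _, hℓ.weilT, ⟨y, mul_ne_zero (expQZ_ne_zero _) hy⟩, ?_⟩
  · convert hdet using 1; ring
  · ext y; exact twist_weilT hγ a b ℓ y

/-- Fourier inversion on $D$. -/
theorem exists_sum_expQZ_ne_zero [Fintype D] {ℓ : D → ℂ} (h : ∃ y, ℓ y ≠ 0) :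
    ∃ y, ∑ β, expQZ (A.pairing y β) * ℓ β ≠ 0 := by
  classical
  by_contra! hcon
  obtain ⟨z, hz⟩ := h
  have h1 : ∑ y, expQZ (-A.pairing y z) * ∑ β, expQZ (A.pairing y β) * ℓ β = 0 :=
    Finset.sum_eq_zero fun y _ => by rw [hcon, mul_zero]
  simp only [Finset.mul_sum] at h1
  rw [Finset.sum_comm] at h1
  have h2 (β : D) : ∑ y, expQZ (-A.pairing y z) * (expQZ (A.pairing y β) * ℓ β) =
      if β = z then Fintype.card D * ℓ β else 0 := by
    have h3 := sum_expQZ (A.pairingHom (β - z))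
    simp only [pairingHom_apply] at h3
    have h4 (y : D) : expQZ (-A.pairing y z) * (expQZ (A.pairing y β) * ℓ β) =
        expQZ (A.pairing (β - z) y) * ℓ β := by
      rw [← mul_assoc, ← expQZ_add, A.pairing_comm _ y, A.pairing_sub_right]
      congr 2
      abel
    rw [Finset.sum_congr rfl fun y _ => h4 y, ← Finset.sum_mul, h3]
    by_cases hβ : β = z
    · subst hβ; simp
    · rw [if_neg hβ, if_neg, zero_mul]
      intro h5
      exact hβ (sub_eq_zero.1 (A.nondegenerate _ fun w => DFunLike.congr_fun h5 w))
  rw [Finset.sum_congr rfl fun β _ => h2 β] at h1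
  simp [hz, Fintype.card_ne_zero] at h1

theorem IsTwistedFixed.weilS [Fintype D] (hγ : A.IsotropicSums P γ) {c d : ℤ} {v : D → ℂ}
    (h : A.IsTwistedFixed P γ c d v) {C : ℂ} (hC : C ≠ 0) :
    A.IsTwistedFixed P γ d (-c) fun y => C * ∑ β, expQZ (A.pairing y β) * v β := by
  obtain ⟨a, b, hdet, ℓ, hℓ, h0, rfl⟩ := h
  obtain ⟨y, hy⟩ := exists_sum_expQZ_ne_zero (A := A) h0
  refine ⟨b, -a, ?_, _, hℓ.weilS C, ⟨y, mul_ne_zero hC hy⟩, ?_⟩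
  · convert hdet using 1; ring
  · ext y; exact twist_weilS hγ a b ℓ C y

theorem IsTwistedFixed.unique (hγ : A.IsotropicSums P γ) {c d : ℤ} {v v' : D → ℂ}
    (h : A.IsTwistedFixed P γ c d v) (h' : A.IsTwistedFixed P γ c d v') :
    ∃ C : ℂ, ∀ y, v' y = C * v y := by
  obtain ⟨a, b, hdet, ℓ, hℓ, h0, rfl⟩ := h
  obtain ⟨a', b', hdet', ℓ', hℓ', h0', rfl⟩ := h'
  obtain ⟨C, hC⟩ := hℓ.unique hdet hℓ' h0
  refine ⟨C, fun y => ?_⟩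
  -- Two complements of $(c,d)$ with determinant 1 differ by $ab'-a'b$ times $(c,d)$.
  have ha : a' ≡ a + (a * b' - a' * b) * c [ZMOD A.level] := by
    refine Int.modEq_iff_dvd.2 ?_
    have h := dvd_sub (hdet'.dvd.mul_left a) (hdet.dvd.mul_left a')
    ring_nf at h ⊢
    exact h
  have hb : b' ≡ b + (a * b' - a' * b) * d [ZMOD A.level] := by
    refine Int.modEq_iff_dvd.2 ?_
    have h := dvd_sub (hdet'.dvd.mul_left b) (hdet.dvd.mul_left b')
    ring_nf at h ⊢
    exact h
  rw [twist_congr ha hb, hℓ'.twist_shift hγ, ← twist_const_mul]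
  congr 1
  exact funext hC

/-! ### Pairing twisted functionals with a modular form -/

/-- The function `∑_γ v_γ F_γ`. -/
def pairWith [Fintype D] (v : D → ℂ) (F : ℍ → D → ℂ) (τ : ℍ) : ℂ := ∑ y, v y * F τ y

theorem IsModularForm.pairWith_T [Fintype D] {s k : ℤ} {F : ℍ → D → ℂ} (hF : A.IsModularForm s k F)
    (v : D → ℂ) (τ : ℍ) :
    pairWith v F (ModularGroup.T • τ) = pairWith (fun y => expQZ (-A.q y) * v y) F τ := by
  simp only [pairWith, hF.transform_T]
  refine Finset.sum_congr rfl fun y _ => ?_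
  change v y * (expQZ (-A.q y) * F τ y) = _
  ring

theorem IsModularForm.pairWith_S [Fintype D] {s k : ℤ} {F : ℍ → D → ℂ} (hF : A.IsModularForm s k F)
    (v : D → ℂ) (τ : ℍ) :
    pairWith v F (ModularGroup.S • τ) = (τ : ℂ) ^ k * pairWith (fun y =>
      Complex.exp (2 * Real.pi * Complex.I * (s / 8)) / (Real.sqrt (Nat.card D) : ℂ) *
        ∑ β, expQZ (A.pairing y β) * v β) F τ := by
  simp only [pairWith, hF.transform_S, DiscriminantForm.weilS, LinearMap.coe_mk, AddHom.coe_mk,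
    Pi.smul_apply, smul_eq_mul, finsum_eq_sum_of_fintype, Finset.mul_sum, Finset.sum_mul]
  rw [Finset.sum_comm]
  refine Finset.sum_congr rfl fun y _ => Finset.sum_congr rfl fun β _ => ?_
  ring

end DiscriminantForm

namespace DiscriminantForm

variable {D : Type*} [AddCommGroup D] (A : DiscriminantForm D)

/-! ### Families of isotropic elements given by regularity -/

/-- A family of nonzero isotropic elements `γ p` in `(N / p) D`, for the primes `p ∣ N`. -/
def IsRegularFamily (γ μ : ℕ → D) : Prop :=
  ∀ p ∈ A.level.primeFactors, γ p = (A.level / p) • μ p ∧ γ p ≠ 0 ∧ A.q (γ p) = 0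

theorem IsRegular.exists_family (h : A.IsRegular) : ∃ γ μ : ℕ → D, A.IsRegularFamily γ μ := by
  have h1 (p : ℕ) : ∃ γ μ : D, p ∈ A.level.primeFactors →
      γ = (A.level / p) • μ ∧ γ ≠ 0 ∧ A.q γ = 0 := by
    by_cases hp : p ∈ A.level.primeFactors
    · obtain ⟨γ, ⟨μ, hμ⟩, h2⟩ := h p (Nat.prime_of_mem_primeFactors hp)
        (Nat.dvd_of_mem_primeFactors hp)
      exact ⟨γ, μ, fun _ => ⟨hμ.symm, h2⟩⟩
    · exact ⟨0, 0, fun h => absurd h hp⟩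
  choose γ μ h2 using h1
  exact ⟨γ, μ, h2⟩

theorem pairing_sum_right {ι : Type*} (S : Finset ι) (f : ι → D) (x : D) :
    A.pairing x (∑ i ∈ S, f i) = ∑ i ∈ S, A.pairing x (f i) :=
  map_sum (A.pairingHom x) f S

variable {A} {γ μ : ℕ → D}

theorem IsRegularFamily.nsmul_eq_zero (h : A.IsRegularFamily γ μ) {p : ℕ}
    (hp : p ∈ A.level.primeFactors) : p • γ p = 0 := by
  rw [(h p hp).1, smul_smul, Nat.mul_div_cancel' (Nat.dvd_of_mem_primeFactors hp), A.level_nsmul]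

/-- For distinct primes the orders are coprime; for equal primes this is isotropy. -/
theorem IsRegularFamily.pairing_eq_zero (h : A.IsRegularFamily γ μ) {p r : ℕ}
    (hp : p ∈ A.level.primeFactors) (hr : r ∈ A.level.primeFactors) :
    A.pairing (γ p) (γ r) = 0 := by
  by_cases hpr : p = r
  · subst hpr
    rw [A.pairing_self, (h p hp).2.2, nsmul_zero]
  · refine A.pairing_eq_zero_of_nsmul (m := p) (n := r) ?_ ?_
      ((Nat.coprime_primes (Nat.prime_of_mem_primeFactors hp)
        (Nat.prime_of_mem_primeFactors hr)).2 hpr)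
    · rw [← A.pairing_nsmul_left, h.nsmul_eq_zero hp, A.pairing_zero_left]
    · rw [← A.pairing_nsmul_right, h.nsmul_eq_zero hr, A.pairing_zero_right]

theorem IsRegularFamily.pairing_sum_eq_zero (h : A.IsRegularFamily γ μ) {p : ℕ}
    (hp : p ∈ A.level.primeFactors) {S : Finset ℕ} (hS : S ⊆ A.level.primeFactors) :
    A.pairing (γ p) (∑ r ∈ S, γ r) = 0 := by
  rw [A.pairing_sum_right]
  exact Finset.sum_eq_zero fun r hr => h.pairing_eq_zero hp (hS hr)

theorem IsRegularFamily.isotropicSums (h : A.IsRegularFamily γ μ) :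
    A.IsotropicSums A.level.primeFactors γ := by
  intro S hS
  rw [Finset.mem_powerset] at hS
  induction S using Finset.induction_on with
  | empty => simp
  | insert p S hpS ih =>
    rw [Finset.insert_subset_iff] at hS
    rw [Finset.sum_insert hpS, A.q_add, ih hS.2, (h p hS.1).2.2, h.pairing_sum_eq_zero hS.1 hS.2]
    simp

theorem IsRegularFamily.nsmul_sum_eq_zero (h : A.IsRegularFamily γ μ) {p ν N' : ℕ} (hp : p.Prime)
    (hN : A.level = p ^ ν * N') {S : Finset ℕ} (hS : S ⊆ A.level.primeFactors) (hpS : p ∉ S) :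
    N' • ∑ r ∈ S, γ r = 0 := by
  rw [Finset.smul_sum]
  refine Finset.sum_eq_zero fun r hr => ?_
  have hr' := hS hr
  have hrp := Nat.prime_of_mem_primeFactors hr'
  have hdvd : r ∣ N' := by
    have := Nat.dvd_of_mem_primeFactors hr'
    rw [hN] at this
    refine (Nat.Coprime.pow_right ν ?_).dvd_of_dvd_mul_left this
    exact (Nat.coprime_primes hrp hp).2 fun h => hpS (h ▸ hr)
  obtain ⟨t, rfl⟩ := hdvd
  rw [mul_comm, mul_smul, h.nsmul_eq_zero hr', nsmul_zero]

theorem exists_level_eq (A : DiscriminantForm D) {p : ℕ} (hp : p ∈ A.level.primeFactors) :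
    ∃ N' : ℕ, A.level = p ^ (A.level.factorization p) * N' ∧ p.Coprime N' ∧
      0 < A.level.factorization p := by
  have hpp := Nat.prime_of_mem_primeFactors hp
  refine ⟨A.level / p ^ A.level.factorization p, (Nat.ordProj_mul_ordCompl_eq_self _ _).symm,
    Nat.coprime_ordCompl hpp A.level_pos.ne', ?_⟩
  exact hpp.factorization_pos_of_dvd A.level_pos.ne' (Nat.dvd_of_mem_primeFactors hp)

/-- Multiplication by the prime-to-$p$ part of $N$ isolates the $p$-component of the sum. -/
theorem IsRegularFamily.sum_ne_zero (h : A.IsRegularFamily γ μ) {S : Finset ℕ}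
    (hS : S ⊆ A.level.primeFactors) (hne : S.Nonempty) : ∑ r ∈ S, γ r ≠ 0 := by
  classical
  obtain ⟨p, hpS⟩ := hne
  intro h0
  have hpp := Nat.prime_of_mem_primeFactors (hS hpS)
  obtain ⟨N', hN, hcop, -⟩ := A.exists_level_eq (hS hpS)
  have h1 := h.nsmul_sum_eq_zero hpp hN ((Finset.erase_subset p S).trans hS)
    (Finset.notMem_erase p S)
  rw [← Finset.add_sum_erase _ _ hpS] at h0
  have h2 : N' • γ p = 0 := by
    have := congrArg (N' • ·) h0
    simpa [h1] using this
  have h3 := addOrderOf_dvd_of_nsmul_eq_zero h2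
  have h4 := addOrderOf_dvd_of_nsmul_eq_zero (h.nsmul_eq_zero (hS hpS))
  have h5 : addOrderOf (γ p) = 1 := Nat.eq_one_of_dvd_coprimes hcop h4 h3
  exact (h p (hS hpS)).2.1 (by simpa using h5)

/-! ### The support of twisted eigenfunctionals: one prime at a time -/

/-- The terms of $S$ and $S\cup\{p\}$ have opposite signs; if every such pair cancelled, the twist
would vanish at $y$. -/
theorem exists_summand_ne_of_twist_ne_zero {P : Finset ℕ} {p : ℕ} (hp : p ∈ P) {a b : ℤ} {ℓ : D → ℂ}
    {y : D} (h : A.twist P γ a b ℓ y ≠ 0) :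
    ∃ S ⊆ P, p ∉ S ∧
      expQZ (b • A.pairing (γ p + ∑ r ∈ S, γ r) y) * ℓ (y + a • (γ p + ∑ r ∈ S, γ r)) ≠
        expQZ (b • A.pairing (∑ r ∈ S, γ r) y) * ℓ (y + a • ∑ r ∈ S, γ r) := by
  classical
  by_contra! hcon
  refine h ?_
  rw [twist]
  conv_lhs => rw [← Finset.insert_erase hp]
  rw [Finset.sum_powerset_insert (Finset.notMem_erase p P), ← Finset.sum_add_distrib]
  refine Finset.sum_eq_zero fun S hS => ?_
  rw [Finset.mem_powerset] at hS
  have hpS : p ∉ S := fun h => Finset.notMem_erase p P (hS h)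
  rw [Finset.sum_insert hpS, Finset.card_insert_of_notMem hpS,
    hcon S (hS.trans (Finset.erase_subset p P)) hpS]
  ring

theorem exists_mul_modEq {p : ℕ} (hp : p.Prime) {c : ℤ} (hc : ¬ (p : ℤ) ∣ c) (a : ℤ) :
    ∃ t : ℤ, t * c ≡ a [ZMOD p] := by
  have hcop : IsCoprime (p : ℤ) c := ((Nat.prime_iff_prime_int.1 hp).coprime_iff_not_dvd).2 hc
  obtain ⟨u, v, huv⟩ := hcop
  refine ⟨a * v, Int.modEq_iff_dvd.2 ⟨a * u, ?_⟩⟩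
  linear_combination -a * huv

theorem IsRegularFamily.zsmul_congr (h : A.IsRegularFamily γ μ) {p : ℕ}
    (hp : p ∈ A.level.primeFactors) {m n : ℤ} (hmn : m ≡ n [ZMOD p]) : m • γ p = n • γ p := by
  obtain ⟨t, ht⟩ := hmn.symm.dvd
  rw [← sub_eq_zero, ← sub_smul, ht, mul_comm, mul_zsmul, natCast_zsmul, h.nsmul_eq_zero hp,
    zsmul_zero]

/-- As $c$ is invertible modulo $p$, the shift by $a\gamma_p$ is a shift by an element
$c\,t\gamma_p$, which fixedness turns into a phase depending only on $(\gamma_p,y)$. If this pairing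
is 0, the factor $1-W(\gamma_p)$ kills the value at $y$. -/
theorem IsFixed.pairing_ne_zero_of_not_dvd (hγ : A.IsRegularFamily γ μ) {p : ℕ}
    (hp : p ∈ A.level.primeFactors) {a b c d : ℤ} (hc : ¬ (p : ℤ) ∣ c) {ℓ : D → ℂ}
    (hℓ : A.IsFixed c d ℓ) {y : D} (hy : A.twist A.level.primeFactors γ a b ℓ y ≠ 0) :
    A.pairing (γ p) y ≠ 0 := by
  intro h0
  obtain ⟨S, hS, hpS, hne⟩ := exists_summand_ne_of_twist_ne_zero hp hy
  obtain ⟨t, ht⟩ := exists_mul_modEq (Nat.prime_of_mem_primeFactors hp) hc a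
  refine hne ?_
  have h1 : a • γ p = c • t • γ p := by
    rw [← hγ.zsmul_congr hp ht, mul_comm, mul_zsmul]
  have h2 : y + a • (γ p + ∑ r ∈ S, γ r) = y + a • ∑ r ∈ S, γ r + c • t • γ p := by
    rw [smul_add, h1]; abel
  have h3 := hℓ (t • γ p) (y + a • ∑ r ∈ S, γ r)
  rw [A.q_zsmul, (hγ p hp).2.2, A.pairing_zsmul_left, A.pairing_add_right, h0,
    A.pairing_zsmul_right, hγ.pairing_sum_eq_zero hp hS] at h3
  rw [h2, A.pairing_add_left, h0, zero_add, h3]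
  simp

/-- The element `x` with `p ^ j x = γ p` coming from `γ p ∈ (N / p) D`. -/
theorem IsRegularFamily.eq_nsmul (h : A.IsRegularFamily γ μ) {p ν N' j : ℕ} (hp : p.Prime)
    (hN : A.level = p ^ ν * N') (hj : j + 1 ≤ ν) (hpN : p ∈ A.level.primeFactors) :
    γ p = p ^ j • (p ^ (ν - 1 - j) * N') • μ p := by
  rw [(h p hpN).1, smul_smul]
  congr 1
  rw [hN]
  refine Nat.div_eq_of_eq_mul_right hp.pos ?_
  obtain ⟨m, rfl⟩ := Nat.exists_eq_add_of_le hj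
  have : j + 1 + m - 1 - j = m := by omega
  rw [this]
  ring

/-- Writing $\gamma_p=p^jx$ again makes $a\gamma_p$ an element of $cD$. The shift is then a phase
governed by $(x,y)$, up to a quadratic term. -/
theorem IsFixed.exists_ne_zero_of_dvd (hγ : A.IsRegularFamily γ μ) {p ν N' j : ℕ} (hp : p.Prime)
    (hpN : p ∈ A.level.primeFactors) (hN : A.level = p ^ ν * N')
    (hj : j + 1 ≤ ν) {a b c₀ d : ℤ} (hc₀ : ¬ (p : ℤ) ∣ c₀) {ℓ : D → ℂ}
    (hℓ : A.IsFixed (p ^ j * c₀) d ℓ) {y : D}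
    (hy : A.twist A.level.primeFactors γ a b ℓ y ≠ 0) :
    ∃ S ⊆ A.level.primeFactors, p ∉ S ∧ ℓ (y + a • ∑ r ∈ S, γ r) ≠ 0 ∧
      (1 ≤ j → j + 2 ≤ ν → A.pairing ((p ^ (ν - 1 - j) * N') • μ p) y ≠ 0) := by
  obtain ⟨S, hS, hpS, hne⟩ := exists_summand_ne_of_twist_ne_zero hpN hy
  obtain ⟨t, ht⟩ := exists_mul_modEq hp hc₀ a
  set x := (p ^ (ν - 1 - j) * N') • μ p with hx
  have hγx : γ p = p ^ j • x := hγ.eq_nsmul hp hN hj hpN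
  have h1 : a • γ p = ((p : ℤ) ^ j * c₀) • t • x := by
    rw [← hγ.zsmul_congr hpN ht, hγx, ← natCast_zsmul, smul_smul, smul_smul]
    congr 1
    push_cast; ring
  have h2 : y + a • (γ p + ∑ r ∈ S, γ r) = y + a • ∑ r ∈ S, γ r + ((p : ℤ) ^ j * c₀) • t • x := by
    rw [smul_add, h1]; abel
  have h3 := hℓ (t • x) (y + a • ∑ r ∈ S, γ r)
  refine ⟨S, hS, hpS, ?_, fun hj1 hj2 h0 => hne ?_⟩
  · intro h4
    rw [h4] at h3
    have h5 := (mul_eq_zero.1 h3.symm).resolve_left (expQZ_ne_zero _)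
    rw [h2, h4, h5, mul_zero, mul_zero] at hne
    exact hne rfl
  · have h4 : A.pairing x (∑ r ∈ S, γ r) = 0 := by
      rw [hx, mul_smul, A.pairing_nsmul_left, A.pairing_nsmul_left, ← A.pairing_nsmul_right,
        hγ.nsmul_sum_eq_zero hp hN hS hpS, A.pairing_zero_right, nsmul_zero]
    -- The quadratic term carries $p^{j+2(\nu-1-j)}=p^{2\nu-2-j}$, which is divisible by $p^\nu$
    -- exactly because $j\le\nu-2$.
    have h5 : ((p : ℤ) ^ j * c₀ * d) • A.q (t • x) = 0 := by
      obtain ⟨m, rfl⟩ := Nat.exists_eq_add_of_le hj2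
      have hm : j + 2 + m - 1 - j = m + 1 := by omega
      rw [hx, hm, A.q_zsmul, A.q_nsmul, ← natCast_zsmul, smul_smul, smul_smul]
      have : (p : ℤ) ^ j * c₀ * d * (t * t) * ((p ^ (m + 1) * N' * (p ^ (m + 1) * N') : ℕ) : ℤ) =
          (c₀ * d * (t * t) * (p ^ m * N')) * (A.level : ℕ) := by
        rw [hN]; push_cast; ring
      rw [this, mul_smul, natCast_zsmul, A.level_nsmul_q, zsmul_zero]
    have h6 : A.pairing (γ p) y = 0 := by
      rw [hγx, A.pairing_nsmul_left, h0, nsmul_zero]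
    rw [h5, A.pairing_zsmul_left, A.pairing_add_right, h0, A.pairing_zsmul_right, h4] at h3
    rw [h2, A.pairing_add_left, h6, zero_add, h3]
    simp

/-- The factor $N'$ makes the test element orthogonal to the $\gamma_r$ with $r\ne p$, so the
condition is the same at $y$ as at the shifted point. -/
theorem IsFixed.pairing_eq_of_ne_zero (hγ : A.IsRegularFamily γ μ) {p ν N' : ℕ} (hp : p.Prime)
    (hN : A.level = p ^ ν * N') {a c d : ℤ} {ℓ : D → ℂ} (hℓ : A.IsFixed c d ℓ) {y : D}
    {S : Finset ℕ} (hS : S ⊆ A.level.primeFactors) (hpS : p ∉ S)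
    (hy : ℓ (y + a • ∑ r ∈ S, γ r) ≠ 0) (x : D) (hx : c • N' • x = 0) :
    (c * d) • A.q (N' • x) + d • A.pairing (N' • x) y = 0 := by
  have h := hℓ.pairing_eq hy hx
  have h4 : A.pairing (N' • x) (∑ r ∈ S, γ r) = 0 := by
    rw [A.pairing_nsmul_left, ← A.pairing_nsmul_right, hγ.nsmul_sum_eq_zero hp hN hS hpS,
      A.pairing_zero_right]
  rwa [A.pairing_add_right, A.pairing_zsmul_right, h4, zsmul_zero, add_zero] at h

theorem zsmul_q_eq_zero_iff {δ : ℕ} (hδ : 0 < δ) {y : D} (hy : y ∈ A.reflectiveSet δ) (n : ℤ) :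
    n • A.q y = 0 ↔ (δ : ℤ) ∣ n := by
  have hδ' : (δ : ℚ) ≠ 0 := by positivity
  rw [hy.2, ← AddCircle.coe_zsmul, EvenLattice.coe_eq_zero_iff, dvd_def]
  refine exists_congr fun m => ?_
  rw [zsmul_eq_mul, mul_one_div, div_eq_iff hδ']
  constructor
  · intro h
    have : n = m * δ := by exact_mod_cast h
    rw [this, mul_comm]
  · rintro rfl; push_cast; ring

/-- If `c` is divisible exactly by `p ^ j` with `1 ≤ j < ν`, then a reflective element in the
support has almost no `p`-part. -/
theorem pow_dvd_of_mem_support (hγ : A.IsRegularFamily γ μ) {p ν N' j : ℕ} (hp : p.Prime)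
    (hpN' : p.Coprime N') (hN : A.level = p ^ ν * N') {a c₀ d : ℤ} (hd : ¬ (p : ℤ) ∣ d)
    {ℓ : D → ℂ} (hℓ : A.IsFixed (p ^ j * c₀) d ℓ) {y : D} {S : Finset ℕ}
    (hS : S ⊆ A.level.primeFactors) (hpS : p ∉ S) (hy : ℓ (y + a • ∑ r ∈ S, γ r) ≠ 0)
    {δ e δ' : ℕ} (hδ : δ = p ^ e * δ') (hδ' : δ' ∣ N') (hyδ : y ∈ A.reflectiveSet δ)
    (hδ0 : 0 < δ) :
    (p : ℤ) ^ e ∣ (p : ℤ) ^ (e - j) * (p ^ j * c₀ * (N' * p ^ (e - j)) + 2) := by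
  -- Fixedness is tested on the multiple $N'p^{e-j}y$ of $y$ itself. The subtraction is truncated:
  -- for $j\ge e$ the multiple is $N'y$.
  have h1 : ((p : ℤ) ^ j * c₀) • N' • p ^ (e - j) • y = 0 := by
    have h2 : δ ∣ p ^ j * N' * p ^ (e - j) := by
      rw [hδ, mul_right_comm, ← pow_add]
      exact mul_dvd_mul (pow_dvd_pow p (by omega)) hδ'
    obtain ⟨t, ht⟩ := h2
    have : ((p : ℤ) ^ j * c₀) • N' • p ^ (e - j) • y = (c₀ * t) • δ • y := by
      simp only [← natCast_zsmul, smul_smul]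
      congr 1
      have : (p : ℤ) ^ j * N' * p ^ (e - j) = δ * t := by exact_mod_cast ht
      push_cast
      linear_combination c₀ * this
    rw [this, hyδ.1, zsmul_zero]
  have h2 := hℓ.pairing_eq_of_ne_zero hγ hp hN hS hpS hy _ h1
  have h3 : ((p : ℤ) ^ j * c₀ * d) • A.q (N' • p ^ (e - j) • y) +
      d • A.pairing (N' • p ^ (e - j) • y) y =
      (d * N' * ((p : ℤ) ^ (e - j) * (p ^ j * c₀ * (N' * p ^ (e - j)) + 2))) • A.q y := by
    rw [A.q_nsmul, A.q_nsmul, A.pairing_nsmul_left, A.pairing_nsmul_left, A.pairing_self]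
    simp only [← natCast_zsmul, smul_smul, ← add_smul]
    congr 1
    push_cast
    ring
  rw [h3, zsmul_q_eq_zero_iff hδ0 hyδ] at h2
  have h4 : (p : ℤ) ^ e ∣ δ := by rw [hδ]; push_cast; exact dvd_mul_right _ _
  have hpp := Nat.prime_iff_prime_int.1 hp
  have hcop : IsCoprime ((p : ℤ) ^ e) (d * N') := by
    refine IsCoprime.pow_left (IsCoprime.mul_right ((hpp.coprime_iff_not_dvd).2 hd) ?_)
    exact Nat.isCoprime_iff_coprime.2 hpN'
  exact hcop.dvd_of_dvd_mul_left (h4.trans h2)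

/-- For odd $p$ the bracket is $\equiv2$ modulo $p$, hence a unit, so $e\le e-j$ in truncated
subtraction. -/
theorem not_dvd_of_mem_support_of_odd {p j e : ℕ} (hp : p.Prime) (hp2 : p ≠ 2) (hj : 1 ≤ j)
    {c₀ N' : ℤ} (h : (p : ℤ) ^ e ∣ (p : ℤ) ^ (e - j) * (p ^ j * c₀ * (N' * p ^ (e - j)) + 2)) :
    e = 0 := by
  by_contra he
  have hpp := Nat.prime_iff_prime_int.1 hp
  have hnd : ¬ (p : ℤ) ∣ p ^ j * c₀ * (N' * p ^ (e - j)) + 2 := by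
    intro hd
    have h1 : (p : ℤ) ∣ p ^ j * c₀ * (N' * p ^ (e - j)) :=
      ((dvd_pow_self _ (by omega)).mul_right _).mul_right _
    have h2 : (p : ℤ) ∣ 2 := (dvd_add_right h1).1 hd
    have h3 : p ∣ 2 := by exact_mod_cast h2
    exact hp2 ((Nat.prime_dvd_prime_iff_eq hp Nat.prime_two).1 h3)
  have hcop : IsCoprime ((p : ℤ) ^ e) (p ^ j * c₀ * (N' * p ^ (e - j)) + 2) :=
    IsCoprime.pow_left ((hpp.coprime_iff_not_dvd).2 hnd)
  have h4 := hcop.dvd_of_dvd_mul_right h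
  have h5 : p ^ e ∣ p ^ (e - j) := by exact_mod_cast h4
  have := (Nat.pow_dvd_pow_iff_le_right hp.one_lt).1 h5
  omega

/-- For $j\ge2$ the bracket is twice an odd number, so $e\le(e-j)+1$. For $j=1$ this gives no
information, which is why characteristic elements are needed. -/
theorem le_one_of_mem_support_of_two {j e : ℕ} (hj : 2 ≤ j)
    {c₀ N' : ℤ} (h : (2 : ℤ) ^ e ∣ 2 ^ (e - j) * (2 ^ j * c₀ * (N' * 2 ^ (e - j)) + 2)) :
    e ≤ 1 := by
  by_contra he
  obtain ⟨i, rfl⟩ := Nat.exists_eq_add_of_le hj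
  have h1 : (2 : ℤ) ^ (e - (2 + i)) * (2 ^ (2 + i) * c₀ * (N' * 2 ^ (e - (2 + i))) + 2) =
      2 ^ (e - (2 + i) + 1) * (2 * (2 ^ i * c₀ * (N' * 2 ^ (e - (2 + i)))) + 1) := by ring
  rw [h1] at h
  have hcop : IsCoprime ((2 : ℤ) ^ e) (2 * (2 ^ i * c₀ * (N' * 2 ^ (e - (2 + i)))) + 1) := by
    refine IsCoprime.pow_left ?_
    exact ⟨-(2 ^ i * c₀ * (N' * 2 ^ (e - (2 + i)))), 1, by ring⟩
  have h4 := hcop.dvd_of_dvd_mul_right h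
  have h5 : 2 ^ e ∣ 2 ^ (e - (2 + i) + 1) := by exact_mod_cast h4
  have := (Nat.pow_dvd_pow_iff_le_right (by norm_num : 1 < 2)).1 h5
  omega

end DiscriminantForm

namespace DiscriminantForm

variable {D : Type*} [AddCommGroup D] {A : DiscriminantForm D} {γ μ : ℕ → D}

/-! ### The support at the prime `2` -/

theorem nsmul_q_eq_zero_of_nsmul {n : ℕ} {x : D} (hx : n • x = 0) : (n * 2) • A.q x = 0 := by
  rw [mul_nsmul', ← A.pairing_self, ← A.pairing_nsmul_left, hx, A.pairing_zero_left]

theorem odd_zsmul_eq {G : Type*} [AddCommGroup G] {n : ℤ} (hn : ¬ (2 : ℤ) ∣ n) {x : G}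
    (hx : 2 • x = 0) : n • x = x := by
  obtain ⟨m, rfl⟩ := Int.not_even_iff_odd.1 fun h => hn h.two_dvd
  have hx' : (2 : ℤ) • x = 0 := by exact_mod_cast hx
  rw [add_smul, mul_comm, mul_smul, hx', one_smul, smul_zero, zero_add]

theorem not_two_dvd_cast {n : ℕ} (hn : Nat.Coprime 2 n) : ¬ (2 : ℤ) ∣ n := by
  have := (Nat.Prime.coprime_iff_not_dvd Nat.prime_two).1 hn
  omega

theorem odd_nsmul_eq {G : Type*} [AddCommGroup G] {n : ℕ} (hn : Nat.Coprime 2 n) {x : G}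
    (hx : 2 • x = 0) : n • x = x := by
  rw [← natCast_zsmul, odd_zsmul_eq (not_two_dvd_cast hn) hx]

variable (A) in
/-- The element `u` is characteristic for the bilinear form on the `2`-torsion. -/
def IsCharacteristic (u : D) : Prop := ∀ x : D, 2 • x = 0 → A.pairing x u = 2 • A.q x

variable (A) in
/-- The `2`-torsion has a characteristic element of order `2` and odd norm. -/
def IsExceptional : Prop := ∃ u : D, 2 • u = 0 ∧ 2 • A.q u ≠ 0 ∧ A.IsCharacteristic u

/-- For $2x=0$ fixedness reads $2c_0d\,q(x)+d(x,y)=0$. Both terms are killed by 2, so the odd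
factors and the sign disappear. -/
theorem IsFixed.isCharacteristic (hγ : A.IsRegularFamily γ μ) {ν N' : ℕ}
    (hN' : Nat.Coprime 2 N') (hN : A.level = 2 ^ ν * N') {a c₀ d : ℤ}
    (hd : ¬ (2 : ℤ) ∣ d) (hc₀ : ¬ (2 : ℤ) ∣ c₀) {ℓ : D → ℂ} (hℓ : A.IsFixed (2 * c₀) d ℓ) {y : D}
    {S : Finset ℕ} (hS : S ⊆ A.level.primeFactors) (h2S : 2 ∉ S)
    (hy : ℓ (y + a • ∑ r ∈ S, γ r) ≠ 0) : A.IsCharacteristic y := by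
  intro x hx
  have hx' : N' • x = x := odd_nsmul_eq hN' hx
  have hcx : (2 * c₀) • N' • x = 0 := by
    rw [hx', mul_comm, mul_smul]
    have : (2 : ℤ) • x = 0 := by exact_mod_cast hx
    rw [this, smul_zero]
  have h := hℓ.pairing_eq_of_ne_zero hγ Nat.prime_two hN hS h2S hy x hcx
  have h4 : (2 * 2) • A.q x = 0 := nsmul_q_eq_zero_of_nsmul hx
  have h2 : 2 • 2 • A.q x = 0 := by rw [smul_smul, h4]
  have hcd : ¬ (2 : ℤ) ∣ c₀ * d := by
    rw [Int.prime_two.dvd_mul]; tauto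
  have h5 : (2 * c₀ * d) • A.q x = 2 • A.q x := by
    have := odd_zsmul_eq hcd h2
    rw [← this, ← natCast_zsmul, smul_smul]
    congr 1
    push_cast; ring
  have h6 : d • A.pairing x y = A.pairing x y :=
    odd_zsmul_eq hd (by rw [← A.pairing_nsmul_left, hx, A.pairing_zero_left])
  rw [hx', h5, h6, add_comm] at h
  rw [eq_neg_of_add_eq_zero_left h, neg_eq_iff_add_eq_zero, ← two_nsmul, h2]

/-- If $4z=0$ then $(z,2y)=(2z,y)=8q(z)=0$, so $2y\in D[4]^\perp=4D$, say $2y=4w$. Then $u=y-2w$ is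
2-torsion, and the cross term $2(u,w)$ vanishes. -/
theorem IsCharacteristic.exists_decomposition {y : D} (h : A.IsCharacteristic y) :
    ∃ u w : D, 2 • u = 0 ∧ 4 • A.q u = 0 ∧ A.IsCharacteristic u ∧
      A.q y = 4 • A.q w + A.q u := by
  obtain ⟨w, hw⟩ := A.exists_eq_zsmul 4 (2 • y) fun z hz => by
    have hz' : 4 • z = 0 := by exact_mod_cast hz
    have h1 := h (2 • z) (by rw [smul_smul]; exact hz')
    rw [A.q_nsmul, smul_smul] at h1
    rw [A.pairing_nsmul_right, ← A.pairing_nsmul_left, h1]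
    exact nsmul_q_eq_zero_of_nsmul (n := 4) hz'
  have hw' : 2 • y = 4 • w := by exact_mod_cast hw
  have hu : 2 • (y - 2 • w) = 0 := by
    rw [smul_sub, smul_smul, hw', sub_eq_zero]
    rfl
  refine ⟨y - 2 • w, w, hu, ?_, fun x hx => ?_, ?_⟩
  · exact nsmul_q_eq_zero_of_nsmul (n := 2) hu
  · rw [A.pairing_sub_right, h x hx, A.pairing_nsmul_right, ← A.pairing_nsmul_left, hx,
      A.pairing_zero_left, sub_zero]
  · conv_lhs => rw [← sub_add_cancel y (2 • w)]
    rw [A.q_add, A.q_nsmul, A.pairing_nsmul_right, ← A.pairing_nsmul_left, hu,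
      A.pairing_zero_left, add_zero, add_comm]

theorem nsmul_q_eq_zero_iff {δ : ℕ} (hδ : 0 < δ) {y : D} (hy : y ∈ A.reflectiveSet δ) (n : ℕ) :
    n • A.q y = 0 ↔ δ ∣ n := by
  rw [← natCast_zsmul, zsmul_q_eq_zero_iff hδ hy, Int.natCast_dvd_natCast]

theorem nsmul_eq_zero_of_dvd {δ n : ℕ} {y : D} (hy : y ∈ A.reflectiveSet δ) (h : δ ∣ n) :
    n • y = 0 := by
  obtain ⟨t, rfl⟩ := h
  rw [mul_comm, mul_smul, hy.1, smul_zero]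

/-- A reflective characteristic element has small `2`-part. -/
theorem IsCharacteristic.dvd_of_reflective {ν N' : ℕ} (hν : 3 ≤ ν) (hN : A.level = 2 ^ ν * N')
    {y : D} (h : A.IsCharacteristic y) {δ : ℕ} (hδ : 0 < δ) (hy : y ∈ A.reflectiveSet δ) :
    (4 ≤ ν → δ ∣ 2 ^ (ν - 2) * N') ∧
      (ν = 3 → δ ∣ 4 * N' ∧ (¬ δ ∣ 2 * N' → A.IsExceptional)) := by
  obtain ⟨u, w, hu, hqu, hchar, hq⟩ := h.exists_decomposition
  have hw := A.level_nsmul_q w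
  refine ⟨fun h4 => ?_, fun h3 => ⟨?_, fun hnd => ⟨u, hu, fun h0 => hnd ?_, hchar⟩⟩⟩
  · obtain ⟨m, rfl⟩ := Nat.exists_eq_add_of_le h4
    rw [← nsmul_q_eq_zero_iff hδ hy, hq, smul_add, smul_smul]
    have h1 : 2 ^ (4 + m - 2) * N' * 4 = A.level := by
      rw [hN, show 4 + m - 2 = m + 2 by omega]; ring
    have h2 : 2 ^ (4 + m - 2) * N' = (2 ^ m * N') * 4 := by
      rw [show 4 + m - 2 = m + 2 by omega]; ring
    rw [h1, hw, h2, mul_smul, hqu, smul_zero, add_zero]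
  · subst h3
    rw [← nsmul_q_eq_zero_iff hδ hy, hq, smul_add, smul_smul, mul_comm 4 N', mul_smul N' 4 (A.q u),
      hqu, smul_zero, add_zero]
    have h1 : N' * 4 * 4 = 2 * A.level := by rw [hN]; ring
    rw [h1, mul_smul, hw, smul_zero]
  · subst h3
    rw [← nsmul_q_eq_zero_iff hδ hy, hq, smul_add, smul_smul, mul_comm 2 N', mul_smul N' 2 (A.q u),
      h0, smul_zero, add_zero]
    have h1 : N' * 2 * 4 = A.level := by rw [hN]; ring
    rw [h1, hw]

/-! ### The support of twisted eigenfunctionals -/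

theorem exists_eq_pow_mul_not_dvd {p : ℕ} (hp : p.Prime) {c : ℤ} {n : ℕ} (hc : ¬ (p : ℤ) ^ n ∣ c) :
    ∃ (j : ℕ) (c₀ : ℤ), c = p ^ j * c₀ ∧ ¬ (p : ℤ) ∣ c₀ ∧ j < n := by
  have hc0 : c ≠ 0 := by rintro rfl; simp at hc
  have hfin : FiniteMultiplicity (p : ℤ) c :=
    Int.finiteMultiplicity_iff.2 ⟨by simpa using hp.ne_one, hc0⟩
  obtain ⟨c₀, h1, h2⟩ := hfin.exists_eq_pow_mul_and_not_dvd
  refine ⟨_, c₀, h1, h2, ?_⟩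
  by_contra hle
  push Not at hle
  exact hc (h1 ▸ ((pow_dvd_pow _ hle).mul_right _))

theorem dvd_of_not_pow_dvd {p ν N' δ : ℕ} (hp : p.Prime) (h : δ ∣ p ^ ν * N')
    (hδ : ¬ p ^ ν ∣ δ) : δ ∣ p ^ (ν - 1) * N' := by
  obtain ⟨e, δ', hδ', rfl⟩ := Nat.exists_eq_pow_mul_and_not_dvd (n := δ)
    (by rintro rfl; simp at hδ) p hp.ne_one
  have hcop : Nat.Coprime δ' (p ^ ν) := ((hp.coprime_iff_not_dvd.2 hδ').symm).pow_right _
  have h1 : δ' ∣ N' := hcop.dvd_of_dvd_mul_left ((dvd_mul_left _ _).trans h)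
  have h2 : e < ν := by
    by_contra hle
    exact hδ ((pow_dvd_pow p (not_lt.1 hle)).mul_right _)
  exact mul_dvd_mul (pow_dvd_pow p (by omega)) h1

/-- If $p^\nu\nmid\delta$, then $y$ is killed by $N/p$, hence orthogonal to $\gamma_p\in\frac NpD$.
-/
theorem twist_support_of_not_dvd (hγ : A.IsRegularFamily γ μ) {p ν N' : ℕ}
    (hpN : p ∈ A.level.primeFactors) (hN : A.level = p ^ ν * N') (hν : 0 < ν)
    {a b c d : ℤ} (hc : ¬ (p : ℤ) ∣ c) {ℓ : D → ℂ}
    (hℓ : A.IsFixed c d ℓ) {y : D} (hy : A.twist A.level.primeFactors γ a b ℓ y ≠ 0) {δ : ℕ}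
    (hδ : δ ∣ A.level) (hyδ : y ∈ A.reflectiveSet δ) : p ^ ν ∣ δ := by
  have hp := Nat.prime_of_mem_primeFactors hpN
  by_contra hnd
  refine hℓ.pairing_ne_zero_of_not_dvd hγ hpN hc hy ?_
  have h1 := hγ.eq_nsmul (j := 0) hp hN hν hpN
  rw [pow_zero, one_smul, Nat.sub_zero] at h1
  rw [h1, A.pairing_nsmul_left, ← A.pairing_nsmul_right,
    nsmul_eq_zero_of_dvd hyδ (dvd_of_not_pow_dvd hp (hN ▸ hδ) hnd), A.pairing_zero_right]

theorem not_dvd_of_det {p : ℕ} (hp : p.Prime) {N a b c d : ℤ} (hN : (p : ℤ) ∣ N)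
    (hdet : a * d - b * c ≡ 1 [ZMOD N]) (hc : (p : ℤ) ∣ c) : ¬ (p : ℤ) ∣ d := by
  intro hd
  have h1 := hN.trans hdet.dvd
  have h2 : (p : ℤ) ∣ a * d - b * c := dvd_sub (hd.mul_left a) (hc.mul_left b)
  have h3 : (p : ℤ) ∣ 1 := (dvd_sub_left h2).1 h1
  exact (Nat.prime_iff_prime_int.1 hp).not_isUnit (isUnit_of_dvd_one h3)

/-- Survival needs $(x,y)\ne0$ for an $x$ divisible by $p^{\nu-1-j}N'$, while the divisibility
bounds force $y$ to be killed by that number. The argument fails only for $p=2$, $j=1$, $\nu=3$. -/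
theorem twist_support_of_dvd (hγ : A.IsRegularFamily γ μ) {p ν N' : ℕ}
    (hpN : p ∈ A.level.primeFactors) (hN : A.level = p ^ ν * N') (hpN' : p.Coprime N')
    {a b c d : ℤ} (hdet : a * d - b * c ≡ 1 [ZMOD A.level]) (hc : (p : ℤ) ∣ c)
    (hc' : ¬ (p : ℤ) ^ (ν - 1) ∣ c) {ℓ : D → ℂ}
    (hℓ : A.IsFixed c d ℓ) {y : D} (hy : A.twist A.level.primeFactors γ a b ℓ y ≠ 0) {δ : ℕ}
    (hδ : δ ∣ A.level) (hyδ : y ∈ A.reflectiveSet δ) :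
    p = 2 ∧ ν = 3 ∧ 2 ^ 2 ∣ δ ∧ A.IsExceptional := by
  have hp := Nat.prime_of_mem_primeFactors hpN
  have hδ0 : 0 < δ := Nat.pos_of_dvd_of_pos hδ A.level_pos
  have hd : ¬ (p : ℤ) ∣ d := not_dvd_of_det hp
    (Int.natCast_dvd_natCast.2 (Nat.dvd_of_mem_primeFactors hpN)) hdet hc
  obtain ⟨j, c₀, rfl, hc₀, hjν⟩ := exists_eq_pow_mul_not_dvd hp hc'
  have hj : 1 ≤ j := by
    rw [Nat.one_le_iff_ne_zero]
    rintro rfl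
    exact hc₀ (by simpa using hc)
  obtain ⟨S, hS, hpS, hℓy, hpair⟩ := hℓ.exists_ne_zero_of_dvd hγ hp hpN hN (by omega) hc₀ hy
  have hpair := hpair hj (by omega)
  have hnd : ¬ δ ∣ p ^ (ν - 1 - j) * N' := by
    intro h
    refine hpair ?_
    rw [A.pairing_nsmul_left, ← A.pairing_nsmul_right, nsmul_eq_zero_of_dvd hyδ h,
      A.pairing_zero_right]
  obtain ⟨e, δ', hpδ', hδe⟩ := Nat.exists_eq_pow_mul_and_not_dvd hδ0.ne' p hp.ne_one
  have hδ' : δ' ∣ N' := by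
    have hcop : Nat.Coprime δ' (p ^ ν) := ((hp.coprime_iff_not_dvd.2 hpδ').symm).pow_right _
    refine hcop.dvd_of_dvd_mul_left ?_
    rw [← hN]
    exact (Dvd.intro_left _ hδe.symm).trans hδ
  have hdvd := pow_dvd_of_mem_support hγ hp hpN' hN hd hℓ hS hpS hℓy hδe hδ' hyδ hδ0
  have hdvd_of_le {n : ℕ} (h : e ≤ n) : δ ∣ p ^ n * N' := by
    rw [hδe]; exact mul_dvd_mul (pow_dvd_pow p h) hδ'
  by_cases hp2 : p = 2
  swap
  · have he := not_dvd_of_mem_support_of_odd hp hp2 hj hdvd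
    exact absurd (hdvd_of_le (by omega)) hnd
  subst hp2
  rcases Nat.lt_or_ge 1 j with hj2 | hj2
  · have he := le_one_of_mem_support_of_two hj2 hdvd
    exact absurd (hdvd_of_le (by omega)) hnd
  -- Here $y$ is characteristic. Its decomposition still suffices for $\nu\ge4$; for $\nu=3$ it
  -- leaves the exceptional case.
  · obtain rfl : j = 1 := by omega
    have hchar : A.IsCharacteristic y := by
      have hℓ' : A.IsFixed (2 * c₀) d ℓ := by simpa using hℓ
      exact hℓ'.isCharacteristic hγ hpN' hN hd hc₀ hS hpS hℓy
    obtain ⟨h4, h3⟩ := hchar.dvd_of_reflective (by omega) hN hδ0 hyδ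
    rcases Nat.lt_or_ge 3 ν with hν | hν
    · exact absurd (h4 hν) hnd
    · obtain rfl : ν = 3 := by omega
      obtain ⟨-, h6⟩ := h3 rfl
      refine ⟨rfl, rfl, ?_, h6 (by simpa using hnd)⟩
      rw [hδe]
      refine (pow_dvd_pow 2 ?_).mul_right _
      by_contra he
      exact hnd (hdvd_of_le (by omega))

/-- For odd $\delta$ the element $y$ is orthogonal to $D[4]$, so fixedness on $D[4]$ leaves only an
odd multiple of $4q(x)$, which has order at most 2. -/
theorem twist_support_two (hγ : A.IsRegularFamily γ μ) {N' : ℕ}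
    (h2N : 2 ∈ A.level.primeFactors) (hN : A.level = 2 ^ 3 * N') (hN' : Nat.Coprime 2 N')
    {a b c d : ℤ} (hdet : a * d - b * c ≡ 1 [ZMOD A.level]) (hc : (4 : ℤ) ∣ c)
    (hc' : ¬ (8 : ℤ) ∣ c) {ℓ : D → ℂ}
    (hℓ : A.IsFixed c d ℓ) {y : D} (hy : A.twist A.level.primeFactors γ a b ℓ y ≠ 0) {δ : ℕ}
    (hδ : ¬ 2 ∣ δ) (hyδ : y ∈ A.reflectiveSet δ) (x : D) (hx : 4 • x = 0) : 4 • A.q x = 0 := by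
  have hd : ¬ (2 : ℤ) ∣ d := not_dvd_of_det Nat.prime_two
    (Int.natCast_dvd_natCast.2 (Nat.dvd_of_mem_primeFactors h2N)) hdet
      ((by norm_num : ((2 : ℕ) : ℤ) ∣ 4).trans hc)
  obtain ⟨c₀, rfl⟩ := hc
  have hc₀ : ¬ (2 : ℤ) ∣ c₀ := by
    rintro ⟨t, rfl⟩
    exact hc' ⟨t, by ring⟩
  obtain ⟨S, hS, hpS, hℓy, -⟩ := IsFixed.exists_ne_zero_of_dvd (j := 2) (c₀ := c₀) hγ Nat.prime_two
    h2N hN (by norm_num) hc₀ (by simpa using hℓ) hy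
  have hcx : (4 * c₀) • N' • x = 0 := by
    have : (4 : ℤ) • x = 0 := by exact_mod_cast hx
    rw [smul_comm (4 * c₀) N' x, mul_comm, mul_smul, this, smul_zero, smul_zero]
  have h := hℓ.pairing_eq_of_ne_zero hγ Nat.prime_two hN hS hpS hℓy x hcx
  have h1 : A.pairing x y = 0 := by
    refine A.pairing_eq_zero_of_nsmul (m := 4) (n := δ) ?_ ?_ ?_
    · rw [← A.pairing_nsmul_left, hx, A.pairing_zero_left]
    · rw [← A.pairing_nsmul_right, hyδ.1, A.pairing_zero_right]
    · exact ((Nat.Prime.coprime_iff_not_dvd Nat.prime_two).2 hδ).pow_left 2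
  rw [A.pairing_nsmul_left, h1, smul_zero, smul_zero, add_zero, A.q_nsmul, ← natCast_zsmul,
    smul_smul] at h
  have h8 : 2 • 4 • A.q x = 0 := by
    rw [smul_smul]; exact nsmul_q_eq_zero_of_nsmul (n := 4) hx
  have hodd : ¬ (2 : ℤ) ∣ c₀ * d * (N' * N') := by
    have h2 := not_two_dvd_cast hN'
    simp only [Int.prime_two.dvd_mul]; tauto
  rw [← odd_zsmul_eq hodd h8, ← natCast_zsmul, smul_smul, ← h]
  congr 1
  push_cast; ring

end DiscriminantForm

/-! ### Alternating forms on finite abelian groups -/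

section Alternating

variable {G H : Type*} [AddCommGroup G] [AddCommGroup H]

theorem card_eq_card_ker_mul_card_range (f : G →+ H) :
    Nat.card G = Nat.card f.range * Nat.card f.ker := by
  rw [AddSubgroup.card_eq_card_quotient_mul_card_addSubgroup f.ker,
    Nat.card_congr (QuotientAddGroup.quotientKerEquivRange f).toEquiv]

/-- The left image pairs injectively with $H$ modulo the right kernel, that is, with the right
image. -/
theorem card_range_le_card_range_flip [Finite G] [Finite H]
    (B : G →+ H →+ AddCircle (1 : ℚ)) : Nat.card B.range ≤ Nat.card B.flip.range := by
  have hker (f : B.range) : B.flip.ker ≤ (f : H →+ AddCircle (1 : ℚ)).ker := by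
    obtain ⟨_, x, rfl⟩ := f
    intro z hz
    exact DFunLike.congr_fun (AddMonoidHom.mem_ker.1 hz) x
  let Φ : B.range →+ (H ⧸ B.flip.ker) →+ AddCircle (1 : ℚ) :=
    AddMonoidHom.mk' (fun f => QuotientAddGroup.lift B.flip.ker f (hker f)) fun f g => by
      ext z; rfl
  have hΦ : Function.Injective Φ := by
    intro f g h
    ext z
    exact DFunLike.congr_fun h (QuotientAddGroup.mk z)
  refine (card_le_of_injective_pairing Φ hΦ).2.trans_eq ?_
  exact Nat.card_congr (QuotientAddGroup.quotientKerEquivRange B.flip).toEquiv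

theorem card_mul_card_ker_flip [Finite G] [Finite H] (B : G →+ H →+ AddCircle (1 : ℚ)) :
    Nat.card G * Nat.card B.flip.ker = Nat.card H * Nat.card B.ker := by
  have h1 : Nat.card B.range = Nat.card B.flip.range :=
    le_antisymm (card_range_le_card_range_flip B) (card_range_le_card_range_flip B.flip)
  rw [card_eq_card_ker_mul_card_range B, card_eq_card_ker_mul_card_range B.flip, h1]
  ring

/-- A maximal isotropic subgroup $W$ equals its own orthogonal complement, since any $x\perp W$
could be added to it. Counting in the pairing $G\times W$ gives $|G|\,|\ker B|=|W|^2$. -/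
theorem isSquare_card_mul_card_ker [Finite G] (B : G →+ G →+ AddCircle (1 : ℚ))
    (hB : ∀ x, B x x = 0) : IsSquare (Nat.card G * Nat.card B.ker) := by
  have hanti (x z : G) : B x z = 0 → B z x = 0 := by
    intro h
    have := hB (x + z)
    simpa [hB, h] using this
  obtain ⟨W, hW⟩ := Set.Finite.exists_maximal
    (Set.toFinite {W : AddSubgroup G | ∀ x ∈ W, ∀ z ∈ W, B x z = 0})
    ⟨⊥, by rintro x hx z hz; rw [AddSubgroup.mem_bot.1 hx]; simp⟩
  have hiso := hW.prop
  have hperp (x : G) (hx : ∀ z ∈ W, B x z = 0) : x ∈ W := by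
    have hle : W ⊔ AddSubgroup.zmultiples x ≤ W := by
      refine hW.2 ?_ le_sup_left
      intro a ha b hb
      obtain ⟨w, hw, _, ⟨m, rfl⟩, rfl⟩ := AddSubgroup.mem_sup.1 ha
      obtain ⟨w', hw', _, ⟨n, rfl⟩, rfl⟩ := AddSubgroup.mem_sup.1 hb
      simp [hB, hx _ hw', hanti _ _ (hx _ hw), hiso w hw w' hw']
    exact hle (AddSubgroup.mem_sup_right (AddSubgroup.mem_zmultiples x))
  let B' : G →+ W →+ AddCircle (1 : ℚ) :=
    AddMonoidHom.mk' (fun x => (B x).comp W.subtype) fun x y => by ext z; simp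
  have h := card_mul_card_ker_flip B'
  have h1 : B'.ker = W := by
    ext x
    rw [AddMonoidHom.mem_ker]
    constructor
    · intro hx
      exact hperp x fun z hz => DFunLike.congr_fun hx (⟨z, hz⟩ : W)
    · intro hx
      ext z
      exact hiso x hx z z.2
  have h2 : Nat.card B'.flip.ker = Nat.card B.ker := by
    refine Nat.card_congr
      ⟨fun z => ⟨z.1.1, ?_⟩, fun x => ⟨⟨x.1, ?_⟩, ?_⟩, fun _ => rfl, fun _ => rfl⟩
    · rw [AddMonoidHom.mem_ker]
      ext x
      exact hanti _ _ (DFunLike.congr_fun (AddMonoidHom.mem_ker.1 z.2) x)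
    · exact hperp _ fun z _ => DFunLike.congr_fun (AddMonoidHom.mem_ker.1 x.2) z
    · rw [AddMonoidHom.mem_ker]
      ext z
      exact hanti _ _ (DFunLike.congr_fun (AddMonoidHom.mem_ker.1 x.2) z)
  rw [h1, h2] at h
  exact ⟨_, h⟩

theorem card_comap_eq [Finite G] (f : G →+ H) (X : AddSubgroup H) :
    Nat.card (X.comap f) = Nat.card f.ker * Nat.card (X ⊓ f.range : AddSubgroup H) := by
  let g : X.comap f →+ H := f.comp (X.comap f).subtype
  have h := card_eq_card_ker_mul_card_range g
  have h1 : g.range = X ⊓ f.range := by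
    ext z
    constructor
    · rintro ⟨x, rfl⟩; exact ⟨x.2, ⟨x.1, rfl⟩⟩
    · rintro ⟨hz, x, rfl⟩; exact ⟨⟨x, hz⟩, rfl⟩
  have h2 : Nat.card g.ker = Nat.card f.ker := by
    refine Nat.card_congr ⟨fun z => ⟨z.1.1, z.2⟩, fun x => ⟨⟨x.1, ?_⟩, x.2⟩,
      fun _ => rfl, fun _ => rfl⟩
    rw [AddSubgroup.mem_comap, AddMonoidHom.mem_ker.1 x.2]
    exact X.zero_mem
  rw [h, h1, h2, mul_comm]

end Alternating

/-! ### The parity obstruction at the prime 2. -/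

namespace DiscriminantForm

variable {D : Type*} [AddCommGroup D] {A : DiscriminantForm D}

theorem isSquare_card_mul_card_radical (K R : AddSubgroup D) (n : ℕ)
    (halt : ∀ x ∈ K, n • A.pairing x x = 0)
    (hR : ∀ x, x ∈ R ↔ x ∈ K ∧ ∀ z ∈ K, n • A.pairing x z = 0) :
    IsSquare (Nat.card K * Nat.card R) := by
  have := A.finite
  let B : K →+ K →+ AddCircle (1 : ℚ) :=
    AddMonoidHom.mk' (fun x => n • (A.pairingHom x).comp K.subtype) fun x y => by
      ext z; simp
  have h := isSquare_card_mul_card_ker B fun x => halt x x.2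
  have h2 : Nat.card B.ker = Nat.card R := by
    refine Nat.card_congr ⟨fun x => ⟨x.1.1, (hR _).2 ⟨x.1.2, fun z hz => ?_⟩⟩,
      fun x => ⟨⟨x.1, ((hR _).1 x.2).1⟩, ?_⟩, fun _ => rfl, fun _ => rfl⟩
    · exact DFunLike.congr_fun (AddMonoidHom.mem_ker.1 x.2) (⟨z, hz⟩ : K)
    · rw [AddMonoidHom.mem_ker]
      ext z
      exact ((hR _).1 x.2).2 z z.2
  rwa [h2] at h

theorem even_padicValNat_of_isSquare {n : ℕ} (h : IsSquare n) (hn : n ≠ 0) :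
    Even (padicValNat 2 n) := by
  obtain ⟨m, rfl⟩ := h
  rw [padicValNat.mul (by rintro rfl; simp at hn) (by rintro rfl; simp at hn)]
  exact ⟨_, rfl⟩

theorem eq_of_two_nsmul_eq_zero {x y : AddCircle (1 : ℚ)} (hx : 2 • x = 0) (hy : 2 • y = 0)
    (hx0 : x ≠ 0) (hy0 : y ≠ 0) : x = y := by
  have key {z : AddCircle (1 : ℚ)} (hz : 2 • z = 0) (hz0 : z ≠ 0) : expQZ z = -1 := by
    have h : expQZ z * expQZ z = 1 := by rw [← expQZ_add, ← two_nsmul, hz, expQZ_zero]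
    rcases mul_self_eq_one_iff.1 h with h | h
    · exact absurd (expQZ_eq_one_iff.1 h) hz0
    · exact h
  rw [← sub_eq_zero, ← expQZ_eq_one_iff, sub_eq_add_neg, expQZ_add, expQZ_neg, key hx hx0,
    key hy hy0]
  norm_num

/-- The parity obstruction at the prime `2`. -/
theorem IsExceptional.false (hexc : A.IsExceptional) (h4 : ∀ x : D, 4 • x = 0 → 4 • A.q x = 0)
    {N' : ℕ} (hN : A.level = 2 ^ 3 * N') (hN' : Nat.Coprime 2 N')
    (hsq : IsSquare (Nat.card (nsmulAddMonoidHom (α := D) 2).ker)) : False := by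
  have := A.finite
  obtain ⟨u, hu, hqu, hchar⟩ := hexc
  set T : AddSubgroup D := (nsmulAddMonoidHom (α := D) 2).ker with hT
  have memT (x : D) : x ∈ T ↔ 2 • x = 0 := Iff.rfl
  set R2 : AddSubgroup D := T ⊓ (nsmulAddMonoidHom (α := D) 2).range with hR2
  set R4 : AddSubgroup D := T ⊓ (nsmulAddMonoidHom (α := D) 4).range with hR4
  have memR2 (x : D) : x ∈ R2 ↔ 2 • x = 0 ∧ ∃ w, 2 • w = x := Iff.rfl
  have memR4 (x : D) : x ∈ R4 ↔ 2 • x = 0 ∧ ∃ w, 4 • w = x := Iff.rfl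
  set K : AddSubgroup D := T ⊓ (A.pairingHom u).ker with hK
  have memK (x : D) : x ∈ K ↔ 2 • x = 0 ∧ A.pairing u x = 0 := Iff.rfl
  have huu : A.pairing u u ≠ 0 := by rwa [A.pairing_self]
  have h2pair {x y : D} (hx : 2 • x = 0) : 2 • A.pairing x y = 0 := by
    rw [← A.pairing_nsmul_left, hx, A.pairing_zero_left]
  -- the form on the orthogonal complement of the characteristic element
  have s1 : IsSquare (Nat.card K * Nat.card R2) := by
    refine A.isSquare_card_mul_card_radical K R2 1 (fun x hx => ?_) fun x => ?_
    · obtain ⟨hx2, hxu⟩ := (memK x).1 hx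
      rw [one_smul, A.pairing_self, ← hchar x hx2, A.pairing_comm, hxu]
    · rw [memR2, memK]
      simp only [one_smul]
      constructor
      · rintro ⟨hx, w, rfl⟩
        refine ⟨⟨hx, ?_⟩, fun z hz => ?_⟩
        · rw [A.pairing_nsmul_right, h2pair hu]
        · rw [A.pairing_nsmul_left, ← A.pairing_nsmul_right, ((memK z).1 hz).1,
            A.pairing_zero_right]
      · rintro ⟨⟨hx, hxu⟩, hxK⟩
        refine ⟨hx, ?_⟩
        obtain ⟨w, hw⟩ := A.exists_eq_zsmul 2 x fun z hz => by
          have hz : 2 • z = 0 := by exact_mod_cast hz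
          rw [A.pairing_comm]
          by_cases hzu : A.pairing u z = 0
          · exact hxK z ((memK z).2 ⟨hz, hzu⟩)
          · have h1 : A.pairing x (z + u) = 0 := by
              refine hxK _ ((memK _).2 ⟨by rw [smul_add, hz, hu, add_zero], ?_⟩)
              rw [A.pairing_add_right, eq_of_two_nsmul_eq_zero (h2pair hu) (h2pair hu) hzu huu,
                ← two_nsmul, h2pair hu]
            rwa [A.pairing_add_right, A.pairing_comm x u, hxu, add_zero] at h1
        exact ⟨w, by exact_mod_cast hw.symm⟩
  -- The functional $(\cdot,u)$ on the 2-torsion is non-zero, since $(u,u)\ne0$, and takes two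
  -- values.
  have c1 : Nat.card T = 2 * Nat.card K := by
    let B : T →+ AddSubgroup.zmultiples u →+ AddCircle (1 : ℚ) :=
      AddMonoidHom.mk' (fun x => (A.pairingHom x).comp (AddSubgroup.zmultiples u).subtype)
        fun x y => by ext z; simp
    have h := card_mul_card_ker_flip B
    have hu0 : u ≠ 0 := by rintro rfl; simp at huu
    have h1 : Nat.card (AddSubgroup.zmultiples u) = 2 := by
      rw [Nat.card_zmultiples]
      exact addOrderOf_eq_prime hu hu0
    have h2 : Nat.card B.flip.ker = 1 := by
      rw [AddSubgroup.card_eq_one, eq_bot_iff]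
      rintro ⟨_, m, rfl⟩ hm
      have hm' : m • A.pairing u u = 0 := by
        rw [← A.pairing_zsmul_right]
        exact DFunLike.congr_fun (AddMonoidHom.mem_ker.1 hm) (⟨u, hu⟩ : T)
      have hm2 : (2 : ℤ) ∣ m := by
        by_contra hnd
        exact huu (by rw [← odd_zsmul_eq hnd (h2pair hu), hm'])
      obtain ⟨t, rfl⟩ := hm2
      have hu' : (2 : ℤ) • u = 0 := by exact_mod_cast hu
      rw [AddSubgroup.mem_bot]
      ext
      simp [mul_comm (2 : ℤ), mul_smul, hu']
    have h3 : Nat.card B.ker = Nat.card K := by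
      refine Nat.card_congr ⟨fun x => ⟨x.1.1, x.1.2, ?_⟩, fun x => ⟨⟨x.1, x.2.1⟩, ?_⟩,
        fun _ => rfl, fun _ => rfl⟩
      · change A.pairing u x.1.1 = 0
        rw [A.pairing_comm]
        exact DFunLike.congr_fun (AddMonoidHom.mem_ker.1 x.2)
          (⟨u, AddSubgroup.mem_zmultiples u⟩ : AddSubgroup.zmultiples u)
      · rw [AddMonoidHom.mem_ker]
        ext ⟨_, m, rfl⟩
        change A.pairing x.1 (m • u) = 0
        have : A.pairing u x.1 = 0 := x.2.2
        rw [A.pairing_zsmul_right, A.pairing_comm, this, zsmul_zero]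
    rwa [h1, h2, h3, mul_one] at h
  have c2 := card_comap_eq (nsmulAddMonoidHom (α := D) 2) T
  have c3 := card_comap_eq (nsmulAddMonoidHom (α := D) 2) R4
  have c4 := card_comap_eq (nsmulAddMonoidHom (α := D) 4) T
  set T4 : AddSubgroup D := T.comap (nsmulAddMonoidHom (α := D) 2) with hT4
  set T8 : AddSubgroup D := T.comap (nsmulAddMonoidHom (α := D) 4) with hT8
  have memT4 (x : D) : x ∈ T4 ↔ 4 • x = 0 := by
    change 2 • 2 • x = 0 ↔ _
    rw [smul_smul]; rfl
  have memT8 (x : D) : x ∈ T8 ↔ 8 • x = 0 := by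
    change 2 • 4 • x = 0 ↔ _
    rw [smul_smul]; rfl
  have hker4 : (nsmulAddMonoidHom (α := D) 4).ker = T4 := by
    ext x; exact (memT4 x).symm
  have hR4' : R4 ⊓ (nsmulAddMonoidHom (α := D) 2).range = R4 := by
    refine inf_eq_left.2 ?_
    rintro x ⟨-, w, rfl⟩
    exact ⟨2 • w, by simp [smul_smul]⟩
  rw [← hT, ← hR2] at c2
  rw [hR4', ← hT] at c3
  rw [hker4, ← hR4] at c4
  have s2 : IsSquare (Nat.card T4 * Nat.card (R4.comap (nsmulAddMonoidHom (α := D) 2))) := by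
    refine A.isSquare_card_mul_card_radical T4 _ 2 (fun x hx => ?_) fun x => ?_
    · rw [A.pairing_self, smul_smul]
      exact h4 x ((memT4 x).1 hx)
    · change 2 • x ∈ R4 ↔ _
      rw [memR4, memT4, smul_smul]
      refine and_congr_right fun hx => ?_
      constructor
      · rintro ⟨w, hw⟩ z hz
        rw [← A.pairing_nsmul_left, ← hw, A.pairing_nsmul_left, ← A.pairing_nsmul_right,
          (memT4 z).1 hz, A.pairing_zero_right]
      · intro h
        obtain ⟨w, hw⟩ := A.exists_eq_zsmul 4 (2 • x) fun z hz => by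
          rw [A.pairing_comm, A.pairing_nsmul_left]
          exact h z ((memT4 z).2 (by exact_mod_cast hz))
        exact ⟨w, by exact_mod_cast hw.symm⟩
  have s3 : IsSquare (Nat.card T8 * Nat.card T4) := by
    refine A.isSquare_card_mul_card_radical T8 T4 4 (fun x hx => ?_) fun x => ?_
    · rw [A.pairing_self, smul_smul]
      have h16 : (8 * 2) • A.q x = 0 := nsmul_q_eq_zero_of_nsmul ((memT8 x).1 hx)
      have hlev := A.level_nsmul_q x
      rw [hN, mul_comm, mul_smul] at hlev
      have := odd_nsmul_eq hN' (x := 8 • A.q x) (by rw [smul_smul]; exact h16)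
      change 8 • A.q x = 0
      rw [← this]
      exact hlev
    · rw [memT4, memT8]
      constructor
      · intro hx
        refine ⟨?_, fun z hz => by rw [← A.pairing_nsmul_left, hx, A.pairing_zero_left]⟩
        have : 8 • x = 2 • 4 • x := by rw [smul_smul]; rfl
        rw [this, hx, smul_zero]
      · rintro ⟨hx, h⟩
        refine A.nondegenerate _ fun z => ?_
        change A.pairing _ _ = 0
        have h8 : 8 • N' • z = 0 := by
          rw [smul_smul]
          have := A.level_nsmul z
          rwa [hN] at this
        have h1 := h (N' • z) ((memT8 _).2 h8)
        rw [A.pairing_nsmul_right, smul_comm, ← A.pairing_nsmul_left] at h1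
        have := odd_nsmul_eq hN' (x := A.pairing (4 • x) z) (by
          have h2 : 2 • 4 • x = 0 := by rw [smul_smul]; exact hx
          rw [← A.pairing_nsmul_left, h2, A.pairing_zero_left])
        rwa [this] at h1
  -- Now compare 2-adic valuations. $|T|$ is a square and $|T|=2|K|$, so $|K|$ has odd valuation.
  -- Then `s1`, `s2`, `s3` give in turn that $|R_2|$ has odd, $|R_4|$ odd and $|R_4|$ even
  -- valuation.
  have pT : Nat.card T ≠ 0 := Nat.card_pos.ne'
  have pK : Nat.card K ≠ 0 := Nat.card_pos.ne'
  have p2 : Nat.card R2 ≠ 0 := Nat.card_pos.ne'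
  have p4 : Nat.card R4 ≠ 0 := Nat.card_pos.ne'
  rw [c3, c2] at s2
  rw [c4, c2] at s3
  have e0 := even_padicValNat_of_isSquare hsq pT
  have e1 := even_padicValNat_of_isSquare s1 (by positivity)
  have e2 := even_padicValNat_of_isSquare s2 (by positivity)
  have e3 := even_padicValNat_of_isSquare s3 (by positivity)
  have e4 := congrArg (padicValNat 2) c1
  rw [padicValNat.mul (by norm_num) pK] at e4
  simp only [padicValNat.mul, pT, pK, p2, p4, padicValNat_self, mul_ne_zero_iff, ne_eq,
    not_false_eq_true, and_self, Nat.even_add] at e0 e1 e2 e3 e4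
  have e5 : Even (padicValNat 2 (Nat.card T)) ↔ ¬ Even (padicValNat 2 (Nat.card K)) := by
    rw [e4, add_comm, Nat.even_add_one]
  tauto

end DiscriminantForm

/-! ### The `2`-torsion of the discriminant group of a lattice of even rank -/

namespace EvenLattice

variable {V : Type*} [AddCommGroup V] [Module ℚ V] (L : EvenLattice V)

theorem finiteDimensional (L : EvenLattice V) : FiniteDimensional ℚ V := by
  obtain ⟨ι, _, b, -⟩ := L.exists_basis
  exact Module.Finite.of_basis b

theorem finrank_eq_of_hasSignature {n m : ℕ} (h : L.HasSignature n m) :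
    Module.finrank ℚ V = n + m := by
  have := L.finiteDimensional
  have h1 := QuadraticForm.sigPos_add_sigNeg_add_radical (Q := L.form.toQuadraticMap)
  have h2 : L.form.toQuadraticMap.radical = ⊥ := by
    rw [eq_bot_iff]
    intro x hx
    rw [QuadraticMap.radical_eq_ker_polarBilin, LinearMap.mem_ker] at hx
    refine (Submodule.mem_bot ℚ).2 (L.nondegenerate.1 x fun y => ?_)
    have h3 := LinearMap.congr_fun hx y
    rw [QuadraticMap.polarBilin_apply_apply, LinearMap.BilinMap.polar_toQuadraticMap,
      L.form_comm y x, LinearMap.zero_apply] at h3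
    linarith
  rw [h2, h.1, h.2, finrank_bot, add_zero] at h1
  exact h1.symm

/-- The pairing `(x, y) / 2 mod 1` on the lattice. -/
noncomputable def halfPairing : L.carrier →+ L.carrier →+ AddCircle (1 : ℚ) :=
  AddMonoidHom.mk' (fun x => AddMonoidHom.mk'
      (fun y => ((L.form (x : V) (y : V) / 2 : ℚ) : AddCircle (1 : ℚ)))
      (fun y z => by rw [← AddCircle.coe_add]; congr 1; simp; ring))
    (fun x y => by
      ext z
      change ((L.form ((x : V) + y) (z : V) / 2 : ℚ) : AddCircle (1 : ℚ)) =
        ((L.form (x : V) (z : V) / 2 : ℚ) : AddCircle (1 : ℚ)) +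
          ((L.form (y : V) (z : V) / 2 : ℚ) : AddCircle (1 : ℚ))
      rw [← AddCircle.coe_add]; congr 1; simp; ring)

theorem halfPairing_apply (x y : L.carrier) :
    L.halfPairing x y = ((L.form (x : V) (y : V) / 2 : ℚ) : AddCircle (1 : ℚ)) := rfl

theorem exists_form_eq (x y : L.carrier) : ∃ m : ℤ, L.form (x : V) (y : V) = m :=
  L.mem_dual.1 (L.carrier_le_dual x.2) y y.2

theorem two_nsmul_halfPairing (x y : L.carrier) : 2 • L.halfPairing x y = 0 := by
  obtain ⟨m, hm⟩ := L.exists_form_eq x y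
  rw [halfPairing_apply, ← AddCircle.coe_nsmul, coe_eq_zero_iff]
  exact ⟨m, by rw [hm]; simp; ring⟩

/-- On $L/2L$, of order $2^{n+m}$, the form $(x,y)/2$ mod 1 is alternating because $L$ is even. Its
radical $(L\cap2L')/2L$ is isomorphic to the 2-torsion of $L'/L$ by $x\mapsto x/2$. Hence $2^{n+m}$
times the order of the 2-torsion is a square. -/
theorem isSquare_card_two_torsion {n m : ℕ} (h : L.HasSignature n m) (hnm : Even (n + m)) :
    IsSquare (Nat.card (nsmulAddMonoidHom (α := L.DiscGroup) 2).ker) := by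
  have := L.isLattice
  have := L.finiteDimensional
  have hfree : Module.Free ℤ L.carrier := Submodule.IsLattice.free (K := ℚ) L.carrier
  have hrank : Module.finrank ℤ L.carrier = n + m := by
    rw [← L.finrank_eq_of_hasSignature h]
    exact congrArg Cardinal.toNat (Submodule.IsLattice.rank' ℚ L.carrier)
  set N := (nsmulAddMonoidHom (α := L.carrier) 2).range with hN
  have hindex : Nat.card (L.carrier ⧸ N) = 2 ^ (n + m) := by
    rw [← hrank, ← AddSubgroup.index_range_nsmul, AddSubgroup.index]
  have hfin : Finite (L.carrier ⧸ N) := Nat.finite_of_card_ne_zero (by rw [hindex]; positivity)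
  have hr (x : L.carrier) : N ≤ (L.halfPairing x).ker := by
    rintro _ ⟨y, rfl⟩
    rw [AddMonoidHom.mem_ker, nsmulAddMonoidHom_apply, map_nsmul, two_nsmul_halfPairing]
  let B₁ : L.carrier →+ (L.carrier ⧸ N) →+ AddCircle (1 : ℚ) :=
    AddMonoidHom.mk' (fun x => QuotientAddGroup.lift N (L.halfPairing x) (hr x)) fun x y => by
      ext z; simp
  have hl : N ≤ B₁.ker := by
    rintro _ ⟨y, rfl⟩
    rw [AddMonoidHom.mem_ker]
    ext z
    change L.halfPairing (2 • y) z = 0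
    rw [map_nsmul, AddMonoidHom.nsmul_apply, two_nsmul_halfPairing]
  let B : (L.carrier ⧸ N) →+ (L.carrier ⧸ N) →+ AddCircle (1 : ℚ) := QuotientAddGroup.lift N B₁ hl
  have hB (x y : L.carrier) : B (QuotientAddGroup.mk x) (QuotientAddGroup.mk y) =
      L.halfPairing x y := rfl
  have hsq := isSquare_card_mul_card_ker B (by
    rintro ⟨x⟩
    refine (hB x x).trans ?_
    obtain ⟨m, hm⟩ := L.even x x.2
    rw [halfPairing_apply, coe_eq_zero_iff]
    exact ⟨m, by rw [hm]; ring⟩)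
  let M := L.halfPairing.ker
  have hmem (x : L.carrier) : x ∈ M ↔ (1 / 2 : ℚ) • (x : V) ∈ L.dual := by
    rw [mem_dual, AddMonoidHom.mem_ker, DFunLike.ext_iff]
    simp only [AddMonoidHom.zero_apply, halfPairing_apply, coe_eq_zero_iff, map_smul,
      LinearMap.smul_apply, smul_eq_mul, Subtype.forall]
    refine forall₂_congr fun y _ => exists_congr fun m => ?_
    rw [div_eq_inv_mul, one_div]
  let f : M →+ L.DiscGroup := AddMonoidHom.mk'
    (fun x => Submodule.Quotient.mk ⟨(1 / 2 : ℚ) • (x : V), (hmem x).1 x.2⟩) fun x y => by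
      rw [← Submodule.Quotient.mk_add]
      congr 1
      ext
      simp
  let g : M →+ L.carrier ⧸ N := (QuotientAddGroup.mk' N).comp M.subtype
  have hfr : f.range = (nsmulAddMonoidHom (α := L.DiscGroup) 2).ker := by
    ext z
    constructor
    · rintro ⟨x, rfl⟩
      change 2 • f x = 0
      change 2 • Submodule.Quotient.mk _ = (0 : L.DiscGroup)
      rw [← Submodule.Quotient.mk_smul, Submodule.Quotient.mk_eq_zero]
      change 2 • (1 / 2 : ℚ) • (x : V) ∈ L.carrier
      rw [← Nat.cast_smul_eq_nsmul ℚ, smul_smul]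
      norm_num
    · intro hz
      obtain ⟨v, rfl⟩ := Submodule.Quotient.mk_surjective _ z
      have hz' : Submodule.Quotient.mk (2 • v) = (0 : L.DiscGroup) := hz
      rw [Submodule.Quotient.mk_eq_zero] at hz'
      have hv : 2 • (v : V) ∈ L.carrier := hz'
      have h2v : (1 / 2 : ℚ) • (2 • (v : V)) = v := by
        rw [← Nat.cast_smul_eq_nsmul ℚ, smul_smul]
        norm_num
      refine ⟨⟨⟨2 • (v : V), hv⟩, (hmem _).2 (by rw [h2v]; exact v.2)⟩, ?_⟩
      change Submodule.Quotient.mk _ = Submodule.Quotient.mk _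
      congr 1
      ext
      exact h2v
  have hgr : g.range = B.ker := by
    ext z
    obtain ⟨x, rfl⟩ := QuotientAddGroup.mk_surjective z
    constructor
    · rintro ⟨y, hy⟩
      rw [← hy, AddMonoidHom.mem_ker]
      ext w
      exact DFunLike.congr_fun (AddMonoidHom.mem_ker.1 y.2) w
    · intro hx
      refine ⟨⟨x, ?_⟩, rfl⟩
      rw [AddMonoidHom.mem_ker]
      ext w
      exact DFunLike.congr_fun (AddMonoidHom.mem_ker.1 hx) (QuotientAddGroup.mk w)
  have hker : f.ker = g.ker := by
    ext x
    rw [AddMonoidHom.mem_ker, AddMonoidHom.mem_ker]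
    change Submodule.Quotient.mk _ = (0 : L.DiscGroup) ↔
      (QuotientAddGroup.mk (x : L.carrier) : L.carrier ⧸ N) = 0
    rw [Submodule.Quotient.mk_eq_zero, QuotientAddGroup.eq_zero_iff]
    change (1 / 2 : ℚ) • (x : V) ∈ L.carrier ↔ _
    constructor
    · intro hx
      refine ⟨⟨_, hx⟩, ?_⟩
      ext
      change 2 • (1 / 2 : ℚ) • (x : V) = x
      rw [← Nat.cast_smul_eq_nsmul ℚ, smul_smul]
      norm_num
    · rintro ⟨y, hy⟩
      have : (x : V) = 2 • (y : V) := by rw [← hy]; rfl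
      rw [this, ← Nat.cast_smul_eq_nsmul ℚ, smul_smul]
      norm_num
  have hcard : Nat.card B.ker = Nat.card (nsmulAddMonoidHom (α := L.DiscGroup) 2).ker := by
    rw [← hgr, ← hfr, ← Nat.card_congr (QuotientAddGroup.quotientKerEquivRange f).toEquiv,
      ← Nat.card_congr (QuotientAddGroup.quotientKerEquivRange g).toEquiv, hker]
  rw [hindex, hcard] at hsq
  obtain ⟨r, hr⟩ := hnm
  rw [hr, pow_add] at hsq
  obtain ⟨s, hs⟩ := hsq
  have hdvd : 2 ^ r ∣ s := by
    rw [← Nat.pow_dvd_pow_iff two_ne_zero]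
    exact ⟨_, by rw [sq, sq, ← hs]⟩
  obtain ⟨t, rfl⟩ := hdvd
  refine ⟨t, ?_⟩
  apply mul_left_cancel₀ (show (2 ^ r * 2 ^ r : ℕ) ≠ 0 by positivity)
  rw [hs]; ring

end EvenLattice

namespace DiscriminantForm

theorem isSquare_card_two_torsion {D : Type*} [AddCommGroup D] {A : DiscriminantForm D}
    {V : Type*} [AddCommGroup V] [Module ℚ V] {L : EvenLattice V} {n m : ℕ}
    (h : L.HasSignature n m) (hnm : Even (n + m)) (hA : L.discForm.IsIsometric A) :
    IsSquare (Nat.card (nsmulAddMonoidHom (α := D) 2).ker) := by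
  obtain ⟨φ, -⟩ := hA
  have h1 := L.isSquare_card_two_torsion h hnm
  have h2 : Nat.card (nsmulAddMonoidHom (α := L.DiscGroup) 2).ker =
      Nat.card (nsmulAddMonoidHom (α := D) 2).ker := by
    refine Nat.card_congr (φ.toEquiv.subtypeEquiv fun x => ?_)
    change 2 • x = 0 ↔ 2 • φ x = 0
    rw [← map_nsmul, map_eq_zero_iff _ φ.injective]
  rwa [h2] at h1

end DiscriminantForm

/-! ### Weighted counts of coprime pairs modulo `N` -/

/-- A weight depending on the `p`-part of `c`. -/
noncomputable def localWeight (p ν : ℕ) (α β : ℚ) (c : ℕ) : ℚ :=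
  if p ^ ν ∣ c then 1 else if ¬ p ∣ c then 1 / p ^ ν else if p ^ (ν - 1) ∣ c then α else β

theorem sum_zmod_val {n : ℕ} [NeZero n] {R : Type*} [AddCommMonoid R] (f : ℕ → R) :
    ∑ x : ZMod n, f x.val = ∑ i ∈ Finset.range n, f i := by
  obtain ⟨k, rfl⟩ := Nat.exists_eq_succ_of_ne_zero (NeZero.ne n)
  exact Fin.sum_univ_eq_sum_range f (k + 1)

theorem sum_range_ite_dvd {a b : ℕ} (ha : 0 < a) :
    ∑ c ∈ Finset.range (a * b), (if a ∣ c then (1 : ℚ) else 0) = b := by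
  rw [Finset.sum_ite, Finset.sum_const_zero, add_zero, Finset.sum_const, nsmul_one]
  congr 1
  have : (Finset.range (a * b)).filter (a ∣ ·) = (Finset.range b).image (a * ·) := by
    ext c
    simp only [Finset.mem_filter, Finset.mem_range, Finset.mem_image]
    constructor
    · rintro ⟨h, t, rfl⟩
      exact ⟨t, lt_of_mul_lt_mul_left h ha.le, rfl⟩
    · rintro ⟨t, ht, rfl⟩
      exact ⟨Nat.mul_lt_mul_of_pos_left ht ha, dvd_mul_right _ _⟩
  rw [this, Finset.card_image_of_injective _ (mul_right_injective₀ ha.ne'), Finset.card_range]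

theorem sum_range_pow_ite_dvd {p ν j : ℕ} (hp : 0 < p) (hj : j ≤ ν) :
    ∑ c ∈ Finset.range (p ^ ν), (if p ^ j ∣ c then (1 : ℚ) else 0) = (p : ℚ) ^ (ν - j) := by
  have h := sum_range_ite_dvd (a := p ^ j) (b := p ^ (ν - j)) (by positivity)
  rw [← pow_add, Nat.add_sub_cancel' hj] at h
  rw [h]; push_cast; rfl

theorem isCoprime_zmod_prime_pow_iff {p ν : ℕ} (hp : p.Prime) (hν : 0 < ν)
    (c d : ZMod (p ^ ν)) : IsCoprime c d ↔ ¬ (p ∣ c.val ∧ p ∣ d.val) := by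
  have : NeZero (p ^ ν) := ⟨(pow_pos hp.pos ν).ne'⟩
  have hunit (x : ZMod (p ^ ν)) (h : ¬ p ∣ x.val) : IsUnit x := by
    have h1 := (ZMod.isUnit_iff_coprime x.val (p ^ ν)).2
      (((hp.coprime_iff_not_dvd).2 h).symm.pow_right ν)
    rwa [ZMod.natCast_zmod_val] at h1
  constructor
  · rintro ⟨a, b, hab⟩ ⟨hc, hd⟩
    have : Fact (1 < p) := ⟨hp.one_lt⟩
    have h1 := congrArg (ZMod.castHom (dvd_pow_self p hν.ne') (ZMod p)) hab
    have hz (x : ZMod (p ^ ν)) (h : p ∣ x.val) :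
        ZMod.castHom (dvd_pow_self p hν.ne') (ZMod p) x = 0 := by
      rw [← ZMod.natCast_zmod_val x, map_natCast, ZMod.natCast_eq_zero_iff]
      exact h
    rw [map_add, map_mul, map_mul, hz c hc, hz d hd, map_one] at h1
    simp at h1
  · intro h
    by_cases hc : p ∣ c.val
    · obtain ⟨u, rfl⟩ := hunit d fun hd => h ⟨hc, hd⟩
      exact ⟨0, ↑u⁻¹, by simp⟩
    · obtain ⟨u, rfl⟩ := hunit c hc
      exact ⟨↑u⁻¹, 0, by simp⟩

theorem sum_coprime_pairs_prime_pow {p ν : ℕ} (hp : p.Prime) (hν : 0 < ν) (u : ℕ → ℚ)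
    [NeZero (p ^ ν)] [∀ c d : ZMod (p ^ ν), Decidable (IsCoprime c d)] :
    ∑ v : ZMod (p ^ ν) × ZMod (p ^ ν), (if IsCoprime v.1 v.2 then u v.1.val else 0) =
      ∑ c ∈ Finset.range (p ^ ν),
        u c * (p ^ ν - p ^ (ν - 1) * (if p ^ 1 ∣ c then (1 : ℚ) else 0)) := by
  rw [Fintype.sum_prod_type, ← sum_zmod_val]
  refine Finset.sum_congr rfl fun c _ => ?_
  have h1 (d : ZMod (p ^ ν)) : (if IsCoprime c d then u c.val else 0) =
      u c.val * (1 - (if p ^ 1 ∣ c.val then (1 : ℚ) else 0) *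
        (if p ^ 1 ∣ d.val then (1 : ℚ) else 0)) := by
    rw [if_congr (isCoprime_zmod_prime_pow_iff hp hν c d) rfl rfl, pow_one]
    by_cases hc : p ∣ c.val <;> by_cases hd : p ∣ d.val <;> simp [hc, hd]
  simp only [h1]
  rw [← Finset.mul_sum, Finset.sum_sub_distrib, ← Finset.mul_sum,
    sum_zmod_val (fun d => if p ^ 1 ∣ d then (1 : ℚ) else 0), sum_range_pow_ite_dvd hp.pos hν]
  simp

theorem localWeight_mul {p ν : ℕ} (hν : 0 < ν) (α β U q : ℚ) (c : ℕ) :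
    localWeight p ν α β c * (q - (q - U) * (if p ^ 1 ∣ c then (1 : ℚ) else 0)) =
      U * (if p ^ ν ∣ c then 1 else 0) + q / p ^ ν * (1 - (if p ^ 1 ∣ c then 1 else 0)) +
        if ν = 1 then 0 else
        α * U * ((if p ^ (ν - 1) ∣ c then 1 else 0) - (if p ^ ν ∣ c then 1 else 0)) +
        β * U * ((if p ^ 1 ∣ c then 1 else 0) - (if p ^ (ν - 1) ∣ c then 1 else 0)) := by
  rw [localWeight, pow_one]
  by_cases h1 : p ∣ c
  · by_cases h2 : p ^ ν ∣ c
    · have h3 : p ^ (ν - 1) ∣ c := (pow_dvd_pow p (Nat.sub_le _ _)).trans h2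
      simp [h1, h2, h3]
    · have hν1 : ν ≠ 1 := by rintro rfl; exact h2 (by simpa using h1)
      by_cases h3 : p ^ (ν - 1) ∣ c
      · simp [h1, h2, h3, hν1]
      · simp [h1, h2, h3, hν1]
  · have h2 : ¬ p ^ ν ∣ c := fun h => h1 ((dvd_pow_self p hν.ne').trans h)
    by_cases hν1 : ν = 1
    · simp [h1, hν1, div_eq_inv_mul]
    · have h3 : ¬ p ^ (ν - 1) ∣ c := fun h => h1 ((dvd_pow_self p (by omega)).trans h)
      simp [h1, h2, h3, div_eq_inv_mul]

/-- With $U=p^\nu-p^{\nu-1}$, the pairs with $p\nmid c$ and those with $p^\nu\mid c$ each have total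
weight $U$. For $\nu\ge2$ the remaining pairs add $(p-1)U$, by the condition on $\alpha,\beta$.
There are $U(p^\nu+p^{\nu-1})$ pairs in all. -/
theorem local_count {p N : ℕ} (hp : p ∈ N.primeFactors) (α β : ℚ)
    (hαβ : N.factorization p ≠ 1 →
      α * (p - 1) + β * (p ^ (N.factorization p - 1) - p) = p - 1)
    [NeZero (p ^ N.factorization p)]
    [∀ c d : ZMod (p ^ N.factorization p), Decidable (IsCoprime c d)] :
    (∑ v : ZMod (p ^ N.factorization p) × ZMod (p ^ N.factorization p),
        if IsCoprime v.1 v.2 then localWeight p (N.factorization p) α β v.1.val else 0) *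
        localFactor p N =
      (∑ v : ZMod (p ^ N.factorization p) × ZMod (p ^ N.factorization p),
        if IsCoprime v.1 v.2 then 1 else 0) * if N.factorization p = 1 then 2 else 1 := by
  have hpp := Nat.prime_of_mem_primeFactors hp
  have hN : N ≠ 0 := (Nat.mem_primeFactors.1 hp).2.2
  have hν : 0 < N.factorization p :=
    hpp.factorization_pos_of_dvd hN (Nat.dvd_of_mem_primeFactors hp)
  rw [sum_coprime_pairs_prime_pow hpp hν, sum_coprime_pairs_prime_pow hpp hν (fun _ => 1),
    localFactor, if_neg hν.ne']
  set ν := N.factorization p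
  have hp0 : (p : ℚ) ≠ 0 := by exact_mod_cast hpp.ne_zero
  have h1 (c : ℕ) := localWeight_mul (p := p) hν α β (p ^ ν - p ^ (ν - 1) : ℚ) (p ^ ν) c
  simp only [sub_sub_cancel] at h1
  have e0 := sum_range_pow_ite_dvd hpp.pos (le_refl ν)
  have e1 := sum_range_pow_ite_dvd hpp.pos (Nat.succ_le_of_lt hν)
  have e2 := sum_range_pow_ite_dvd hpp.pos (Nat.sub_le ν 1)
  rw [Finset.sum_congr rfl fun c _ => h1 c]
  obtain ⟨k, hk⟩ := Nat.exists_eq_succ_of_ne_zero hν.ne'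
  have hk1 : ν - 1 = k := by omega
  have hk2 : ν - (ν - 1) = 1 := by omega
  by_cases hν1 : ν = 1
  · have hk0 : k = 0 := by omega
    simp only [if_pos hν1, add_zero, one_mul, Finset.sum_add_distrib, ← Finset.mul_sum,
      Finset.sum_sub_distrib, e0, e1, Nat.succ_eq_add_one, zero_add]
    simp [hν1, hp0]
    ring
  · simp only [if_neg hν1, one_mul, Finset.sum_add_distrib, ← Finset.mul_sum,
      Finset.sum_sub_distrib, e0, e1, e2, Nat.succ_eq_add_one, zero_add, hk2]
    have h2 := hαβ hν1
    have hpow : (p : ℚ) ^ ν = p ^ k * p := by rw [hk, pow_succ]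
    simp only [Finset.sum_const, Finset.card_range, nsmul_eq_mul, mul_one, Nat.cast_pow, hk1,
      Nat.sub_self, pow_zero, pow_one] at h2 ⊢
    rw [hpow]
    field_simp
    linear_combination (p - 1 : ℚ) * h2

section CoprimePairs

variable (N : ℕ) [NeZero N]

/-- Pairs of coprime residues modulo `N`. -/
abbrev CoprimePairs : Type := {v : ZMod N × ZMod N // IsCoprime v.1 v.2}

theorem isCoprime_pi_iff {ι : Type*} {R : ι → Type*} [∀ i, CommSemiring (R i)]
    (c d : ∀ i, R i) : IsCoprime c d ↔ ∀ i, IsCoprime (c i) (d i) := by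
  constructor
  · rintro ⟨a, b, h⟩ i
    exact ⟨a i, b i, congrFun h i⟩
  · intro h
    choose a b h using h
    exact ⟨a, b, funext h⟩

theorem isCoprime_ringEquiv_iff {R S : Type*} [CommSemiring R] [CommSemiring S] (e : R ≃+* S)
    (c d : R) : IsCoprime (e c) (e d) ↔ IsCoprime c d := by
  refine ⟨fun h => ?_, fun h => h.map e.toRingHom⟩
  have := h.map e.symm.toRingHom
  simpa using this

theorem val_equivPi_dvd_iff (p : N.primeFactors) {j : ℕ} (hj : j ≤ N.factorization p)
    (c : ZMod N) : (p : ℕ) ^ j ∣ (ZMod.equivPi N (NeZero.ne N) c p).val ↔ (p : ℕ) ^ j ∣ c.val := by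
  have h : ZMod.equivPi N (NeZero.ne N) c p =
      ((c.val : ℕ) : ZMod ((p : ℕ) ^ N.factorization p)) := by
    conv_lhs => rw [← ZMod.natCast_zmod_val c, map_natCast]
    rfl
  rw [h, ZMod.val_natCast, Nat.dvd_mod_iff (pow_dvd_pow _ hj)]

theorem localWeight_val_equivPi (p : N.primeFactors) (α β : ℚ) (c : ZMod N) :
    localWeight p (N.factorization p) α β (ZMod.equivPi N (NeZero.ne N) c p).val =
      localWeight p (N.factorization p) α β c.val := by
  have hν : 1 ≤ N.factorization p :=
    (Nat.prime_of_mem_primeFactors p.2).factorization_pos_of_dvd (NeZero.ne N)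
      (Nat.dvd_of_mem_primeFactors p.2)
  have h1 := val_equivPi_dvd_iff N p hν c
  rw [pow_one] at h1
  simp only [localWeight, val_equivPi_dvd_iff N p le_rfl c,
    val_equivPi_dvd_iff N p (Nat.sub_le _ 1) c, h1]

-- Chinese remainder theorem: coprimality and the local weights are both determined prime by prime.
open Classical in
theorem sum_coprimePairs_eq_prod (u : N.primeFactors → ℕ → ℚ)
    (hu : ∀ p (c : ZMod N), u p (ZMod.equivPi N (NeZero.ne N) c p).val = u p c.val)
    [∀ p : N.primeFactors, NeZero ((p : ℕ) ^ N.factorization p)] :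
    ∑ v : CoprimePairs N, ∏ p, u p v.1.1.val =
      ∏ p : N.primeFactors, ∑ v : ZMod ((p : ℕ) ^ N.factorization p) × ZMod _,
        if IsCoprime v.1 v.2 then u p v.1.val else 0 := by
  rw [Finset.prod_univ_sum, Fintype.piFinset_univ]
  have h1 : ∑ v : CoprimePairs N, ∏ p, u p v.1.1.val =
      ∑ v : ZMod N × ZMod N, if IsCoprime v.1 v.2 then ∏ p, u p v.1.val else 0 := by
    rw [← Finset.sum_filter]
    exact (Finset.sum_subtype (Finset.univ.filter fun v : ZMod N × ZMod N => IsCoprime v.1 v.2)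
      (fun v => by simp) fun v => ∏ p, u p v.1.val).symm
  rw [h1]
  let e := ZMod.equivPi N (NeZero.ne N)
  let E : ZMod N × ZMod N ≃
      ∀ p : N.primeFactors,
        ZMod ((p : ℕ) ^ N.factorization p) × ZMod ((p : ℕ) ^ N.factorization p) :=
    { toFun := fun v p => (e v.1 p, e v.2 p)
      invFun := fun w => (e.symm fun p => (w p).1, e.symm fun p => (w p).2)
      left_inv := fun v => by simp
      right_inv := fun w => by simp }
  refine Fintype.sum_equiv E _ _ fun v => ?_
  change _ = ∏ p, if IsCoprime (e v.1 p) (e v.2 p) then u p (e v.1 p).val else 0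
  by_cases h : IsCoprime v.1 v.2
  · have h2 := (isCoprime_pi_iff _ _).1 ((isCoprime_ringEquiv_iff e v.1 v.2).2 h)
    simp only [h, h2, if_true]
    exact Finset.prod_congr rfl fun p _ => (hu p v.1).symm
  · rw [if_neg h]
    have h2 : ¬ ∀ p, IsCoprime (e v.1 p) (e v.2 p) := fun h3 =>
      h ((isCoprime_ringEquiv_iff e v.1 v.2).1 ((isCoprime_pi_iff _ _).2 h3))
    push Not at h2
    obtain ⟨p, hp⟩ := h2
    exact (Finset.prod_eq_zero (Finset.mem_univ p) (if_neg hp)).symm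

open Classical in
theorem sum_weight_mul_prod_localFactor (α β : ℕ → ℚ)
    (hαβ : ∀ p ∈ N.primeFactors, N.factorization p ≠ 1 →
      α p * (p - 1) + β p * (p ^ (N.factorization p - 1) - p) = p - 1) :
    (∑ v : CoprimePairs N, ∏ p ∈ N.primeFactors,
        localWeight p (N.factorization p) (α p) (β p) v.1.1.val) *
      ∏ p ∈ N.primeFactors, (localFactor p N : ℚ) =
      Fintype.card (CoprimePairs N) * 2 ^ hallOmega N := by
  have (p : N.primeFactors) : NeZero ((p : ℕ) ^ N.factorization p) :=
    ⟨(pow_pos (Nat.prime_of_mem_primeFactors p.2).pos _).ne'⟩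
  have h1 : (∑ v : CoprimePairs N, ∏ p ∈ N.primeFactors,
      localWeight p (N.factorization p) (α p) (β p) v.1.1.val) =
      ∑ v : CoprimePairs N, ∏ p : N.primeFactors,
        localWeight p (N.factorization p) (α p) (β p) v.1.1.val :=
    Finset.sum_congr rfl fun v _ => (Finset.prod_coe_sort N.primeFactors
      fun p => localWeight p (N.factorization p) (α p) (β p) v.1.1.val).symm
  have h2 : (Fintype.card (CoprimePairs N) : ℚ) =
      ∑ v : CoprimePairs N, ∏ p : N.primeFactors, (fun _ _ => 1) p v.1.1.val := by
    simp
  have h3 : (2 : ℚ) ^ hallOmega N =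
      ∏ p : N.primeFactors, if N.factorization p = 1 then 2 else 1 := by
    rw [Finset.prod_coe_sort N.primeFactors fun p => if N.factorization p = 1 then (2 : ℚ) else 1,
      Finset.prod_ite, Finset.prod_const, Finset.prod_const_one, mul_one, hallOmega]
  rw [h1, h2, h3, ← Finset.prod_coe_sort N.primeFactors fun p => (localFactor p N : ℚ),
    sum_coprimePairs_eq_prod N
      (fun p c => localWeight p (N.factorization p) (α p) (β p) c)
      (fun p c => localWeight_val_equivPi N p _ _ c),
    sum_coprimePairs_eq_prod N (fun _ _ => 1) (fun _ _ => rfl), ← Finset.prod_mul_distrib,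
    ← Finset.prod_mul_distrib]
  exact Finset.prod_congr rfl fun p _ => local_count p.2 _ _ (hαβ p p.2)

end CoprimePairs

namespace DiscriminantForm

variable {D : Type*} [AddCommGroup D] (A : DiscriminantForm D)

/-! ### The pole orders of the twisted pairings -/

open Classical in
/-- The parameters of the local weight at `p`. -/
noncomputable def weightParams (p : ℕ) : ℚ × ℚ :=
  if p = 2 ∧ A.level.factorization 2 = 3 ∧ A.IsExceptional then (1 / 2, 1 / 4) else (1, 0)

/-- In the exceptional case $\frac12\cdot1+\frac14(4-2)=1$, so the loss for $2\mid c$, $4\nmid c$ is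
exactly compensated by the gain for $4\mid c$, $8\nmid c$. -/
theorem weightParams_eq {p : ℕ} (h : A.level.factorization p ≠ 1) :
    (A.weightParams p).1 * (p - 1) +
      (A.weightParams p).2 * (p ^ (A.level.factorization p - 1) - p) = p - 1 := by
  unfold weightParams
  split_ifs with h1
  · obtain ⟨rfl, h2, -⟩ := h1
    rw [h2]; norm_num
  · simp

theorem weightParams_nonneg (p : ℕ) : 0 ≤ (A.weightParams p).1 ∧ 0 ≤ (A.weightParams p).2 := by
  unfold weightParams
  split_ifs <;> norm_num

/-- The weight of the residue `c` modulo the level. -/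
noncomputable def weight (c : ℕ) : ℚ := ∏ p ∈ A.level.primeFactors,
  localWeight p (A.level.factorization p) (A.weightParams p).1 (A.weightParams p).2 c

theorem localWeight_nonneg {p ν : ℕ} {α β : ℚ} (hα : 0 ≤ α) (hβ : 0 ≤ β) (c : ℕ) :
    0 ≤ localWeight p ν α β c := by
  unfold localWeight
  split_ifs <;> positivity

theorem weight_nonneg (c : ℕ) : 0 ≤ A.weight c :=
  Finset.prod_nonneg fun p _ =>
    localWeight_nonneg (A.weightParams_nonneg p).1 (A.weightParams_nonneg p).2 c

variable {A} {γ μ : ℕ → D}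

theorem inv_pow_le_localWeight (hγ : A.IsRegularFamily γ μ)
    (hsq : IsSquare (Nat.card (nsmulAddMonoidHom (α := D) 2).ker)) {p : ℕ}
    (hpN : p ∈ A.level.primeFactors) {a b d : ℤ} {c : ℕ}
    (hdet : a * d - b * c ≡ 1 [ZMOD A.level]) {ℓ : D → ℂ} (hℓ : A.IsFixed c d ℓ) {y : D}
    (hy : A.twist A.level.primeFactors γ a b ℓ y ≠ 0) {δ : ℕ} (hδ : δ ∣ A.level)
    (hyδ : y ∈ A.reflectiveSet δ) :
    1 / (p : ℚ) ^ δ.factorization p ≤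
      localWeight p (A.level.factorization p) (A.weightParams p).1 (A.weightParams p).2 c := by
  have hp := Nat.prime_of_mem_primeFactors hpN
  have hδ0 : δ ≠ 0 := (Nat.pos_of_dvd_of_pos hδ A.level_pos).ne'
  obtain ⟨N', hN, hpN', hν⟩ := A.exists_level_eq hpN
  have hp1 : (1 : ℚ) ≤ p := by exact_mod_cast hp.one_le
  have hle {j : ℕ} (h : p ^ j ∣ δ) : 1 / (p : ℚ) ^ δ.factorization p ≤ 1 / (p : ℚ) ^ j := by
    have : j ≤ δ.factorization p := (hp.pow_dvd_iff_le_factorization hδ0).1 h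
    exact one_div_le_one_div_of_le (by positivity) (pow_le_pow_right₀ hp1 this)
  have hle0 := hle (j := 0) (by simp)
  rw [pow_zero, div_one] at hle0
  have hdvd (j : ℕ) : (p : ℤ) ^ j ∣ c ↔ p ^ j ∣ c := by exact_mod_cast Iff.rfl
  have hdvd1 : (p : ℤ) ∣ c ↔ p ∣ c := Int.natCast_dvd_natCast
  unfold localWeight
  split_ifs with h1 h2 h3
  · exact hle0
  · unfold weightParams
    split_ifs with h4
    · obtain ⟨rfl, h5, hexc⟩ := h4
      rw [h5] at hN h1 h3
      have h6 : 2 ∣ δ := by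
        by_contra hδ2
        refine hexc.false (fun x hx => ?_) hN hpN' hsq
        exact twist_support_two hγ hpN hN hpN' hdet (by exact_mod_cast h3)
          (by exact_mod_cast h1) hℓ hy hδ2 hyδ x hx
      simpa using hle (j := 1) (by simpa using h6)
    · exact hle0
  · obtain ⟨rfl, h5, h6, hexc⟩ := twist_support_of_dvd hγ hpN hN hpN' hdet
      (hdvd1.2 (by simpa using h2))
      (fun h => h3 ((hdvd _).1 h)) hℓ hy hδ hyδ
    rw [weightParams, if_pos ⟨rfl, h5, hexc⟩]
    refine (hle h6).trans (le_of_eq ?_)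
    norm_num
  · exact hle (twist_support_of_not_dvd hγ hpN hN hν (mt hdvd1.1 (by simpa using h2)) hℓ hy hδ hyδ)

/-- The pole order $1/\delta$ is the product of its $p$-parts, each bounded by the local weight. -/
theorem one_div_le_weight (hγ : A.IsRegularFamily γ μ)
    (hsq : IsSquare (Nat.card (nsmulAddMonoidHom (α := D) 2).ker)) {c : ℕ} {d : ℤ} {v : D → ℂ}
    (hv : A.IsTwistedFixed A.level.primeFactors γ c d v) {y : D} (hy : v y ≠ 0) {δ : ℕ}
    (hδ : δ ∣ A.level) (hyδ : y ∈ A.reflectiveSet δ) : 1 / (δ : ℚ) ≤ A.weight c := by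
  obtain ⟨a, b, hdet, ℓ, hℓ, -, rfl⟩ := hv
  have hδ0 : δ ≠ 0 := (Nat.pos_of_dvd_of_pos hδ A.level_pos).ne'
  have h1 : (δ : ℚ) = ∏ p ∈ A.level.primeFactors, (p : ℚ) ^ δ.factorization p := by
    have h2 := Nat.prod_factorization_pow_eq_self hδ0
    rw [Finsupp.prod_of_support_subset _ (s := A.level.primeFactors)
      (Nat.primeFactors_mono hδ A.level_pos.ne') _ (fun _ _ => pow_zero _)] at h2
    exact_mod_cast h2.symm
  rw [h1, weight, one_div, ← Finset.prod_inv_distrib]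
  simp only [← one_div]
  refine Finset.prod_le_prod (fun p _ => by positivity) fun p hp => ?_
  exact inv_pow_le_localWeight hγ hsq hp hdet hℓ hy hδ hyδ

theorem norm_exp_two_pi_I_mul (τ : ℍ) (r : ℝ) :
    ‖Complex.exp (2 * Real.pi * Complex.I * τ * r)‖ = Real.exp (-(2 * Real.pi * r * τ.im)) := by
  rw [Complex.norm_exp]
  congr 1
  simp
  ring

theorem HasLeadingTerm.isBigO {D : Type*} {F : ℍ → D → ℂ} {y : D} {δ : ℕ} {c : ℂ}
    (h : HasLeadingTerm F y δ c) {w : ℚ} (hw : 1 / (δ : ℚ) ≤ w) :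
    (fun τ => F τ y) =O[atImInfty] fun τ => Real.exp (2 * Real.pi * w * τ.im) := by
  have h1 := (h.isBigO_one ℝ)
  obtain ⟨K, hK⟩ := h1.bound
  refine Asymptotics.IsBigO.of_bound K ?_
  filter_upwards [hK] with τ hτ
  have h2 := norm_exp_two_pi_I_mul τ (1 / δ : ℝ)
  have h3 : Complex.exp (2 * Real.pi * Complex.I * τ * (1 / δ : ℝ)) =
      Complex.exp (2 * Real.pi * Complex.I * τ / δ) := by
    congr 1; push_cast; ring
  rw [h3] at h2
  rw [norm_mul, h2, norm_one, mul_one, Real.exp_neg, inv_mul_le_iff₀ (Real.exp_pos _)] at hτ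
  rw [Real.norm_eq_abs, abs_of_pos (Real.exp_pos _)]
  have hK0 : 0 ≤ K := by
    by_contra hneg
    have := mul_neg_of_pos_of_neg (Real.exp_pos (2 * Real.pi * (1 / δ : ℝ) * τ.im)) (not_le.1 hneg)
    exact absurd (norm_nonneg (F τ y)) (not_le.2 (hτ.trans_lt this))
  rw [mul_comm] at hτ
  refine hτ.trans (mul_le_mul_of_nonneg_left (Real.exp_le_exp.2 ?_) hK0)
  have hw' : (1 / δ : ℝ) ≤ w := by
    have := (Rat.cast_le (K := ℝ)).2 hw
    push_cast at this
    exact this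
  have := τ.im_pos
  gcongr

theorem isBigO_of_not_isSingularAt {D : Type*} {F : ℍ → D → ℂ} {y : D} (h : ¬ IsSingularAt F y)
    {w : ℚ} (hw : 0 ≤ w) :
    (fun τ => F τ y) =O[atImInfty] fun τ => Real.exp (2 * Real.pi * w * τ.im) := by
  have h1 : IsBoundedAtImInfty fun τ => F τ y := not_not.1 h
  refine Asymptotics.IsBigO.trans h1 (Asymptotics.isBigO_of_le _ fun τ => ?_)
  have : (0 : ℝ) ≤ w := by exact_mod_cast hw
  have := τ.im_pos
  rw [Pi.one_apply, norm_one, Real.norm_eq_abs, abs_of_pos (Real.exp_pos _)]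
  exact Real.one_le_exp (by positivity)

theorem IsWeaklyReflective.pairWith_isBigO [Fintype D] {s k : ℤ} {F : ℍ → D → ℂ}
    (hF : A.IsWeaklyReflective s k F) (hγ : A.IsRegularFamily γ μ)
    (hsq : IsSquare (Nat.card (nsmulAddMonoidHom (α := D) 2).ker)) {c : ℕ} {d : ℤ} {v : D → ℂ}
    (hv : A.IsTwistedFixed A.level.primeFactors γ c d v) :
    pairWith v F =O[atImInfty] fun τ => Real.exp (2 * Real.pi * A.weight c * τ.im) := by
  refine Asymptotics.IsBigO.fun_sum fun y _ => ?_
  by_cases hy : v y = 0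
  · simpa [hy] using Asymptotics.isBigO_zero _ _
  refine Asymptotics.IsBigO.const_mul_left ?_ _
  by_cases hs : IsSingularAt F y
  · obtain ⟨δ, hδ, hyδ, e, he⟩ := hF.pole y hs
    exact HasLeadingTerm.isBigO he (one_div_le_weight hγ hsq hv hy hδ hyδ)
  · exact isBigO_of_not_isSingularAt hs (A.weight_nonneg c)

/-! ### Non-vanishing -/

theorem IsFixed.eq_zero_of_ne {ℓ : D → ℂ} (hℓ : A.IsFixed 0 1 ℓ) {y : D} (hy : y ≠ 0) :
    ℓ y = 0 := by
  by_contra h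
  refine hy (A.nondegenerate y fun x => ?_)
  have := hℓ.pairing_eq h (zero_zsmul x)
  simp only [zero_mul, zero_zsmul, one_smul, zero_add] at this
  rw [← pairing, A.pairing_comm, this]

/-- Here $\ell$ is a multiple of the indicator of 0, so the twist lives on negatives of partial sums
of the $\gamma_p$. The non-empty sums are non-zero, so nothing cancels the value at 0. -/
theorem IsTwistedFixed.support_zero_one (hγ : A.IsRegularFamily γ μ) {v : D → ℂ}
    (hv : A.IsTwistedFixed A.level.primeFactors γ 0 1 v) :
    v 0 ≠ 0 ∧ ∀ y, v y ≠ 0 → A.q y = 0 := by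
  obtain ⟨a, b, hdet, ℓ, hℓ, ⟨z, hz⟩, rfl⟩ := hv
  have ha : a ≡ 1 [ZMOD A.level] := by simpa using hdet
  constructor
  · rw [twist, Finset.sum_eq_single ∅]
    · have : z = 0 := by
        by_contra h
        exact hz (hℓ.eq_zero_of_ne h)
      subst this
      simpa using hz
    · intro S hS hne
      rw [Finset.mem_powerset] at hS
      rw [A.zsmul_congr ha, one_smul, zero_add, hℓ.eq_zero_of_ne, mul_zero, mul_zero]
      exact hγ.sum_ne_zero hS (Finset.nonempty_iff_ne_empty.2 hne)
    · intro h; simp at h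
  · intro y hy
    obtain ⟨S, hS, hne⟩ := Finset.exists_ne_zero_of_sum_ne_zero hy
    have h1 : y + a • ∑ p ∈ S, γ p = 0 := by
      by_contra h
      exact hne (by rw [hℓ.eq_zero_of_ne h, mul_zero, mul_zero])
    rw [eq_neg_of_add_eq_zero_left h1, ← _root_.neg_smul, A.q_zsmul,
      hγ.isotropicSums S hS, zsmul_zero]

theorem eq_zero_of_reflective_of_isotropic {y : D} {δ : ℕ} (hδ : 0 < δ)
    (hy : y ∈ A.reflectiveSet δ) (hq : A.q y = 0) : y = 0 := by
  have h1 := (nsmul_q_eq_zero_iff hδ hy 1).1 (by rw [hq, smul_zero])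
  simpa [Nat.dvd_one.1 h1] using hy.1

/-- If the pairing vanished, $F_0$ would be a combination of components at non-zero isotropic
elements. Such elements are not reflective, so these components are bounded, whereas $F_0$ is not.
-/
theorem IsWeaklyReflective.exists_pairWith_ne_zero [Fintype D] {s k : ℤ} {F : ℍ → D → ℂ}
    (hF : A.IsWeaklyReflective s k F) (h0 : IsSingularAt F 0) (hγ : A.IsRegularFamily γ μ)
    {v : D → ℂ} (hv : A.IsTwistedFixed A.level.primeFactors γ 0 1 v) :
    ∃ τ, pairWith v F τ ≠ 0 := by
  classical
  obtain ⟨hv0, hvq⟩ := hv.support_zero_one hγ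
  by_contra! hcon
  refine h0 ?_
  have h1 : (fun τ => F τ 0) =
      fun τ => -(v 0)⁻¹ * ∑ y ∈ Finset.univ.erase 0, v y * F τ y := by
    ext τ
    have h2 := hcon τ
    rw [pairWith, ← Finset.add_sum_erase _ _ (Finset.mem_univ 0)] at h2
    field_simp
    linear_combination h2
  rw [h1]
  refine Asymptotics.IsBigO.const_mul_left (Asymptotics.IsBigO.fun_sum fun y hy => ?_) _
  by_cases hvy : v y = 0
  · simpa [hvy] using Asymptotics.isBigO_zero _ _
  refine Asymptotics.IsBigO.const_mul_left ?_ _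
  by_contra hs
  obtain ⟨δ, hδ, hyδ, -⟩ := hF.pole y hs
  exact Finset.ne_of_mem_erase hy (eq_zero_of_reflective_of_isotropic
    (Nat.pos_of_dvd_of_pos hδ A.level_pos) hyδ (hvq y hvy))

end DiscriminantForm

/-! ### The action of `SL₂(ℤ)` on coprime pairs modulo `N` -/

namespace CoprimePairs

variable {N : ℕ}

/-- The pair `(d, -c)`. -/
def rotate : CoprimePairs N ≃ CoprimePairs N where
  toFun v := ⟨(v.1.2, -v.1.1), v.2.symm.neg_right⟩
  invFun v := ⟨(-v.1.2, v.1.1), v.2.symm.neg_left⟩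
  left_inv v := by simp
  right_inv v := by simp

/-- The pair `(c, d + c)`. -/
def shear : CoprimePairs N ≃ CoprimePairs N where
  toFun v := ⟨(v.1.1, v.1.2 + v.1.1), by simpa using v.2.add_mul_left_right 1⟩
  invFun v := ⟨(v.1.1, v.1.2 - v.1.1), by simpa [sub_eq_add_neg] using v.2.add_mul_left_right (-1)⟩
  left_inv v := by simp
  right_inv v := by simp

theorem isCoprime_bottom_row (M : SL(2, ℤ)) : IsCoprime (M 1 0) (M 1 1) := by
  have h := M.det_coe
  rw [Matrix.det_fin_two] at h
  exact ⟨-M 0 1, M 0 0, by linear_combination h⟩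

/-- The bottom row of a matrix, reduced modulo `N`. -/
def bottomRow (N : ℕ) (M : SL(2, ℤ)) : CoprimePairs N :=
  ⟨((M 1 0 : ℤ), (M 1 1 : ℤ)), (isCoprime_bottom_row M).map (Int.castRingHom (ZMod N))⟩

theorem bottomRow_mul_S (M : SL(2, ℤ)) :
    bottomRow N (M * ModularGroup.S) = rotate (bottomRow N M) := by
  refine Subtype.ext (Prod.ext ?_ ?_) <;>
    simp [bottomRow, rotate, Matrix.SpecialLinearGroup.coe_mul, Matrix.mul_apply,
      ModularGroup.coe_S]

theorem bottomRow_mul_T (M : SL(2, ℤ)) :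
    bottomRow N (M * ModularGroup.T) = shear (bottomRow N M) := by
  refine Subtype.ext (Prod.ext ?_ ?_) <;>
    simp [bottomRow, shear, Matrix.SpecialLinearGroup.coe_mul, Matrix.mul_apply, ModularGroup.coe_T,
      add_comm]

/-- Let $m\equiv c$ be positive. As $d$ is a unit modulo $\gcd(m,N)$, it lifts to a unit modulo $m$;
gluing this with $d$ modulo $N$ gives a second entry prime to $m$. -/
theorem exists_isCoprime_int [NeZero N] {c d : ZMod N} (h : IsCoprime c d) :
    ∃ c' d' : ℤ, IsCoprime c' d' ∧ (c' : ZMod N) = c ∧ (d' : ZMod N) = d := by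
  obtain ⟨m, hm0, hm⟩ : ∃ m : ℕ, m ≠ 0 ∧ (m : ZMod N) = c :=
    ⟨c.val + N, by have := NeZero.ne N; omega, by simp⟩
  have : NeZero m := ⟨hm0⟩
  have hg : IsUnit (ZMod.castHom (Nat.gcd_dvd_right m N) (ZMod (m.gcd N)) d) := by
    have h1 := h.map (ZMod.castHom (Nat.gcd_dvd_right m N) (ZMod (m.gcd N)))
    rw [← hm, map_natCast, (ZMod.natCast_eq_zero_iff m (m.gcd N)).2 (Nat.gcd_dvd_left m N)] at h1
    exact isCoprime_zero_left.1 h1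
  obtain ⟨u, hu⟩ := ZMod.unitsMap_surjective (Nat.gcd_dvd_left m N) hg.unit
  have h2 : (u : ZMod m).val ≡ d.val [MOD m.gcd N] := by
    rw [← ZMod.natCast_eq_natCast_iff]
    have h3 := congrArg Units.val hu
    rw [ZMod.unitsMap_val, IsUnit.unit_spec] at h3
    rw [ZMod.castHom_apply] at h3
    rw [ZMod.natCast_val, ZMod.natCast_val, h3]
  obtain ⟨e, he, he'⟩ := Nat.chineseRemainder' h2
  refine ⟨m, e, ?_, by exact_mod_cast hm, ?_⟩
  · rw [Nat.isCoprime_iff_coprime, Nat.coprime_comm, ← ZMod.isUnit_iff_coprime,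
      (ZMod.natCast_eq_natCast_iff _ _ _).2 he, ZMod.natCast_zmod_val]
    exact u.isUnit
  · have := (ZMod.natCast_eq_natCast_iff _ _ _).2 he'
    rw [ZMod.natCast_zmod_val] at this
    exact_mod_cast this

theorem bottomRow_surjective [NeZero N] : Function.Surjective (bottomRow N) := by
  rintro ⟨⟨c, d⟩, h⟩
  obtain ⟨c', d', hcd, rfl, rfl⟩ := exists_isCoprime_int h
  obtain ⟨g, -, hg⟩ := ModularGroup.bottom_row_surj (R := ℤ) (a := ![c', d']) hcd
  refine ⟨g, Subtype.ext (Prod.ext ?_ ?_)⟩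
  · change ((g 1 0 : ℤ) : ZMod N) = c'
    rw [show g 1 0 = c' from congrFun hg 0]
  · change ((g 1 1 : ℤ) : ZMod N) = d'
    rw [show g 1 1 = d' from congrFun hg 1]

/-- Induction along the action of the generators. -/
theorem induction_on [NeZero N] {Q : CoprimePairs N → Prop} (h1 : Q (bottomRow N 1))
    (hS : ∀ v, Q v → Q (rotate v)) (hT : ∀ v, Q v → Q (shear v)) (v : CoprimePairs N) : Q v := by
  -- A permutation of a finite set has a power of itself as inverse, so forward stability suffices.
  have hinv (e : Equiv.Perm (CoprimePairs N)) (he : ∀ v, Q v → Q (e v)) (v) : Q v ↔ Q (e v) := by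
    refine ⟨he v, fun h => ?_⟩
    have h1 (n : ℕ) : Q ((e ^ n) (e v)) := by
      induction n with
      | zero => simpa using h
      | succ n ih => rw [pow_succ', Equiv.Perm.mul_apply]; exact he _ ih
    have h2 := h1 (orderOf e - 1)
    rwa [← Equiv.Perm.mul_apply, ← pow_succ, Nat.sub_add_cancel (orderOf_pos e),
      pow_orderOf_eq_one] at h2
  obtain ⟨g, rfl⟩ := bottomRow_surjective v
  have hg : g ∈ Subgroup.closure {ModularGroup.S, ModularGroup.T} := by
    simp [SpecialLinearGroup.SL2Z_generators]
  suffices h : ∀ M, Q (bottomRow N M) ↔ Q (bottomRow N (M * g)) by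
    simpa using (h 1).1 h1
  induction hg using Subgroup.closure_induction with
  | mem g hg =>
    intro M
    rcases hg with rfl | rfl
    · rw [bottomRow_mul_S]; exact hinv _ hS _
    · rw [bottomRow_mul_T]; exact hinv _ hT _
  | one => simp
  | mul g g' _ _ h h' => intro M; rw [h M, h' (M * g), mul_assoc]
  | inv g _ h => intro M; rw [h (M * g⁻¹), inv_mul_cancel_right]

end CoprimePairs

/-! ### Proof of the weight bound. -/

namespace DiscriminantForm

variable {D : Type*} [AddCommGroup D] {A : DiscriminantForm D}

theorem pairWith_of_eq_mul {D : Type*} [Fintype D] {v v' : D → ℂ} {c : ℂ} (h : ∀ y, v' y = c * v y)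
    (F : ℍ → D → ℂ) (τ : ℍ) : pairWith v' F τ = c * pairWith v F τ := by
  simp only [pairWith, h, Finset.mul_sum, mul_assoc]

theorem IsModularForm.mdifferentiable_pairWith [Fintype D] {s k : ℤ} {F : ℍ → D → ℂ}
    (hF : A.IsModularForm s k F) (v : D → ℂ) :
    MDifferentiable 𝓘(ℂ) 𝓘(ℂ) (pairWith v F) := by
  have h1 (y : D) : MDifferentiable 𝓘(ℂ) 𝓘(ℂ) (v y • fun τ => F τ y) :=
    (hF.holomorphic y).const_smul (v y)
  have h (s : Finset D) : MDifferentiable 𝓘(ℂ) 𝓘(ℂ) (∑ y ∈ s, v y • fun τ => F τ y) := by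
    classical
    induction s using Finset.induction_on with
    | empty => exact mdifferentiable_const
    | insert a s ha ih => rw [Finset.sum_insert ha]; exact (h1 a).add ih
  convert h Finset.univ using 1
  ext τ
  simp [pairWith]

/-- Integrality of the weight $1-n/2$ makes the rank $n+2$ even. -/
theorem IsWeaklyReflective.isSquare_card_two_torsion {s k : ℤ} {F : ℍ → D → ℂ}
    (hF : A.IsWeaklyReflective s k F) :
    IsSquare (Nat.card (nsmulAddMonoidHom (α := D) 2).ker) := by
  obtain ⟨V, _, _, L, n, hL, -, hk, hA⟩ := hF.exists_lattice
  refine DiscriminantForm.isSquare_card_two_torsion hL ?_ hA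
  have h1 : (n : ℤ) = 2 * (1 - k) := by
    have : (n : ℚ) = 2 * (1 - k) := by linarith
    exact_mod_cast this
  have h2 : Even (n : ℤ) := ⟨1 - k, by linarith⟩
  exact ((Int.even_coe_nat n).1 h2).add even_two

theorem exists_det_modEq {N : ℕ} [NeZero N] {c d : ZMod N} (h : IsCoprime c d) :
    ∃ a b : ℤ, a * (d.val : ℤ) - b * (c.val : ℤ) ≡ 1 [ZMOD N] := by
  obtain ⟨a, b, hab⟩ := h
  refine ⟨b.val, -a.val, ?_⟩
  rw [← ZMod.intCast_eq_intCast_iff]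
  push_cast
  simp only [ZMod.natCast_val, ZMod.cast_id', id]
  linear_combination hab

/-- The bound for the weight of a weakly reflective form on a regular discriminant form. -/
theorem IsWeaklyReflective.weight_bound (hreg : A.IsRegular) {s k : ℤ} {F : ℍ → D → ℂ}
    (hF : A.IsWeaklyReflective s k F) (h0 : IsSingularAt F 0) :
    -(k : ℚ) / 12 * ∏ p ∈ A.level.primeFactors, (localFactor p A.level : ℚ) ≤
      2 ^ hallOmega A.level := by
  classical
  have := A.finite
  cases nonempty_fintype D
  have hN : NeZero A.level := ⟨A.level_pos.ne'⟩
  obtain ⟨γ, μ, hγ⟩ := hreg.exists_family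
  have hM := hF.isModularForm
  have hiso := hγ.isotropicSums
  -- Any choice on each line works: by uniqueness $S$ and $T$ then permute the choices up to
  -- scalars.
  have hex (v : CoprimePairs A.level) : ∃ l : D → ℂ,
      A.IsTwistedFixed A.level.primeFactors γ (v.1.1.val : ℤ) (v.1.2.val : ℤ) l := by
    obtain ⟨a, b, hab⟩ := exists_det_modEq v.2
    exact exists_isTwistedFixed hab
  choose l hl using hex
  have hcast {x : ZMod A.level} {m : ℤ} (h : (m : ZMod A.level) = x) :
      m ≡ (x.val : ℤ) [ZMOD A.level] := by
    rw [← ZMod.intCast_eq_intCast_iff, h]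
    simp
  have hC : Complex.exp (2 * Real.pi * Complex.I * (s / 8)) / (Real.sqrt (Nat.card D) : ℂ) ≠ 0 := by
    refine div_ne_zero (Complex.exp_ne_zero _) ?_
    have : (0 : ℝ) < Nat.card D := by exact_mod_cast Nat.card_pos
    exact_mod_cast (Real.sqrt_pos.2 this).ne'
  have hS (v : CoprimePairs A.level) : ∃ c : ℂ, ∀ τ : ℍ,
      pairWith (l v) F (ModularGroup.S • τ) = c * (τ : ℂ) ^ k * pairWith (l v.rotate) F τ := by
    have h1 := ((hl v).weilS hiso hC).congr (c' := (v.rotate.1.1.val : ℤ))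
      (d' := (v.rotate.1.2.val : ℤ)) (hcast (by simp [CoprimePairs.rotate]))
      (hcast (by simp [CoprimePairs.rotate]))
    obtain ⟨c, hc⟩ := (hl v.rotate).unique hiso h1
    refine ⟨c, fun τ => ?_⟩
    rw [hM.pairWith_S, pairWith_of_eq_mul hc]
    ring
  have hT (v : CoprimePairs A.level) : ∃ c : ℂ, ∀ τ : ℍ,
      pairWith (l v) F (ModularGroup.T • τ) = c * pairWith (l v.shear) F τ := by
    have h1 := ((hl v).weilT hiso).congr (c' := (v.shear.1.1.val : ℤ))
      (d' := (v.shear.1.2.val : ℤ)) (hcast (by simp [CoprimePairs.shear]))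
      (hcast (by simp [CoprimePairs.shear]))
    obtain ⟨c, hc⟩ := (hl v.shear).unique hiso h1
    refine ⟨c, fun τ => ?_⟩
    rw [hM.pairWith_T, pairWith_of_eq_mul hc]
  -- Non-vanishing at $(0,1)$ spreads along the transitive action: if the pairing at $Sv$ or $Tv$
  -- vanished identically, so would the one at $v$'s image point, contradicting the functional
  -- equation.
  have hne (v : CoprimePairs A.level) : ∃ τ, pairWith (l v) F τ ≠ 0 := by
    refine CoprimePairs.induction_on (Q := fun v => ∃ τ, pairWith (l v) F τ ≠ 0) ?_ ?_ ?_ v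
    · refine hF.exists_pairWith_ne_zero h0 hγ ((hl _).congr ?_ ?_)
      · exact (hcast (by simp [CoprimePairs.bottomRow])).symm
      · exact (hcast (by simp [CoprimePairs.bottomRow])).symm
    · rintro v ⟨τ, hτ⟩
      obtain ⟨c, hc⟩ := hS v
      refine ⟨ModularGroup.S⁻¹ • τ, fun h => hτ ?_⟩
      have := hc (ModularGroup.S⁻¹ • τ)
      rwa [smul_inv_smul, h, mul_zero] at this
    · rintro v ⟨τ, hτ⟩
      obtain ⟨c, hc⟩ := hT v
      refine ⟨ModularGroup.T⁻¹ • τ, fun h => hτ ?_⟩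
      have := hc (ModularGroup.T⁻¹ • τ)
      rwa [smul_inv_smul, h, mul_zero] at this
  have key := weight_le_of_permuted_family (fun v => pairWith (l v) F) k
    CoprimePairs.rotate CoprimePairs.shear (fun v => hM.mdifferentiable_pairWith _) hne hS hT
    (fun v => A.weight v.1.1.val) (fun v => A.weight_nonneg _)
    (fun v => hF.pairWith_isBigO hγ hF.isSquare_card_two_torsion (hl v))
  have hcount := sum_weight_mul_prod_localFactor A.level (fun p => (A.weightParams p).1)
    (fun p => (A.weightParams p).2) fun p _ h => weightParams_eq A h
  have hcard : (0 : ℚ) < Fintype.card (CoprimePairs A.level) := by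
    exact_mod_cast Fintype.card_pos_iff.2 ⟨CoprimePairs.bottomRow _ 1⟩
  refine le_of_mul_le_mul_left ?_ hcard
  rw [← hcount]
  refine le_trans (le_of_eq ?_) (mul_le_mul_of_nonneg_right key
    (Finset.prod_nonneg fun p _ => Nat.cast_nonneg (localFactor p A.level)))
  ring

end DiscriminantForm

namespace DiscriminantForm

variable {D : Type*} [AddCommGroup D] {A : DiscriminantForm D}

/-! ### The Gauss sum of a discriminant form carrying a modular form -/

theorem HasLeadingTerm.isSingularAt {F : ℍ → D → ℂ} (h : HasLeadingTerm F 0 1 1) :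
    IsSingularAt F 0 := by
  intro hb
  have h1 : Tendsto (fun τ : ℍ => Complex.exp (2 * Real.pi * Complex.I * τ / (1 : ℕ)))
      atImInfty (𝓝 0) := by
    rw [tendsto_zero_iff_norm_tendsto_zero]
    have h2 (τ : ℍ) : ‖Complex.exp (2 * Real.pi * Complex.I * τ / (1 : ℕ))‖ =
        Real.exp (-(2 * Real.pi * τ.im)) := by
      have := norm_exp_two_pi_I_mul τ 1
      simpa using this
    simp only [h2]
    refine Real.tendsto_exp_neg_atTop_nhds_zero.comp ?_
    exact tendsto_comap.const_mul_atTop (by positivity)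
  have h3 := h1.zero_mul_isBoundedUnder_le (g := fun τ => F τ 0)
    (Asymptotics.isBigO_one_iff (F := ℝ) |>.1 hb)
  exact zero_ne_one (tendsto_nhds_unique h3 h)

variable (A) in
/-- The Gauss sum of the conjugate form. -/
noncomputable def gaussSum [Fintype D] : ℂ := ∑ y, expQZ (-A.q y)

/-- Completing the square, by the substitution $y\mapsto y+w$. -/
theorem sum_expQZ_pairing_sub_q [Fintype D] (w : D) :
    ∑ y, expQZ (A.pairing w y - A.q y) = A.gaussSum * expQZ (A.q w) := by
  rw [gaussSum, Finset.sum_mul, ← Equiv.sum_comp (Equiv.addRight w)]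
  refine Finset.sum_congr rfl fun y _ => ?_
  rw [Equiv.coe_addRight, ← expQZ_add, A.q_add, A.pairing_add_right, A.pairing_self,
    A.pairing_comm y w]
  congr 1
  abel

/-- $F_0(S\tau)$ is computed directly and through $TSTST=S$. Completing the square makes the two
results differ by the factor $C\cdot G$, and the common value is non-zero for some $\tau$. This
takes the place of Milgram's formula. -/
theorem IsModularForm.mul_gaussSum [Fintype D] {s k : ℤ} {F : ℍ → D → ℂ}
    (hF : A.IsModularForm s k F) (h0 : ∃ τ, F τ 0 ≠ 0) :
    Complex.exp (2 * Real.pi * Complex.I * (s / 8)) / (Real.sqrt (Nat.card D) : ℂ) *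
      A.gaussSum = 1 := by
  set C := Complex.exp (2 * Real.pi * Complex.I * (s / 8)) / (Real.sqrt (Nat.card D) : ℂ) with hC
  have hS (β : D) (τ : ℍ) : F (ModularGroup.S • τ) β =
      (τ : ℂ) ^ k * (C * ∑ y, expQZ (A.pairing β y) * F τ y) := by
    rw [hF.transform_S]
    simp only [DiscriminantForm.weilS, LinearMap.coe_mk, AddHom.coe_mk,
      Pi.smul_apply, smul_eq_mul, finsum_eq_sum_of_fintype, A.pairing_comm β, hC]
  have hT (β : D) (τ : ℍ) : F (ModularGroup.T • τ) β = expQZ (-A.q β) * F τ β := by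
    rw [hF.transform_T]; rfl
  obtain ⟨τ, hτ⟩ : ∃ τ, F (ModularGroup.S • τ) 0 ≠ 0 := by
    obtain ⟨τ, hτ⟩ := h0
    exact ⟨ModularGroup.S • τ, by rwa [S_smul_S_smul]⟩
  have h1 : F (ModularGroup.S • τ) 0 =
      (((ModularGroup.T • ModularGroup.S • ModularGroup.T • τ : ℍ) : ℂ) *
        (ModularGroup.T • τ : ℍ)) ^ k * (C * (C * A.gaussSum * ∑ y, F τ y)) := by
    conv_lhs => rw [← TSTST_smul]
    rw [hT, hS, mul_zpow, mul_assoc]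
    simp only [hT, hS, A.q_zero, neg_zero, expQZ_zero, one_mul, A.pairing_zero_left]
    congr 1
    rw [mul_left_comm]
    congr 1
    have h2 (β : D) : expQZ (-A.q β) * (((ModularGroup.T • τ : ℍ) : ℂ) ^ k *
        (C * ∑ y, expQZ (A.pairing β y) * (expQZ (-A.q y) * F τ y))) =
        ((ModularGroup.T • τ : ℍ) : ℂ) ^ k * C * ∑ y, expQZ (A.pairing y β - A.q β) *
          (expQZ (-A.q y) * F τ y) := by
      simp only [Finset.mul_sum]
      refine Finset.sum_congr rfl fun y _ => ?_
      rw [sub_eq_add_neg, expQZ_add, A.pairing_comm y β]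
      ring
    simp only [h2, ← Finset.mul_sum]
    rw [mul_assoc, Finset.sum_comm]
    congr 1
    rw [mul_assoc]
    congr 1
    rw [Finset.mul_sum]
    refine Finset.sum_congr rfl fun y _ => ?_
    rw [← Finset.sum_mul, sum_expQZ_pairing_sub_q, expQZ_neg]
    field_simp [expQZ_ne_zero]
  rw [coe_ST_smul, hS] at h1
  simp only [A.pairing_zero_left, expQZ_zero, one_mul] at h1
  rw [hS] at hτ
  simp only [A.pairing_zero_left, expQZ_zero, one_mul] at hτ
  refine mul_left_cancel₀ hτ ?_
  linear_combination -h1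

theorem IsModularForm.signature_dvd_of_level_one [Finite D] {s k : ℤ} {F : ℍ → D → ℂ}
    (hF : A.IsModularForm s k F) (h0 : ∃ τ, F τ 0 ≠ 0) (hN : A.level = 1) : 8 ∣ s := by
  cases nonempty_fintype D
  have h := hF.mul_gaussSum h0
  have hz (x : D) : x = 0 := by
    have := A.level_nsmul x
    rwa [hN, one_smul] at this
  have : Unique D := ⟨⟨0⟩, hz⟩
  rw [gaussSum, Fintype.sum_unique, hz default, A.q_zero] at h
  simp only [neg_zero, expQZ_zero, mul_one, Nat.card_unique, Nat.cast_one, Real.sqrt_one,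
    Complex.ofReal_one, div_one] at h
  obtain ⟨n, hn⟩ := Complex.exp_eq_one_iff.1 h
  have h2 : (2 * Real.pi * Complex.I : ℂ) ≠ 0 := by simp [Real.pi_ne_zero]
  have h3 : (s / 8 : ℂ) = n := mul_left_cancel₀ h2 (by rw [hn]; ring)
  refine ⟨n, ?_⟩
  have : (s : ℂ) = 8 * n := by rw [← h3]; ring
  exact_mod_cast this

/-- Multiplication by $a$ permutes $D$ and changes the sign of $q$. -/
theorem conj_gaussSum [Fintype D] {a : ℤ} (ha : a * a ≡ -1 [ZMOD A.level]) :
    (starRingEnd ℂ) A.gaussSum = A.gaussSum := by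
  rw [gaussSum, map_sum]
  have hinj : Function.Injective fun y : D => a • y := by
    intro x y hxy
    have h1 (z : D) : a • a • z = -z := by
      rw [smul_smul, A.zsmul_congr ha, _root_.neg_smul, one_smul]
    have h2 : a • a • x = a • a • y := congrArg (a • ·) hxy
    rwa [h1, h1, neg_inj] at h2
  rw [← Equiv.sum_comp (Equiv.ofBijective _ (Finite.injective_iff_bijective.1 hinj))
    fun y => expQZ (-A.q y)]
  refine Finset.sum_congr rfl fun y _ => ?_
  rw [conj_expQZ, neg_neg, Equiv.ofBijective_apply, A.q_zsmul, A.zsmul_q_congr ha, _root_.neg_smul,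
    one_smul, neg_neg]

/-- The Gauss sum is real, so $e(s/8)$ is real and $e(s/4)=1$. -/
theorem IsModularForm.signature_dvd_of_neg_one_square [Finite D] {s k : ℤ} {F : ℍ → D → ℂ}
    (hF : A.IsModularForm s k F) (h0 : ∃ τ, F τ 0 ≠ 0) {a : ℤ}
    (ha : a * a ≡ -1 [ZMOD A.level]) : 4 ∣ s := by
  cases nonempty_fintype D
  have h := hF.mul_gaussSum h0
  have h1 := congrArg (starRingEnd ℂ) h
  rw [map_mul, conj_gaussSum ha, map_div₀, Complex.conj_ofReal, ← Complex.exp_conj, map_one] at h1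
  have hG : A.gaussSum ≠ 0 := right_ne_zero_of_mul (by rw [h]; exact one_ne_zero)
  have hsq : (Real.sqrt (Nat.card D) : ℂ) ≠ 0 := by
    have : (0 : ℝ) < Nat.card D := by exact_mod_cast Nat.card_pos
    exact_mod_cast (Real.sqrt_pos.2 this).ne'
  have h2 := (div_left_inj' hsq).1 (mul_right_cancel₀ hG (h.trans h1.symm))
  have h3 : Complex.exp (2 * Real.pi * Complex.I * (s / 4)) = 1 := by
    have h4 : (2 * Real.pi * Complex.I * (s / 4) : ℂ) = 2 * Real.pi * Complex.I * (s / 8) -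
        (starRingEnd ℂ) (2 * Real.pi * Complex.I * (s / 8)) := by
      simp [map_ofNat]
      ring
    rw [h4, Complex.exp_sub, h2, div_self (Complex.exp_ne_zero _)]
  obtain ⟨n, hn⟩ := Complex.exp_eq_one_iff.1 h3
  have h2 : (2 * Real.pi * Complex.I : ℂ) ≠ 0 := by simp [Real.pi_ne_zero]
  have h3 : (s / 4 : ℂ) = n := mul_left_cancel₀ h2 (by rw [hn]; ring)
  refine ⟨n, ?_⟩
  have : (s : ℂ) = 4 * n := by rw [← h3]; ring
  exact_mod_cast this

end DiscriminantForm

/-! ### The levels allowed by the bound -/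

theorem two_pow_hallOmega (N : ℕ) :
    2 ^ hallOmega N = ∏ p ∈ N.primeFactors, if N.factorization p = 1 then 2 else 1 := by
  rw [Finset.prod_ite, Finset.prod_const, Finset.prod_const_one, mul_one, hallOmega]

theorem le_localFactor {p N : ℕ} (hp : p ∈ N.primeFactors) :
    (if N.factorization p = 1 then 2 else 1) ≤ localFactor p N := by
  have hpp := Nat.prime_of_mem_primeFactors hp
  have := hpp.two_le
  unfold localFactor
  split_ifs <;> first | omega | exact Nat.one_le_pow _ _ hpp.pos

/-- For $\nu=1$ this is $4p\le(p+1)^2$; for $\nu\ge2$ it is $\nu\le2(\nu-1)$. -/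
theorem pow_factorization_mul_sq_le {p N : ℕ} (hp : p ∈ N.primeFactors) :
    p ^ N.factorization p * (if N.factorization p = 1 then 2 else 1) ^ 2 ≤
      localFactor p N ^ 2 := by
  have hpp := Nat.prime_of_mem_primeFactors hp
  have hν : N.factorization p ≠ 0 :=
    (hpp.factorization_pos_of_dvd (Nat.mem_primeFactors.1 hp).2.2
      (Nat.dvd_of_mem_primeFactors hp)).ne'
  unfold localFactor
  rw [if_neg hν]
  split_ifs with h
  · obtain ⟨t, ht⟩ := Nat.exists_eq_add_of_le hpp.two_le
    rw [h, pow_one, ht]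
    nlinarith
  · rw [one_pow, mul_one, ← pow_mul]
    exact Nat.pow_le_pow_right hpp.pos (by omega)

theorem mul_sq_le_of_bound {r N : ℕ} (hN : N ≠ 0)
    (h : r * ∏ p ∈ N.primeFactors, localFactor p N ≤ 12 * 2 ^ hallOmega N) :
    r ^ 2 * N ≤ 144 := by
  have h1 : N * (2 ^ hallOmega N) ^ 2 ≤ (∏ p ∈ N.primeFactors, localFactor p N) ^ 2 := by
    have h2 := Nat.prod_factorization_pow_eq_self hN
    rw [Nat.prod_factorization_eq_prod_primeFactors] at h2
    nth_rw 1 [← h2]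
    rw [two_pow_hallOmega, ← Finset.prod_pow, ← Finset.prod_pow, ← Finset.prod_mul_distrib]
    exact Finset.prod_le_prod' fun p hp => pow_factorization_mul_sq_le hp
  have h2 : 0 < (2 ^ hallOmega N) ^ 2 := by positivity
  refine Nat.le_of_mul_le_mul_right ?_ h2
  calc r ^ 2 * N * (2 ^ hallOmega N) ^ 2
      ≤ r ^ 2 * (∏ p ∈ N.primeFactors, localFactor p N) ^ 2 := by
        rw [mul_assoc]; exact Nat.mul_le_mul_left _ h1
    _ = (r * ∏ p ∈ N.primeFactors, localFactor p N) ^ 2 := (mul_pow _ _ _).symm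
    _ ≤ (12 * 2 ^ hallOmega N) ^ 2 := Nat.pow_le_pow_left h 2
    _ = 144 * (2 ^ hallOmega N) ^ 2 := by rw [mul_pow]; norm_num

/-- Every other local factor is at least its contribution to $2^\omega$, so $p+1\le24$ if $\nu=1$
and $p^{\nu-1}\le12$ if $\nu\ge2$. -/
theorem prime_le_of_bound {r N p : ℕ} (hr : 0 < r) (hp : p ∈ N.primeFactors)
    (h : r * ∏ p ∈ N.primeFactors, localFactor p N ≤ 12 * 2 ^ hallOmega N) : p ≤ 23 := by
  have hpp := Nat.prime_of_mem_primeFactors hp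
  have hν : N.factorization p ≠ 0 :=
    (hpp.factorization_pos_of_dvd (Nat.mem_primeFactors.1 hp).2.2
      (Nat.dvd_of_mem_primeFactors hp)).ne'
  have h1 : ∏ p ∈ N.primeFactors, localFactor p N ≤ 12 * 2 ^ hallOmega N :=
    (Nat.le_mul_of_pos_left _ hr).trans h
  rw [two_pow_hallOmega, ← Finset.mul_prod_erase _ _ hp, ← Finset.mul_prod_erase _ _ hp] at h1
  set W := ∏ x ∈ N.primeFactors.erase p, if N.factorization x = 1 then 2 else 1
  have h2 : W ≤ ∏ x ∈ N.primeFactors.erase p, localFactor x N :=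
    Finset.prod_le_prod' fun x hx => le_localFactor (Finset.mem_of_mem_erase hx)
  have hW : 0 < W := Finset.prod_pos fun x _ => by split_ifs <;> norm_num
  have h3 : localFactor p N ≤ 12 * if N.factorization p = 1 then 2 else 1 := by
    refine Nat.le_of_mul_le_mul_right ?_ hW
    rw [mul_assoc]
    exact (Nat.mul_le_mul_left _ h2).trans h1
  unfold localFactor at h3
  rw [if_neg hν] at h3
  split_ifs at h3 with h4
  · omega
  · have : p ≤ p ^ (N.factorization p - 1) := Nat.le_self_pow (by omega) p
    omega

/-- The primes below `24`. -/
def smallPrimes : Finset ℕ := {2, 3, 5, 7, 11, 13, 17, 19, 23}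

theorem mem_smallPrimes {p : ℕ} (hp : p.Prime) (h : p ≤ 23) : p ∈ smallPrimes := by
  interval_cases p <;> first | decide | (exfalso; revert hp; norm_num)

theorem prime_of_mem_smallPrimes {p : ℕ} (h : p ∈ smallPrimes) : p.Prime := by
  simp only [smallPrimes, Finset.mem_insert, Finset.mem_singleton] at h
  rcases h with rfl | rfl | rfl | rfl | rfl | rfl | rfl | rfl | rfl <;> norm_num

/-- The exponent of `p` in `N`, if it is at most `7`. -/
def exponent (p N : ℕ) : ℕ := ((Finset.range 7).filter fun j => p ^ (j + 1) ∣ N).card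

theorem exponent_eq {p N : ℕ} (hp : p.Prime) (hN : N ≠ 0) (h : N < 2 ^ 8) :
    exponent p N = N.factorization p := by
  have h1 : N.factorization p < 8 := by
    by_contra! h2
    have h3 := Nat.le_of_dvd (Nat.pos_of_ne_zero hN) (Nat.ordProj_dvd N p)
    have h4 := (Nat.pow_le_pow_left hp.two_le 8).trans (Nat.pow_le_pow_right hp.pos h2)
    omega
  rw [exponent]
  simp only [hp.pow_dvd_iff_le_factorization hN]
  rw [show (Finset.range 7).filter (fun j => j + 1 ≤ N.factorization p) =
    Finset.range (N.factorization p) by ext j; simp; omega, Finset.card_range]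

/-- The local factor of an exponent. -/
def exponentFactor (p ν : ℕ) : ℕ := if ν = 0 then 1 else if ν = 1 then p + 1 else p ^ (ν - 1)

-- The finite check, in a form the kernel evaluates: factorizations are replaced by explicit
-- divisibility counts, and the condition $N\mid(\prod p)^7$ says that only primes up to 23 occur,
-- with exponent at most 7.
set_option synthInstance.maxSize 10000 in
set_option maxRecDepth 100000 in
theorem mem_levelTable_of_small : ∀ N < 145, ∀ r < 13, 0 < N → 0 < r →
    N ∣ (∏ p ∈ smallPrimes, p) ^ 7 →
    r * ∏ p ∈ smallPrimes, exponentFactor p (exponent p N) ≤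
      12 * 2 ^ (smallPrimes.filter fun p => exponent p N = 1).card →
    (N = 1 → 4 ∣ r) → ((∃ a < N, N ∣ a * a + 1) → 2 ∣ r) → N ∈ levelTable (2 * r + 2) := by
  decide +kernel

theorem mem_levelTable {r N : ℕ} (hN : N ≠ 0) (hr : 0 < r)
    (h : r * ∏ p ∈ N.primeFactors, localFactor p N ≤ 12 * 2 ^ hallOmega N)
    (h1 : N = 1 → 4 ∣ r) (h2 : ∀ a : ℕ, N ∣ a * a + 1 → 2 ∣ r) :
    N ∈ levelTable (2 * r + 2) := by
  have hb := mul_sq_le_of_bound hN h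
  have hN0 := Nat.pos_of_ne_zero hN
  have hN' : N < 145 := by nlinarith [Nat.pow_le_pow_left hr 2]
  have hr' : r < 13 := by nlinarith
  have hsub : N.primeFactors ⊆ smallPrimes := fun p hp =>
    mem_smallPrimes (Nat.prime_of_mem_primeFactors hp) (prime_le_of_bound hr hp h)
  have hexp (p : ℕ) (hp : p ∈ smallPrimes) : exponent p N = N.factorization p :=
    exponent_eq (prime_of_mem_smallPrimes hp) hN (by omega)
  have hzero (p : ℕ) (hp : p ∉ N.primeFactors) : N.factorization p = 0 := by
    rwa [← Finsupp.notMem_support_iff, Nat.support_factorization]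
  refine mem_levelTable_of_small N hN' r hr' hN0 hr ?_ ?_ h1 (fun ⟨a, _, ha⟩ => h2 a ha)
  · conv_lhs => rw [← Nat.prod_factorization_pow_eq_self hN]
    rw [Nat.prod_factorization_eq_prod_primeFactors, ← Finset.prod_pow]
    refine (Finset.prod_dvd_prod_of_dvd _ _ fun p hp => pow_dvd_pow p ?_).trans
      (Finset.prod_dvd_prod_of_subset _ _ _ hsub)
    rw [← hexp p (hsub hp)]
    exact (Finset.card_filter_le _ _).trans (by simp)
  · rw [Finset.prod_congr rfl fun p hp => by rw [hexp p hp],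
      Finset.filter_congr fun p hp => by rw [hexp p hp],
      ← Finset.prod_subset hsub fun p _ hp => by rw [hzero p hp]; rfl,
      show (smallPrimes.filter fun p => N.factorization p = 1) =
        N.primeFactors.filter fun p => N.factorization p = 1 from ?_]
    · exact h
    · ext p
      simp only [Finset.mem_filter]
      refine ⟨fun hp => ⟨?_, hp.2⟩, fun hp => ⟨hsub hp.1, hp.2⟩⟩
      by_contra h3
      rw [hzero p h3] at hp
      exact absurd hp.2 (by norm_num)

/-! ### The level table and the theorem. -/

open DiscriminantForm in
theorem EvenLattice.CarriesReflectiveProduct.level_mem {V : Type*} [AddCommGroup V] [Module ℚ V]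
    {L : EvenLattice V} {n : ℕ} (h : L.CarriesReflectiveProduct n) (hn : 2 < n) (hev : Even n)
    (hreg : L.discForm.IsRegular) : L.discForm.level ∈ levelTable n := by
  obtain ⟨k, F, hk, hF⟩ := h
  obtain ⟨m, rfl⟩ := hev
  obtain ⟨r, rfl⟩ : ∃ r, m = r + 1 := ⟨m - 1, by omega⟩
  have hr : 0 < r := by omega
  have hfin := L.finite_discGroup
  have hs := HasLeadingTerm.isSingularAt hF.zero_component
  have h0 : ∃ τ, F τ 0 ≠ 0 := by
    by_contra! h0
    refine hs ?_
    simp only [h0]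
    exact Asymptotics.isBigO_zero _ _
  have hM := hF.isModularForm
  have hb := hF.toIsWeaklyReflective.weight_bound hreg hs
  have hk' : (k : ℚ) = -r := by rw [hk]; push_cast; ring
  have hb' : r * ∏ p ∈ L.discForm.level.primeFactors, localFactor p L.discForm.level ≤
      12 * 2 ^ hallOmega L.discForm.level := by
    rw [hk', neg_neg, div_mul_eq_mul_div, div_le_iff₀ (by norm_num), mul_comm (2 ^ _ : ℚ)] at hb
    exact_mod_cast hb
  -- With $n=2r+2$ the signature is $s=n-2=2r$, so $8\mid s$ and $4\mid s$ become $4\mid r$ and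
  -- $2\mid r$.
  rw [show r + 1 + (r + 1) = 2 * r + 2 by ring]
  refine mem_levelTable L.discForm.level_pos.ne' hr hb' (fun h1 => ?_) fun a ha => ?_
  · have := hM.signature_dvd_of_level_one h0 h1
    push_cast at this
    omega
  · have := hM.signature_dvd_of_neg_one_square h0 (a := a) (by
      rw [Int.modEq_comm, Int.modEq_iff_dvd, sub_neg_eq_add]
      exact_mod_cast ha)
    push_cast at this
    omega

theorem mainTheorem1 :
    (∀ {D : Type*} [AddCommGroup D] (A : DiscriminantForm D) (s k : ℤ) (F : ℍ → D → ℂ),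
      A.HasSignature s → Even s → A.IsRegular → A.IsWeaklyReflective s k F →
      DiscriminantForm.IsSingularAt F 0 →
      (-(k : ℝ) / 12) * ∏ p ∈ A.level.primeFactors, (localFactor p A.level : ℝ) ≤
        2 ^ hallOmega A.level) ∧
    (∀ {V : Type*} [AddCommGroup V] [Module ℚ V] (L : EvenLattice V) (n : ℕ),
      L.HasSignature n 2 → 2 < n → Even n → L.discForm.IsRegular →
      L.CarriesReflectiveProduct n →
      L.discForm.level ∈ levelTable n) := by
  refine ⟨fun A s k F _ _ hreg hF h0 => ?_, fun L n _ hn hev hreg h => h.level_mem hn hev hreg⟩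
  exact_mod_cast hF.weight_bound hreg h0
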